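/- Let $\mathbb T^3=(\mathbb R/2\pi\mathbb Z)^3$, $0<\theta<\tfrac13$, $T>0$. Consider the system \[ \partial_t v+\operatorname{div}(v\otimes v)+\nabla p+(-\Delta)^\theta v=-\operatorname{div}R,\qquad \operatorname{div}v=0\qquad\text{on }\mathbb T^3\times[0,T],\tag{FNSR} \] for $v$ with values in $\mathbb R^3$, $p$ in $\mathbb R$ and $R$ in the symmetric $3\times3$ matrices, where $(-\Delta)^s$ is the Fourier multiplier $|k|^{2s}$, $k\in\mathbb Z^3$. For $f$ on $\mathbb T^3$ put $\|f\|_N=\sup|f|+\sum_{k=1}^N\max_{|\beta|=k}\sup|\partial_\beta f|$ and $\|f\|_{H^{-1}}^2=\sum_{k\in\mathbb Z^3}(1+|k|^2)^{-1}|\hat f(k)|^2$. Let $(\tilde v,\tilde p,\tilde R)$ be a smooth solution of (FNSR) on $\mathbb T^3\times[0,T]$, let $S\in C^\infty(\mathbb T^3\times[0,T])$ have values in the symmetric positive definite $3\times 3$ matrices, and let $\bar\alpha\in(0,1)$. Then there are constants $C\ge1$ and $C_N\geq1$ ($N\in\mathbb N$), depending only on $\theta,T,(\tilde v,\tilde p,\tilde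 R),S,\bar\alpha$ (and $C_N$ also on $N$), such that for every $\varepsilon>0$ and every real $\lambda>1$ there is a smooth solution $(\check v,\check p,\check R)$ of (FNSR) on $\mathbb T^3\times[0,T]$ with the following properties. 1. $(\check v,\check p,\check R)(\cdot,t)=(\tilde v,\tilde p,\tilde R)(\cdot,t)$ for all $t\in[0,T]$ outside the support in time of $\operatorname{tr}S$, that is, the closure of the set of times at which $\operatorname{tr}S(\cdot,t)\not\equiv0$. 2. $\int_{\mathbb T^3}(|\check v|^2+\operatorname{tr}\check R)(x,t)\,dx=\int_{\mathbb T^3}(|\tilde v|^2+\operatorname{tr}\tilde R)(x,t)\,dx$ for all $t\in[0,T]$. 3. For all $t\in[0,T]$: $\|(\check v-\tilde v)(t)\|_{H^{-1}}\le C\lambda^{-1}$; $\|\check v(t)\|_k\le C\lambda^k$ for $k=1,2$; and $\|(\tilde R-\check R-S)(t)\|_N\le C_N\lambda^{N+2\theta+\bar\alpha-1}$ for all $N\in\mathbb N=\{0,1,2,\dots\}$. 4. $\operatorname{tr}(\tilde R-\check R-S)(x,t)=\mu(t)$ depends on $t$ only, $\mu$ is differentiable on $[0,T]$, and $|\mu'(t)|\le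 C\lambda^{\bar\alpha}$ for all $t\in[0,T]$. 5. The function $\check{\mathcal T}(t)=\int_0^t\int_{\mathbb T^3}\big(|(-\Delta)^{\theta/2}\check v(x,s)|^2-|(-\Delta)^{\theta/2}\tilde v(x,s)|^2\big)\,dx\,ds$ is differentiable on $[0,T]$ and $|\check{\mathcal T}'(t)|\le C\lambda^{2(\theta+\varepsilon)}$ for all $t\in[0,T]$. Derivatives in time at the end points of $[0,T]$ are one-sided. -/

import Mathlib

open Set MeasureTheory
open scoped ContDiff ENNReal

noncomputable section

namespace HypoNS

/-- Euclidean space `ℝ³`. Functions on the torus `𝕋³ = (ℝ/2πℤ)³` are the functions on `ℝ³`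
that are `2π`-periodic in each coordinate. -/
abbrev E3 : Type := EuclideanSpace ℝ (Fin 3)

/-- The `i`-th standard basis vector. -/
def stdVec (i : Fin 3) : E3 := EuclideanSpace.single i (1 : ℝ)

/-- The fundamental domain `[0, 2π)³` of the torus. -/
def cube : Set E3 := {x | ∀ i, x i ∈ Ico (0 : ℝ) (2 * Real.pi)}

/-- Periodicity of a function on `ℝ³` with respect to the lattice `2πℤ³`. -/
def Periodic3 {F : Type*} (f : E3 → F) : Prop :=
  ∀ (i : Fin 3) (x : E3), f (x + (2 * Real.pi) • stdVec i) = f x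

/-- `f ∈ C^∞(𝕋³ × [0,T]; F)`, smoothness being up to the end points of the time interval.
Only the values `f t x` with `t ∈ [0,T]` matter. -/
def SmoothField {F : Type*} [NormedAddCommGroup F] [NormedSpace ℝ F]
    (T : ℝ) (f : ℝ → E3 → F) : Prop :=
  ContDiffOn ℝ ∞ (fun z : ℝ × E3 => f z.1 z.2) (Icc 0 T ×ˢ univ) ∧
    ∀ t ∈ Icc 0 T, Periodic3 (f t)

/-- The partial derivative `∂ᵢ f` in space. -/
def pd {F : Type*} [NormedAddCommGroup F] [NormedSpace ℝ F]
    (i : Fin 3) (f : E3 → F) (x : E3) : F :=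
  fderiv ℝ f x (stdVec i)

/-- `|k|²` for a frequency `k ∈ ℤ³`. -/
def freqSq (k : Fin 3 → ℤ) : ℝ := ∑ i, (k i : ℝ) ^ 2

/-- `k · x`. -/
def phase (k : Fin 3 → ℤ) (x : E3) : ℝ := ∑ i, (k i : ℝ) * x i

/-- Fourier coefficient `(2π)⁻³ ∫_{𝕋³} f(x) e^{-ik·x} dx`. -/
def fourierCoef (f : E3 → ℝ) (k : Fin 3 → ℤ) : ℂ :=
  ((2 * Real.pi) ^ 3 : ℝ)⁻¹ •
    ∫ x in cube, (f x : ℂ) * Complex.exp (-(Complex.I * (phase k x : ℂ)))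

/-- The fractional Laplacian `(-Δ)^s f (x) = ∑ₖ |k|^{2s} f̂(k) e^{ik·x}` of a real function on
the torus, for `s > 0`. The sum of the series is real since `f` is. -/
def fracLap (s : ℝ) (f : E3 → ℝ) (x : E3) : ℝ :=
  (∑' k : Fin 3 → ℤ,
    ((freqSq k ^ s : ℝ) : ℂ) * fourierCoef f k * Complex.exp (Complex.I * (phase k x : ℂ))).re

/-- The dissipation density `|(-Δ)^{θ/2} v|²` of a vector field. -/
def dissipation (θ : ℝ) (v : E3 → E3) (x : E3) : ℝ :=
  ∑ i, (fracLap (θ / 2) (fun y => v y i) x) ^ 2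

/-- The seminorm `[f]_k`: the maximum, over all partial derivatives of order `k`, of the supremum
norm. The partial derivatives of order `k` are the `∂_{σ 0} ⋯ ∂_{σ (k-1)} f`. -/
def cSemi {F : Type*} [NormedAddCommGroup F] [NormedSpace ℝ F]
    (k : ℕ) (f : E3 → F) : ℝ≥0∞ :=
  ⨆ σ : Fin k → Fin 3, ⨆ x : E3, ‖iteratedFDeriv ℝ k f x (fun j => stdVec (σ j))‖ₑ

/-- The norm `‖f‖_N = ‖f‖₀ + ∑_{k=1}^N [f]_k`, with `[f]₀ = ‖f‖₀`. -/
def cNorm {F : Type*} [NormedAddCommGroup F] [NormedSpace ℝ F]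
    (N : ℕ) (f : E3 → F) : ℝ≥0∞ :=
  ∑ k ∈ Finset.range (N + 1), cSemi k f

/-- A 3-by-3 matrix as a vector with nine entries, so that its norm is the Euclidean
(Frobenius) one. -/
def matVec (M : Matrix (Fin 3) (Fin 3) ℝ) : EuclideanSpace ℝ (Fin 3 × Fin 3) :=
  WithLp.toLp 2 (fun ij => M ij.1 ij.2)

/-- The norm `‖w‖_{H^{-1}(𝕋³)} = (∑ₖ (1 + |k|²)⁻¹ |ŵ(k)|²)^{1/2}` of a vector field. -/
def hNegOneNorm (w : E3 → E3) : ℝ≥0∞ :=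
  (∑' k : Fin 3 → ℤ,
    ENNReal.ofReal ((1 + freqSq k)⁻¹ * ∑ i, ‖fourierCoef (fun y => w y i) k‖ ^ 2)) ^ (1 / 2 : ℝ)

/-- `(v, p, R)` is a smooth solution on `𝕋³ × [0,T]` of
`∂ₜ v + div (v ⊗ v) + ∇p + (-Δ)^θ v = -div R`, `div v = 0`,
with values in `ℝ³ × ℝ ×` (symmetric matrices). -/
structure IsSmoothSolution (θ T : ℝ) (v : ℝ → E3 → E3) (p : ℝ → E3 → ℝ)
    (R : ℝ → E3 → Matrix (Fin 3) (Fin 3) ℝ) : Prop where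
  smooth_v : SmoothField T v
  smooth_p : SmoothField T p
  smooth_R : ∀ i j, SmoothField T (fun t x => R t x i j)
  symm_R : ∀ t ∈ Icc 0 T, ∀ x, (R t x).IsSymm
  momentum : ∀ t ∈ Icc 0 T, ∀ x, ∀ i,
    derivWithin (fun s => v s x i) (Icc 0 T) t
      + ∑ j, pd j (fun y => v t y i * v t y j) x
      + pd i (p t) x
      + fracLap θ (fun y => v t y i) x
      = -∑ j, pd j (fun y => R t y i j) x
  div_free : ∀ t ∈ Icc 0 T, ∀ x, ∑ i, pd i (fun y => v t y i) x = 0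

/-- The support in time of `tr S`: the closure of the set of times at which `tr S` does not
vanish identically in space. -/
def timeSuppTrace (T : ℝ) (S : ℝ → E3 → Matrix (Fin 3) (Fin 3) ℝ) : Set ℝ :=
  closure {t | t ∈ Icc 0 T ∧ ∃ x, (S t x).trace ≠ 0}

/-- The difference of the dissipated energies of `v₁` and `v₀` up to time `t`,
`∫₀ᵗ ∫_{𝕋³} (|(-Δ)^{θ/2} v₁|² - |(-Δ)^{θ/2} v₀|²) dx ds`. -/
def dissipationGap (θ : ℝ) (v₁ v₀ : ℝ → E3 → E3) (t : ℝ) : ℝ :=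
  ∫ s in (0 : ℝ)..t, ∫ x in cube, (dissipation θ (v₁ s) x - dissipation θ (v₀ s) x)

end HypoNS

end

open HypoNS

/-! This is one step of convex integration. The constants may depend on the given solution and on
`S`, so neither mollification nor a subdivision of time is needed: one frequency `n = ⌈λ⌉` and one
Lagrangian map `Φ`, defined on all of `[0,T]` and transported by the given velocity `v`, are enough.

The perturbation is a curl, `w = n⁻¹ curl (∑ a_J ∇(l_J·Φ) G_J(nΦ))`. Its leading part is `∑ a_J
(∇(k_J·Φ) × ∇(l_J·Φ)) g_J(nΦ)`, a superposition of pipes along integer directions with pairwise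
disjoint supports (`exists_pipeFamily`). Products of different pipes vanish, so the mean of `w ⊗ w`
is a sum of rank one matrices. The amplitudes are chosen so that this mean equals `S`: the pull-back
of `S` to Lagrangian coordinates takes values in a compact set of positive definite matrices, on
which a smooth decomposition into squares times integer rank one matrices exists
(`exists_decomposition`, `exists_amplitude`).

No term of the force costs a factor `n`. The material derivative does not see the phase `nΦ`
(`matD_osc`), and the oscillating part of `w ⊗ w` is constant along the pipe it belongs to
(`tangent_transport`). Hence the force, the fractional dissipation apart, is a finite sum of terms
`c(t,x) q(t,nΦ)` with `q` of mean zero (`exists_oscClass_force`). Such a sum is the divergence of a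
symmetric matrix of size `n⁻¹` plus a sum of the same kind of size `n⁻¹`. After ten iterations
(`exists_antidivergence`) the remainder is so small that it can be removed by the inverse Laplacian
with a crude loss of derivatives. Applied to the matrix of `w`, the operator `(-Δ)^θ` costs
`n^{2θ}`, which gives the size `n^{2θ-1}` of the new stress (`exists_small_stress`).

A multiple of the identity, compensated by the pressure and by a function `μ(t)`, makes the trace of
the error constant in space and the energy balance exact; `μ` is the mean of `2v·w + |w|² - tr S`.
Its time derivative is bounded because the mean of `∂ₜh` is that of the material derivative up to
`(div v)h`. The `H⁻¹` bound holds since `w` is `n⁻¹` times the curl of a bounded field, and the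
dissipation bound since `(-Δ)^{θ/2}` costs `n^θ`.

The analytic tools are built on the ring `Sm` of smooth functions on `ℝ × 𝕋³`: Fourier series and
multipliers, the singular integral for `(-Δ)^s` (giving the sharp cost in sup norm,
`exists_fracMult_bound`), smooth dependence of flows on initial data (`IsFlow.contDiff`), and the
extension of functions smooth up to the end points of `[0,T]` to all times
(`SmoothField.exists_sm_compact`). -/

noncomputable section

open Set MeasureTheory Filter Topology
open scoped ContDiff ENNReal Pointwise

namespace HypoNS

/-! ### Smooth functions on `ℝ × 𝕋³` -/

/-- The algebra of smooth real functions on `ℝ × 𝕋³`, as functions of time and space. -/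
def smoothPeriodic : Subalgebra ℝ (ℝ → E3 → ℝ) where
  carrier := {f | ContDiff ℝ ∞ (fun z : ℝ × E3 => f z.1 z.2) ∧ ∀ t, Periodic3 (f t)}
  mul_mem' := fun {f g} hf hg => ⟨hf.1.mul hg.1, fun t i x => by
    simp only [Pi.mul_apply]; rw [hf.2 t i x, hg.2 t i x]⟩
  add_mem' := fun {f g} hf hg => ⟨hf.1.add hg.1, fun t i x => by
    simp only [Pi.add_apply]; rw [hf.2 t i x, hg.2 t i x]⟩
  algebraMap_mem' := fun r => ⟨contDiff_const, fun _ _ _ => rfl⟩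

/-- The type of smooth real functions on `ℝ × 𝕋³`. -/
def Sm : Type := smoothPeriodic

instance : CommRing Sm := inferInstanceAs (CommRing smoothPeriodic)
instance : Algebra ℝ Sm := inferInstanceAs (Algebra ℝ smoothPeriodic)

/-- The underlying function. -/
def Sm.fn (f : Sm) : ℝ → E3 → ℝ := Subtype.val (p := (· ∈ smoothPeriodic)) f

instance : CoeFun Sm (fun _ => ℝ → E3 → ℝ) := ⟨Sm.fn⟩

namespace Sm

@[ext] theorem ext {f g : Sm} (h : ∀ t x, f t x = g t x) : f = g :=
  Subtype.ext (funext fun t => funext fun x => h t x)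

@[simp] theorem add_apply (f g : Sm) (t : ℝ) (x : E3) : (f + g) t x = f t x + g t x := rfl
@[simp] theorem mul_apply (f g : Sm) (t : ℝ) (x : E3) : (f * g) t x = f t x * g t x := rfl
@[simp] theorem sub_apply (f g : Sm) (t : ℝ) (x : E3) : (f - g) t x = f t x - g t x := rfl
@[simp] theorem neg_apply (f : Sm) (t : ℝ) (x : E3) : (-f) t x = -f t x := rfl
@[simp] theorem smul_apply (r : ℝ) (f : Sm) (t : ℝ) (x : E3) : (r • f) t x = r * f t x := rfl
@[simp] theorem zero_apply (t : ℝ) (x : E3) : (0 : Sm) t x = 0 := rfl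
@[simp] theorem one_apply (t : ℝ) (x : E3) : (1 : Sm) t x = 1 := rfl
@[simp] theorem algebraMap_apply (r : ℝ) (t : ℝ) (x : E3) : (algebraMap ℝ Sm r) t x = r := rfl
@[simp] theorem pow_apply (f : Sm) (n : ℕ) (t : ℝ) (x : E3) : (f ^ n) t x = f t x ^ n := rfl

/-- Evaluation at a point, as an algebra homomorphism. -/
def eval (t : ℝ) (x : E3) : Sm →ₐ[ℝ] ℝ where
  toFun f := f t x
  map_one' := rfl
  map_mul' _ _ := rfl
  map_zero' := rfl
  map_add' _ _ := rfl
  commutes' _ := rfl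

@[simp] theorem sum_apply {ι : Type*} (s : Finset ι) (f : ι → Sm) (t : ℝ) (x : E3) :
    (∑ i ∈ s, f i) t x = ∑ i ∈ s, f i t x := map_sum (eval t x) f s

/-- The function of space-time points. -/
def unc (f : Sm) : ℝ × E3 → ℝ := fun z => f z.1 z.2

theorem smooth (f : Sm) : ContDiff ℝ ∞ f.unc := f.2.1

theorem differentiable (f : Sm) : Differentiable ℝ f.unc := f.smooth.differentiable (by simp)

theorem periodic (f : Sm) (t : ℝ) : Periodic3 (f t) := f.2.2 t

theorem contDiff_slice (f : Sm) (t : ℝ) : ContDiff ℝ ∞ (f t) :=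
  f.smooth.comp (contDiff_const.prodMk contDiff_id : ContDiff ℝ ∞ fun x : E3 => (t, x))

theorem continuous_slice (f : Sm) (t : ℝ) : Continuous (f t) := (f.contDiff_slice t).continuous

theorem unc_translate (f : Sm) (i : Fin 3) :
    (fun z : ℝ × E3 => f.unc (z + (0, (2 * Real.pi) • stdVec i))) = f.unc := by
  funext z
  simp [unc, f.periodic z.1 i z.2]

theorem fderiv_unc_translate (f : Sm) (i : Fin 3) (t : ℝ) (x : E3) :
    fderiv ℝ f.unc (t, x + (2 * Real.pi) • stdVec i) = fderiv ℝ f.unc (t, x) := by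
  have h := fderiv_comp_add_right (𝕜 := ℝ) (f := f.unc) (x := (t, x))
    ((0, (2 * Real.pi) • stdVec i) : ℝ × E3)
  rw [f.unc_translate i] at h
  rw [h]
  simp

/-- The directional derivative of a smooth function in a space-time direction. -/
def dirDeriv (a : ℝ × E3) (f : Sm) : Sm :=
  ⟨fun t x => fderiv ℝ f.unc (t, x) a,
    ((f.smooth.fderiv_right (m := ∞) (by simp)).clm_apply contDiff_const),
    fun t i x => by beta_reduce; rw [f.fderiv_unc_translate]⟩

theorem dirDeriv_apply (a : ℝ × E3) (f : Sm) (t : ℝ) (x : E3) :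
    dirDeriv a f t x = fderiv ℝ f.unc (t, x) a := rfl

/-- The directional derivative as a derivation. -/
def D (a : ℝ × E3) : Derivation ℝ Sm Sm :=
  Derivation.mk'
    { toFun := dirDeriv a
      map_add' := fun f g => by
        ext t x
        have : (f + g).unc = f.unc + g.unc := rfl
        simp only [dirDeriv_apply, add_apply, this]
        rw [fderiv_add f.differentiable.differentiableAt g.differentiable.differentiableAt]; rfl
      map_smul' := fun r f => by
        ext t x
        have : (r • f).unc = r • f.unc := rfl
        simp only [dirDeriv_apply, smul_apply, this, RingHom.id_apply]
        rw [fderiv_const_smul f.differentiable.differentiableAt]; rfl }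
    (fun f g => by
      ext t x
      have : (f * g).unc = f.unc * g.unc := rfl
      simp only [LinearMap.coe_mk, AddHom.coe_mk, dirDeriv_apply, this, smul_eq_mul, add_apply,
        mul_apply]
      rw [fderiv_mul f.differentiable.differentiableAt g.differentiable.differentiableAt]
      simp [unc])

theorem D_apply (a : ℝ × E3) (f : Sm) (t : ℝ) (x : E3) :
    D a f t x = fderiv ℝ f.unc (t, x) a := rfl

theorem unc_D (a : ℝ × E3) (f : Sm) : (D a f).unc = fun z => fderiv ℝ f.unc z a := rfl

theorem D_mul (a : ℝ × E3) (f g : Sm) : D a (f * g) = D a f * g + f * D a g := by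
  rw [Derivation.leibniz]; simp only [smul_eq_mul]; ring

theorem D_comm (a b : ℝ × E3) (f : Sm) : D a (D b f) = D b (D a f) := by
  ext t x
  have hd : DifferentiableAt ℝ (fderiv ℝ f.unc) (t, x) :=
    ((f.smooth.fderiv_right (m := ∞) (by simp)).differentiable (by simp)).differentiableAt
  have key : ∀ a b : ℝ × E3,
      D a (D b f) t x = fderiv ℝ (fderiv ℝ f.unc) (t, x) a b := by
    intro a b
    rw [D_apply, unc_D, fderiv_clm_apply hd (differentiableAt_const b)]
    simp
  rw [key, key]
  exact (f.smooth.contDiffAt.isSymmSndFDerivAt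
    (by rw [minSmoothness_of_isRCLikeNormedField]; exact WithTop.coe_le_coe.2 (le_top (a := (2 : ℕ∞))))) a b

/-- The space derivative `∂ᵢ`. -/
def dx (i : Fin 3) : Derivation ℝ Sm Sm := D (0, stdVec i)

/-- The time derivative. -/
def dt : Derivation ℝ Sm Sm := D (1, 0)

theorem dx_mul (i : Fin 3) (f g : Sm) : dx i (f * g) = dx i f * g + f * dx i g := D_mul _ f g
theorem dt_mul (f g : Sm) : dt (f * g) = dt f * g + f * dt g := D_mul _ f g
theorem dx_comm (i j : Fin 3) (f : Sm) : dx i (dx j f) = dx j (dx i f) := D_comm _ _ f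

theorem hasFDerivAt_slice (f : Sm) (t : ℝ) (x : E3) :
    HasFDerivAt (f t) ((fderiv ℝ f.unc (t, x)).comp (ContinuousLinearMap.inr ℝ ℝ E3)) x := by
  have h1 : HasFDerivAt (fun y : E3 => (t, y)) (ContinuousLinearMap.inr ℝ ℝ E3) x :=
    hasFDerivAt_prodMk_right t x
  exact (f.differentiable (t, x)).hasFDerivAt.comp x h1

theorem dx_apply (i : Fin 3) (f : Sm) (t : ℝ) (x : E3) : dx i f t x = pd i (f t) x := by
  rw [pd, (f.hasFDerivAt_slice t x).fderiv]
  rfl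

theorem hasDerivAt_time (f : Sm) (t : ℝ) (x : E3) :
    HasDerivAt (fun s => f s x) (dt f t x) t := by
  have h1 : HasFDerivAt (fun s : ℝ => (s, x)) (ContinuousLinearMap.inl ℝ ℝ E3) t :=
    hasFDerivAt_prodMk_left t x
  have h2 := ((f.differentiable (t, x)).hasFDerivAt.comp t h1).hasDerivAt
  exact h2

theorem fderiv_eq (f : Sm) (z a : ℝ × E3) :
    fderiv ℝ f.unc z a = a.1 * dt f z.1 z.2 + ∑ i, a.2 i * dx i f z.1 z.2 := by
  have h : a = a.1 • ((1, 0) : ℝ × E3) + ∑ i, a.2 i • ((0, stdVec i) : ℝ × E3) := by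
    ext j
    · simp [Prod.fst_sum]
    · simp only [Prod.smul_mk, smul_eq_mul, mul_one, smul_zero, mul_zero, Prod.snd_add,
        Prod.snd_sum, zero_add]
      fin_cases j <;> simp [Fin.sum_univ_three, stdVec]
  conv_lhs => rw [h]
  simp only [map_add, map_smul, map_sum, smul_eq_mul]
  rfl

theorem pd_eq_zero_of_const {f : E3 → ℝ} (h : ∀ x y, f x = f y) (i : Fin 3) (x : E3) :
    pd i f x = 0 := by
  have : f = fun _ => f 0 := funext fun y => h y 0
  rw [pd, this]; simp

end Sm

/-- A function with values in space-time functions that intertwines directional derivatives has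
smooth values. -/
theorem contDiff_of_intertwine (Θ : Sm → ℝ × E3 → ℝ)
    (h : ∀ f z, ∃ L : (ℝ × E3) →L[ℝ] ℝ, HasFDerivAt (Θ f) L z ∧ ∀ a, L a = Θ (Sm.D a f) z)
    (f : Sm) : ContDiff ℝ ∞ (Θ f) := by
  rw [contDiff_infty]
  intro n
  induction n generalizing f with
  | zero =>
    refine contDiff_zero.2 (continuous_iff_continuousAt.2 fun z => ?_)
    obtain ⟨L, hL, -⟩ := h f z
    exact hL.continuousAt
  | succ n ih =>
    push_cast
    rw [contDiff_succ_iff_fderiv_apply]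
    refine ⟨fun z => ?_, by simp, fun a => ?_⟩
    · obtain ⟨L, hL, -⟩ := h f z
      exact hL.differentiableAt
    · have : (fun z => fderiv ℝ (Θ f) z a) = Θ (Sm.D a f) := by
        funext z
        obtain ⟨L, hL, hLa⟩ := h f z
        rw [hL.fderiv, hLa]
      rw [this]
      exact ih _

/-! ### Periodic functions -/

/-- The lattice vector `2πk`. -/
def latVec (k : Fin 3 → ℤ) : E3 := WithLp.toLp 2 fun i => 2 * Real.pi * k i

@[simp] theorem latVec_apply (k : Fin 3 → ℤ) (i : Fin 3) : latVec k i = 2 * Real.pi * k i := rfl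

theorem Periodic3.add_int {F : Type*} {f : E3 → F} (hf : Periodic3 f) (i : Fin 3) (m : ℤ) (x : E3) :
    f (x + (2 * Real.pi * m) • stdVec i) = f x := by
  have h : Function.Periodic f ((2 * Real.pi) • stdVec i) := fun x => hf i x
  have := h.zsmul m x
  rw [← this]
  congr 2
  rw [← Int.cast_smul_eq_zsmul ℝ, smul_smul, mul_comm]

theorem Periodic3.add_lat {F : Type*} {f : E3 → F} (hf : Periodic3 f) (k : Fin 3 → ℤ) (x : E3) :
    f (x + latVec k) = f x := by
  have h : x + latVec k = x + (2 * Real.pi * k 0) • stdVec 0 + (2 * Real.pi * k 1) • stdVec 1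
      + (2 * Real.pi * k 2) • stdVec 2 := by
    ext j
    fin_cases j <;> simp [stdVec]
  rw [h, hf.add_int, hf.add_int, hf.add_int]

theorem exists_lat_mem_cube (x : E3) : ∃ k, x + latVec k ∈ cube := by
  have hp : (0 : ℝ) < 2 * Real.pi := by positivity
  refine ⟨fun i => -⌊x i / (2 * Real.pi)⌋, fun i => ?_⟩
  have h1 := Int.floor_le (x i / (2 * Real.pi))
  have h2 := Int.lt_floor_add_one (x i / (2 * Real.pi))
  rw [le_div_iff₀ hp] at h1
  rw [div_lt_iff₀ hp] at h2
  simp only [PiLp.add_apply, latVec_apply, Int.cast_neg]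
  constructor <;> nlinarith

theorem isCompact_closedCube : IsCompact {x : E3 | ∀ i, x i ∈ Icc (0 : ℝ) (2 * Real.pi)} := by
  have h : IsCompact (Set.pi univ fun _ : Fin 3 => Icc (0 : ℝ) (2 * Real.pi)) :=
    isCompact_univ_pi fun _ => isCompact_Icc
  have := h.image (PiLp.continuous_toLp 2 (fun _ : Fin 3 => ℝ))
  convert this using 1
  ext x
  exact ⟨fun hx => ⟨x.ofLp, fun i _ => hx i, rfl⟩, by rintro ⟨y, hy, rfl⟩; exact fun i => hy i trivial⟩

theorem cube_subset_closedCube : cube ⊆ {x : E3 | ∀ i, x i ∈ Icc (0 : ℝ) (2 * Real.pi)} :=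
  fun _ hx i => Ico_subset_Icc_self (hx i)

namespace Sm

theorem exists_bound_of_isCompact (f : Sm) {K : Set ℝ} (hK : IsCompact K) :
    ∃ C, 0 < C ∧ ∀ t ∈ K, ∀ x, |f t x| ≤ C := by
  obtain ⟨C, hC⟩ := (hK.prod isCompact_closedCube).exists_bound_of_continuousOn
    f.smooth.continuous.continuousOn
  refine ⟨max C 1, by positivity, fun t ht x => ?_⟩
  obtain ⟨k, hk⟩ := exists_lat_mem_cube x
  rw [← (f.periodic t).add_lat k x]
  exact (hC (t, x + latVec k) ⟨ht, cube_subset_closedCube hk⟩).trans (le_max_left _ _)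

end Sm

section TorusIntegration

/-! ### Integration over the torus -/

/-- The measure on `ℝ / ℤ` is the Haar probability measure. -/
local instance : MeasureSpace UnitAddCircle := ⟨AddCircle.haarAddCircle⟩

local instance : Measure.IsAddHaarMeasure (volume : Measure UnitAddCircle) :=
  inferInstanceAs (Measure.IsAddHaarMeasure AddCircle.haarAddCircle)

local instance : IsProbabilityMeasure (volume : Measure UnitAddCircle) :=
  inferInstanceAs (IsProbabilityMeasure AddCircle.haarAddCircle)

/-- The representative in `(0, 2π]³` of a point of the unit torus. -/
def torusPt (y : UnitAddTorus (Fin 3)) : E3 :=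
  WithLp.toLp 2 fun i => 2 * Real.pi * (AddCircle.equivIoc (1 : ℝ) 0 (y i)).1

/-- The class in the unit torus of `x / 2π`. -/
def torusClass (x : E3) : UnitAddTorus (Fin 3) := fun i => ((x i / (2 * Real.pi) : ℝ) : UnitAddCircle)

theorem torusClass_torusPt (y : UnitAddTorus (Fin 3)) : torusClass (torusPt y) = y := by
  funext i
  have : 2 * Real.pi ≠ 0 := by positivity
  simp only [torusClass, torusPt, mul_div_cancel_left₀ _ this]
  exact AddCircle.coe_equivIoc

theorem torusClass_sub (x y : E3) : torusClass (x - y) = torusClass x - torusClass y := by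
  funext i
  simp [torusClass, sub_div]

theorem exists_lat_of_torusClass_eq {x y : E3} (h : torusClass x = torusClass y) :
    ∃ k, x = y + latVec k := by
  have hp : 2 * Real.pi ≠ 0 := by positivity
  have : ∀ i, ∃ m : ℤ, x i = y i + 2 * Real.pi * m := by
    intro i
    have h1 := congrFun h i
    simp only [torusClass] at h1
    have h2 : ((x i / (2 * Real.pi) - y i / (2 * Real.pi) : ℝ) : UnitAddCircle) = 0 := by
      rw [AddCircle.coe_sub, h1, sub_self]
    obtain ⟨m, hm⟩ := (AddCircle.coe_eq_zero_iff (1 : ℝ)).1 h2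
    refine ⟨m, ?_⟩
    simp only [zsmul_eq_mul, mul_one] at hm
    field_simp at hm
    linarith
  choose k hk using this
  exact ⟨k, by ext i; simpa using hk i⟩

theorem Periodic3.eq_of_torusClass_eq {F : Type*} {g : E3 → F} (hg : Periodic3 g) {x y : E3}
    (h : torusClass x = torusClass y) : g x = g y := by
  obtain ⟨k, rfl⟩ := exists_lat_of_torusClass_eq h
  exact hg.add_lat k y

/-- The function on the unit torus induced by a function on `ℝ³`. -/
def liftTorus {F : Type*} (g : E3 → F) (y : UnitAddTorus (Fin 3)) : F := g (torusPt y)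

theorem liftTorus_class {F : Type*} {g : E3 → F} (hg : Periodic3 g) (x : E3) :
    liftTorus g (torusClass x) = g x :=
  hg.eq_of_torusClass_eq (torusClass_torusPt _)

theorem isOpenQuotientMap_torusClass : IsOpenQuotientMap torusClass := by
  have h1 : IsOpenQuotientMap (Pi.map (fun _ : Fin 3 => ((↑) : ℝ → UnitAddCircle))) :=
    IsOpenQuotientMap.piMap fun _ => QuotientAddGroup.isOpenQuotientMap_mk
  have hp : (2 * Real.pi)⁻¹ ≠ 0 := by positivity
  let e : E3 ≃ₜ (Fin 3 → ℝ) := (PiLp.homeomorph 2 (fun _ : Fin 3 => ℝ)).trans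
    (Homeomorph.smulOfNeZero ((2 * Real.pi)⁻¹) hp)
  have h2 := h1.comp e.isOpenQuotientMap
  convert h2 using 1
  funext x i
  simp [torusClass, e, Pi.map, div_eq_inv_mul]
  rfl

theorem continuous_liftTorus {F : Type*} [TopologicalSpace F] {g : E3 → F} (hg : Periodic3 g)
    (hc : Continuous g) : Continuous (liftTorus g) := by
  rw [isOpenQuotientMap_torusClass.isQuotientMap.continuous_iff]
  convert hc using 1
  funext x
  exact liftTorus_class hg x

/-- Passes from Lebesgue measure on the cube to Haar probability measure on the unit torus; the
factor is the Jacobian of `x ↦ 2πx`. Translation invariance and Parseval become available in this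
way. -/
theorem setIntegral_cube_eq {F : Type*} [NormedAddCommGroup F] [NormedSpace ℝ F] {g : E3 → F}
    (hg : Periodic3 g) :
    ∫ x in cube, g x = ((2 * Real.pi) ^ 3) • ∫ y, liftTorus g y := by
  have hp : (0 : ℝ) < 2 * Real.pi := by positivity
  rw [UnitAddTorus.integral_preimage (liftTorus g) 0]
  have h1 : ∀ x : Fin 3 → ℝ, liftTorus g (fun i => (x i : UnitAddCircle))
      = (fun y : Fin 3 → ℝ => g (WithLp.toLp 2 y)) ((2 * Real.pi) • x) := by
    intro x
    beta_reduce
    rw [← liftTorus_class hg]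
    congr 1
    funext i
    simp [torusClass, hp.ne']
  simp_rw [h1]
  rw [Measure.setIntegral_comp_smul_of_pos volume (fun y : Fin 3 → ℝ => g (WithLp.toLp 2 y)) _ hp]
  simp only [Module.finrank_fintype_fun_eq_card, Fintype.card_fin]
  rw [smul_inv_smul₀ (by positivity)]
  have h2 : ((2 * Real.pi) • {x : Fin 3 → ℝ | ∀ i, x i ∈ Ioc ((0 : Fin 3 → ℝ) i) ((0 : Fin 3 → ℝ) i + 1)})
      = Set.pi univ fun _ : Fin 3 => Ioc (0 : ℝ) (2 * Real.pi) := by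
    ext x
    rw [Set.mem_smul_set_iff_inv_smul_mem₀ hp.ne']
    simp only [mem_ofPred_eq, Set.mem_pi, mem_univ, true_imp_iff, Pi.smul_apply, smul_eq_mul,
      Pi.zero_apply, zero_add, mem_Ioc]
    refine forall_congr' fun i => ?_
    rw [inv_mul_le_iff₀ hp, mul_one]
    constructor
    · rintro ⟨ha, hb⟩; exact ⟨by by_contra hn; exact absurd ha (not_lt.2 (mul_nonpos_of_nonneg_of_nonpos (by positivity) (not_lt.1 hn))), hb⟩
    · rintro ⟨ha, hb⟩; exact ⟨by positivity, hb⟩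
  rw [h2]
  -- The torus is parametrized by half-open intervals closed on the right, `cube` by intervals
  -- closed on the left; the difference is a null set.
  have h3 : (Set.pi univ fun _ : Fin 3 => Ioc (0 : ℝ) (2 * Real.pi)) =ᵐ[volume]
      Set.pi univ fun _ : Fin 3 => Ico (0 : ℝ) (2 * Real.pi) := by
    exact (Measure.univ_pi_Ioc_ae_eq_Icc (μ := fun _ => volume)).trans
      (Measure.univ_pi_Ico_ae_eq_Icc (μ := fun _ => volume)).symm
  rw [setIntegral_congr_set h3]
  have h4 := (EuclideanSpace.volume_preserving_symm_measurableEquiv_toLp (Fin 3)).symm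
  have h5 := h4.setIntegral_preimage_emb (MeasurableEquiv.measurableEmbedding _) g cube
  rw [← h5]
  congr 2
  ext x
  simp [cube, Set.mem_pi]

/-- Haar measure on the torus is invariant under translations and under reflection. -/
theorem integral_cube_sub_left {F : Type*} [NormedAddCommGroup F] [NormedSpace ℝ F] {g : E3 → F}
    (hg : Periodic3 g) (x : E3) : ∫ y in cube, g (x - y) = ∫ y in cube, g y := by
  have hg' : Periodic3 fun y => g (x - y) := by
    intro i y
    have : x - (y + (2 * Real.pi) • stdVec i) + (2 * Real.pi) • stdVec i = x - y := by abel
    beta_reduce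
    rw [← this, hg i]
  rw [setIntegral_cube_eq hg', setIntegral_cube_eq hg]
  congr 1
  have hn : (volume : Measure (UnitAddTorus (Fin 3))).IsNegInvariant :=
    haveI : (volume : Measure UnitAddCircle).IsNegInvariant :=
      inferInstanceAs (AddCircle.haarAddCircle : Measure UnitAddCircle).IsNegInvariant
    Measure.pi.isNegInvariant _
  rw [← integral_sub_left_eq_self (liftTorus g) volume (torusClass x)]
  congr 1
  funext y
  rw [← torusClass_torusPt y, ← torusClass_sub, liftTorus_class hg, liftTorus_class hg']

theorem volume_cube : volume.real cube = (2 * Real.pi) ^ 3 := by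
  have h := setIntegral_cube_eq (g := fun _ : E3 => (1 : ℝ)) (fun _ _ => rfl)
  simpa [liftTorus] using h

theorem integral_cube_pos {g : E3 → ℝ} (hg : Periodic3 g) (hc : Continuous g)
    (h0 : ∀ x, 0 ≤ g x) {x : E3} (hx : g x ≠ 0) : 0 < ∫ y in cube, g y := by
  rw [setIntegral_cube_eq hg]
  refine smul_pos (by positivity) ?_
  refine (continuous_liftTorus hg hc).integral_pos_of_hasCompactSupport_nonneg_nonzero
    (HasCompactSupport.of_compactSpace _) (fun y => h0 _) (x := torusClass x) ?_
  rwa [liftTorus_class hg]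

theorem volume_cube_lt_top : volume cube < ⊤ :=
  (measure_mono cube_subset_closedCube).trans_lt isCompact_closedCube.measure_lt_top

instance : IsFiniteMeasure (volume.restrict cube) :=
  ⟨by simpa using volume_cube_lt_top⟩

theorem integrableOn_cube {F : Type*} [NormedAddCommGroup F] {g : E3 → F} (hg : Continuous g) :
    IntegrableOn g cube :=
  (hg.continuousOn.integrableOn_compact isCompact_closedCube).mono_set cube_subset_closedCube

/-! ### Fourier projections -/

theorem exists_bound_of_periodic {F : Type*} [NormedAddCommGroup F] {g : ℝ × E3 → F}
    (hg : Continuous g) (hp : ∀ t, Periodic3 fun x => g (t, x)) {K : Set ℝ} (hK : IsCompact K) :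
    ∃ C, 0 < C ∧ ∀ t ∈ K, ∀ x, ‖g (t, x)‖ ≤ C := by
  obtain ⟨C, hC⟩ := (hK.prod isCompact_closedCube).exists_bound_of_continuousOn hg.continuousOn
  refine ⟨max C 1, by positivity, fun t ht x => ?_⟩
  obtain ⟨k, hk⟩ := exists_lat_mem_cube x
  have h := (hp t).add_lat k x
  beta_reduce at h
  rw [← h]
  exact (hC (t, x + latVec k) ⟨ht, cube_subset_closedCube hk⟩).trans (le_max_left _ _)

theorem phase_add (k : Fin 3 → ℤ) (x y : E3) : phase k (x + y) = phase k x + phase k y := by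
  simp [phase, mul_add, Finset.sum_add_distrib]

theorem phase_sub (k : Fin 3 → ℤ) (x y : E3) : phase k (x - y) = phase k x - phase k y := by
  simp [phase, mul_sub, Finset.sum_sub_distrib]

theorem phase_smul_stdVec (k : Fin 3 → ℤ) (r : ℝ) (i : Fin 3) :
    phase k (r • stdVec i) = r * k i := by
  fin_cases i <;> simp [phase, stdVec, mul_comm]

theorem continuous_phase (k : Fin 3 → ℤ) : Continuous (phase k) := by
  unfold phase; fun_prop

theorem periodic_cos_phase (k : Fin 3 → ℤ) : Periodic3 fun x => Real.cos (phase k x) := by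
  intro i x
  beta_reduce
  rw [phase_add, phase_smul_stdVec, mul_comm (2 * Real.pi), Real.cos_add_int_mul_two_pi]

/-- The average of a function against a kernel. -/
def avg (κ : E3 → ℝ) (f : Sm) (z : ℝ × E3) : ℝ :=
  ((2 * Real.pi) ^ 3)⁻¹ * ∫ y in cube, κ y • f.unc (z - (0, y))

/-- Differentiation under the integral sign. The dominating constant comes from compactness in time
and periodicity in space. -/
theorem hasFDerivAt_avg {κ : E3 → ℝ} (hκ : Continuous κ) (hκ1 : ∀ y, |κ y| ≤ 1) (f : Sm)
    (z : ℝ × E3) :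
    ∃ L : (ℝ × E3) →L[ℝ] ℝ, HasFDerivAt (avg κ f) L z ∧ ∀ a, L a = avg κ (Sm.D a f) z := by
  have hf' : Continuous (fderiv ℝ f.unc) := f.smooth.continuous_fderiv (by simp)
  obtain ⟨C, hC0, hC⟩ := exists_bound_of_periodic hf' (fun t i x => f.fderiv_unc_translate i t x)
    (isCompact_closedBall z.1 1)
  have hs : {w : ℝ × E3 | w.1 ∈ Metric.ball z.1 1} ∈ 𝓝 z :=
    (Metric.isOpen_ball.preimage continuous_fst).mem_nhds (by simp)
  have hcF : ∀ w : ℝ × E3, Continuous fun y : E3 => κ y • f.unc (w - (0, y)) := fun w =>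
    hκ.smul (f.smooth.continuous.comp (by fun_prop))
  have hcF' : Continuous fun y : E3 => κ y • fderiv ℝ f.unc (z - (0, y)) :=
    hκ.smul (hf'.comp (by fun_prop))
  have key := hasFDerivAt_integral_of_dominated_of_fderiv_le (μ := volume.restrict cube) (𝕜 := ℝ)
    (F := fun (w : ℝ × E3) (y : E3) => κ y • f.unc (w - (0, y)))
    (F' := fun (w : ℝ × E3) (y : E3) => κ y • fderiv ℝ f.unc (w - (0, y)))
    (x₀ := z) (bound := fun _ => C) hs
    (Eventually.of_forall fun w => (integrableOn_cube (hcF w)).aestronglyMeasurable)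
    (integrableOn_cube (hcF z)) (integrableOn_cube hcF').aestronglyMeasurable
    (Eventually.of_forall fun y w hw => by
      rw [norm_smul]
      have h1 := hC (w.1) (Metric.ball_subset_closedBall hw) (w.2 - y)
      have h2 : w - (0, y) = (w.1, w.2 - y) := by ext <;> simp
      rw [h2]
      calc _ ≤ 1 * C := mul_le_mul (hκ1 y) h1 (norm_nonneg _) zero_le_one
        _ = C := one_mul C)
    (integrable_const C)
    (Eventually.of_forall fun y w _ => by
      have h1 : HasFDerivAt (fun w : ℝ × E3 => w - (0, y)) (ContinuousLinearMap.id ℝ (ℝ × E3)) w :=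
        (hasFDerivAt_id w).sub_const _
      have h2 := (f.differentiable (w - (0, y))).hasFDerivAt.comp w h1
      exact h2.const_smul (κ y))
  refine ⟨_, key.const_mul _, fun a => ?_⟩
  simp only [_root_.smul_apply, smul_eq_mul, avg]
  congr 1
  rw [ContinuousLinearMap.integral_apply (integrableOn_cube hcF')]
  rfl

theorem avg_periodic (κ : E3 → ℝ) (f : Sm) (t : ℝ) : Periodic3 fun x => avg κ f (t, x) := by
  intro i x
  simp only [avg]
  congr 2
  funext y
  have : (t, x + (2 * Real.pi) • stdVec i) - (0, y) = (t, (x - y) + (2 * Real.pi) • stdVec i) := by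
    ext1
    · simp
    · simp only [Prod.snd_sub]; abel
  rw [this]
  simp only [Sm.unc, Prod.fst_sub, Prod.snd_sub, sub_zero]
  rw [f.periodic t i]

/-- The projection of a function onto the span of `cos (k · x)` and `sin (k · x)`. -/
def proj (k : Fin 3 → ℤ) (f : Sm) : Sm :=
  ⟨fun t x => avg (fun y => Real.cos (phase k y)) f (t, x),
    contDiff_of_intertwine _ (hasFDerivAt_avg (Real.continuous_cos.comp (continuous_phase k))
      fun _ => Real.abs_cos_le_one _) f,
    avg_periodic _ f⟩

theorem D_proj (a : ℝ × E3) (k : Fin 3 → ℤ) (f : Sm) : Sm.D a (proj k f) = proj k (Sm.D a f) := by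
  ext t x
  obtain ⟨L, hL, hLa⟩ := hasFDerivAt_avg (Real.continuous_cos.comp (continuous_phase k))
      (fun _ => Real.abs_cos_le_one _) f (t, x)
  rw [Sm.D_apply]
  change fderiv ℝ (avg _ f) (t, x) a = _
  have := hL.fderiv
  simp only [Function.comp_def] at this
  rw [this, hLa]
  rfl

theorem proj_apply (k : Fin 3 → ℤ) (f : Sm) (t : ℝ) (x : E3) :
    proj k f t x
      = ((2 * Real.pi) ^ 3)⁻¹ * ∫ y in cube, Real.cos (phase k (x - y)) * f t y := by
  have hper : Periodic3 fun y => Real.cos (phase k (x - y)) * f t y := by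
    intro i y
    beta_reduce
    rw [f.periodic t i]
    congr 1
    have := periodic_cos_phase k i (x - (y + (2 * Real.pi) • stdVec i))
    beta_reduce at this
    rw [← this]
    congr 2
    abel
  rw [← integral_cube_sub_left hper x]
  change _ * _ = _
  congr 2
  funext y
  simp [Sm.unc]

/-- The cosine coefficient of a projection. -/
def cosCoef (k : Fin 3 → ℤ) (f : Sm) (t : ℝ) : ℝ :=
  ((2 * Real.pi) ^ 3)⁻¹ * ∫ y in cube, Real.cos (phase k y) * f t y

/-- The sine coefficient of a projection. -/
def sinCoef (k : Fin 3 → ℤ) (f : Sm) (t : ℝ) : ℝ :=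
  ((2 * Real.pi) ^ 3)⁻¹ * ∫ y in cube, Real.sin (phase k y) * f t y

theorem integrableOn_cos (k : Fin 3 → ℤ) (f : Sm) (t : ℝ) :
    IntegrableOn (fun y => Real.cos (phase k y) * f t y) cube :=
  integrableOn_cube ((Real.continuous_cos.comp (continuous_phase k)).mul (f.continuous_slice t))

theorem integrableOn_sin (k : Fin 3 → ℤ) (f : Sm) (t : ℝ) :
    IntegrableOn (fun y => Real.sin (phase k y) * f t y) cube :=
  integrableOn_cube ((Real.continuous_sin.comp (continuous_phase k)).mul (f.continuous_slice t))

theorem proj_eq_cos_sin (k : Fin 3 → ℤ) (f : Sm) (t : ℝ) (x : E3) :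
    proj k f t x
      = Real.cos (phase k x) * cosCoef k f t + Real.sin (phase k x) * sinCoef k f t := by
  rw [proj_apply, cosCoef, sinCoef]
  have : ∀ y, Real.cos (phase k (x - y)) * f t y
      = Real.cos (phase k x) * (Real.cos (phase k y) * f t y)
        + Real.sin (phase k x) * (Real.sin (phase k y) * f t y) := by
    intro y; rw [phase_sub, Real.cos_sub]; ring
  simp_rw [this]
  rw [integral_add ((integrableOn_cos k f t).const_mul _) ((integrableOn_sin k f t).const_mul _),
    integral_const_mul, integral_const_mul]
  ring

/-- A single mode is an eigenfunction of the symmetric translation by `±y`. This produces the factor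
`1 - cos (k·y)` in the singular integral. -/
theorem proj_add_proj_sub (k : Fin 3 → ℤ) (f : Sm) (t : ℝ) (x y : E3) :
    proj k f t (x + y) + proj k f t (x - y) = 2 * Real.cos (phase k y) * proj k f t x := by
  simp only [proj_eq_cos_sin, phase_add, phase_sub, Real.cos_add, Real.sin_add, Real.cos_sub,
    Real.sin_sub]
  ring

theorem hasFDerivAt_phase (k : Fin 3 → ℤ) (x : E3) :
    ∃ L : E3 →L[ℝ] ℝ, HasFDerivAt (phase k) L x ∧ ∀ i, L (stdVec i) = k i := by
  refine ⟨∑ i, (k i : ℝ) • (EuclideanSpace.proj i : E3 →L[ℝ] ℝ), ?_, fun i => ?_⟩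
  · have := (∑ i, (k i : ℝ) • (EuclideanSpace.proj i : E3 →L[ℝ] ℝ)).hasFDerivAt (x := x)
    convert this using 1
    funext y
    simp [phase]
  · fin_cases i <;> simp [stdVec, Fin.sum_univ_three]

theorem pd_cos_sin_phase (k : Fin 3 → ℤ) (A B : ℝ) (i : Fin 3) (x : E3) :
    pd i (fun y => Real.cos (phase k y) * A + Real.sin (phase k y) * B) x
      = Real.cos (phase k x) * (k i * B) + Real.sin (phase k x) * (-(k i * A)) := by
  obtain ⟨L, hL, hLi⟩ := hasFDerivAt_phase k x
  rw [pd, ((hL.cos.mul_const A).fun_add (hL.sin.mul_const B)).fderiv]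
  simp [hLi]
  ring

theorem dx_dx_proj (k : Fin 3 → ℤ) (f : Sm) (i : Fin 3) :
    Sm.dx i (Sm.dx i (proj k f)) = (-(k i : ℝ) ^ 2) • proj k f := by
  have h1 : ∀ t, proj k f t = fun y => Real.cos (phase k y) * cosCoef k f t
      + Real.sin (phase k y) * sinCoef k f t := fun t => funext fun x => proj_eq_cos_sin k f t x
  ext t x
  have h2 : (Sm.dx i (proj k f)) t = fun y => Real.cos (phase k y) * (k i * sinCoef k f t)
      + Real.sin (phase k y) * (-(k i * cosCoef k f t)) := by
    funext y
    rw [Sm.dx_apply, h1, pd_cos_sin_phase]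
  rw [Sm.dx_apply, h2, pd_cos_sin_phase, Sm.smul_apply, proj_eq_cos_sin]
  ring

theorem proj_add (k : Fin 3 → ℤ) (f g : Sm) : proj k (f + g) = proj k f + proj k g := by
  ext t x
  simp only [proj_eq_cos_sin, Sm.add_apply, cosCoef, sinCoef, mul_add]
  rw [integral_add (integrableOn_cos k f t) (integrableOn_cos k g t),
    integral_add (integrableOn_sin k f t) (integrableOn_sin k g t)]
  ring

theorem proj_smul (k : Fin 3 → ℤ) (r : ℝ) (f : Sm) : proj k (r • f) = r • proj k f := by
  ext t x
  simp only [proj_eq_cos_sin, Sm.smul_apply, cosCoef, sinCoef, mul_left_comm _ r]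
  rw [integral_const_mul, integral_const_mul]
  ring

/-- The projection as a linear map. -/
def projL (k : Fin 3 → ℤ) : Sm →ₗ[ℝ] Sm where
  toFun := proj k
  map_add' := proj_add k
  map_smul' := proj_smul k

theorem abs_proj_le (k : Fin 3 → ℤ) (f : Sm) (t : ℝ) (C : ℝ) (hC : ∀ y, |f t y| ≤ C) (x : E3) :
    |proj k f t x| ≤ C := by
  rw [proj_apply, abs_mul]
  have h := norm_setIntegral_le_of_norm_le_const (μ := volume) (s := cube) (C := C)
    (f := fun y => Real.cos (phase k (x - y)) * f t y) volume_cube_lt_top (fun y _ => by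
      rw [Real.norm_eq_abs, abs_mul]
      calc _ ≤ 1 * C := mul_le_mul (Real.abs_cos_le_one _) (hC y) (abs_nonneg _) zero_le_one
        _ = C := one_mul C)
  rw [volume_cube, Real.norm_eq_abs] at h
  rw [abs_of_pos (by positivity : (0 : ℝ) < ((2 * Real.pi) ^ 3)⁻¹), inv_mul_le_iff₀ (by positivity)]
  linarith

/-- The Laplacian in space. -/
def lap (f : Sm) : Sm := ∑ i, Sm.dx i (Sm.dx i f)

theorem dx_proj (i : Fin 3) (k : Fin 3 → ℤ) (f : Sm) :
    Sm.dx i (proj k f) = proj k (Sm.dx i f) := D_proj _ k f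

theorem freqSq_nonneg (k : Fin 3 → ℤ) : 0 ≤ freqSq k := Finset.sum_nonneg fun _ _ => sq_nonneg _

theorem lap_proj (k : Fin 3 → ℤ) (f : Sm) : lap (proj k f) = -freqSq k • proj k f := by
  simp only [lap, dx_dx_proj, freqSq, ← Finset.sum_smul, Finset.sum_neg_distrib]

theorem proj_lap (k : Fin 3 → ℤ) (f : Sm) : proj k (lap f) = -freqSq k • proj k f := by
  rw [← lap_proj, lap, lap]
  simp only [dx_proj]
  exact map_sum (projL k) _ _

/-- The operator `1 - Δ`. -/
def oneSubLap (f : Sm) : Sm := f - lap f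

theorem proj_oneSubLap (k : Fin 3 → ℤ) (f : Sm) :
    proj k (oneSubLap f) = (1 + freqSq k) • proj k f := by
  have : proj k (oneSubLap f) = proj k f - proj k (lap f) := map_sub (projL k) f (lap f)
  rw [this, proj_lap, add_smul, one_smul, neg_smul, sub_neg_eq_add]

theorem proj_oneSubLap_iterate (k : Fin 3 → ℤ) (f : Sm) (n : ℕ) :
    proj k (oneSubLap^[n] f) = (1 + freqSq k) ^ n • proj k f := by
  induction n with
  | zero => simp
  | succ n ih => rw [Function.iterate_succ_apply', proj_oneSubLap, ih, smul_smul, pow_succ']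

/-- Repeated integration by parts in spectral form: every `1 - Δ` multiplies the mode by `1 + |k|²`.
-/
theorem abs_proj_le_decay (n : ℕ) (k : Fin 3 → ℤ) (f : Sm) (t : ℝ) (C : ℝ)
    (hC : ∀ y, |(oneSubLap^[n] f) t y| ≤ C) (x : E3) :
    |proj k f t x| ≤ C * ((1 + freqSq k) ^ n)⁻¹ := by
  have h := abs_proj_le k _ t C hC x
  have hk := freqSq_nonneg k
  rw [proj_oneSubLap_iterate, Sm.smul_apply, abs_mul, abs_of_pos (by positivity)] at h
  rw [← div_eq_mul_inv, le_div_iff₀ (by positivity)]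
  linarith

/-- The weight dominates the product of the three one-dimensional weights `1 + kᵢ²`, whose inverses
are summable over `ℤ`. -/
theorem summable_freqSq : Summable fun k : Fin 3 → ℤ => ((1 + freqSq k) ^ 3)⁻¹ := by
  have h1 : Summable fun m : ℤ => ((1 + (m : ℝ) ^ 2))⁻¹ := by
    have := (Real.summable_one_div_int_pow (p := 2)).2 one_lt_two
    refine Summable.of_norm_bounded_eventually (g := fun m : ℤ => 1 / (m : ℝ) ^ 2) this ?_
    filter_upwards [(Set.finite_singleton (0 : ℤ)).compl_mem_cofinite] with m hm
    have hm' : (0 : ℝ) < (m : ℝ) ^ 2 := by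
      have : (m : ℝ) ≠ 0 := by exact_mod_cast hm
      positivity
    rw [Real.norm_of_nonneg (by positivity), one_div]
    gcongr
    linarith
  have h2 : Summable fun p : ℤ × ℤ × ℤ => (1 + (p.1 : ℝ) ^ 2)⁻¹ *
      ((1 + (p.2.1 : ℝ) ^ 2)⁻¹ * (1 + (p.2.2 : ℝ) ^ 2)⁻¹) := by
    have h3 := h1.mul_of_nonneg h1 (fun _ => by positivity) (fun _ => by positivity)
    exact h1.mul_of_nonneg h3 (fun _ => by positivity) (fun _ => by positivity)
  let e : (Fin 3 → ℤ) → ℤ × ℤ × ℤ := fun k => (k 0, k 1, k 2)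
  have he : Function.Injective e := by
    intro k l h
    simp only [e, Prod.mk.injEq] at h
    funext i
    fin_cases i
    exacts [h.1, h.2.1, h.2.2]
  refine Summable.of_nonneg_of_le (fun k => by have := freqSq_nonneg k; positivity) (fun k => ?_)
    (h2.comp_injective he)
  simp only [Function.comp, e, ← mul_inv]
  have hk : freqSq k = (k 0 : ℝ) ^ 2 + (k 1 : ℝ) ^ 2 + (k 2 : ℝ) ^ 2 := by
    simp [freqSq, Fin.sum_univ_three]
  gcongr
  rw [hk, pow_three]
  have a0 := sq_nonneg (k 0 : ℝ)
  have a1 := sq_nonneg (k 1 : ℝ)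
  have a2 := sq_nonneg (k 2 : ℝ)
  gcongr <;> linarith

/-! ### Fourier multipliers -/

namespace Sm

theorem norm_fderiv_le (f : Sm) (z : ℝ × E3) :
    ‖fderiv ℝ f.unc z‖ ≤ |dt f z.1 z.2| + ∑ i, |dx i f z.1 z.2| := by
  refine ContinuousLinearMap.opNorm_le_bound _ (by positivity) fun a => ?_
  rw [fderiv_eq, add_mul, Finset.sum_mul, Real.norm_eq_abs]
  refine (abs_add_le _ _).trans (add_le_add ?_ ((Finset.abs_sum_le_sum_abs _ _).trans
    (Finset.sum_le_sum fun i _ => ?_)))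
  · rw [abs_mul, mul_comm]
    exact mul_le_mul_of_nonneg_left (norm_fst_le a) (abs_nonneg _)
  · rw [abs_mul, mul_comm]
    exact mul_le_mul_of_nonneg_left ((PiLp.norm_apply_le a.2 i).trans (norm_snd_le a))
      (abs_nonneg _)

/-- The fourth power leaves a summable third power after one factor is spent on a symbol of growth
two. -/
theorem exists_decay (f : Sm) {K : Set ℝ} (hK : IsCompact K) :
    ∃ C, 0 < C ∧ ∀ t ∈ K, ∀ k x, |proj k f t x| ≤ C * ((1 + freqSq k) ^ 4)⁻¹ := by
  obtain ⟨C, hC0, hC⟩ := (oneSubLap^[4] f).exists_bound_of_isCompact hK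
  exact ⟨C, hC0, fun t ht k x => abs_proj_le_decay 4 k f t C (hC t ht) x⟩

end Sm

/-- The symbols of the multipliers: functions of growth at most two. -/
structure Symb where
  /-- The symbol. -/
  m : (Fin 3 → ℤ) → ℝ
  bound : ∀ k, |m k| ≤ 1 + freqSq k

theorem abs_symb_mul_le (σ : Symb) {C : ℝ} (k : Fin 3 → ℤ) {y : ℝ}
    (hy : |y| ≤ C * ((1 + freqSq k) ^ 4)⁻¹) : |σ.m k * y| ≤ C * ((1 + freqSq k) ^ 3)⁻¹ := by
  have hk : 0 < 1 + freqSq k := by have := freqSq_nonneg k; positivity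
  rw [abs_mul]
  calc _ ≤ (1 + freqSq k) * (C * ((1 + freqSq k) ^ 4)⁻¹) :=
        mul_le_mul (σ.bound k) hy (abs_nonneg _) hk.le
    _ = C * ((1 + freqSq k) ^ 3)⁻¹ := by field_simp

/-- The Fourier multiplier with a given symbol, as a function. -/
def multFun (σ : Symb) (f : Sm) (z : ℝ × E3) : ℝ := ∑' k, σ.m k * proj k f z.1 z.2

theorem summable_mult (σ : Symb) (f : Sm) (t : ℝ) (x : E3) :
    Summable fun k => σ.m k * proj k f t x := by
  obtain ⟨C, hC0, hC⟩ := f.exists_decay (isCompact_singleton (x := t))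
  exact Summable.of_norm_bounded (summable_freqSq.mul_left C)
    fun k => abs_symb_mul_le σ k (hC t rfl k x)

/-- Termwise differentiation: the differentiated series is dominated on a slab of times, so the
multiplier commutes with all derivatives. -/
theorem hasFDerivAt_multFun (σ : Symb) (f : Sm) (z : ℝ × E3) :
    ∃ L : (ℝ × E3) →L[ℝ] ℝ, HasFDerivAt (multFun σ f) L z ∧
      ∀ a, L a = multFun σ (Sm.D a f) z := by
  obtain ⟨C, -, hC⟩ := (Sm.dt f).exists_decay (isCompact_closedBall z.1 1)
  choose C' _ hC' using fun i => (Sm.dx i f).exists_decay (isCompact_closedBall z.1 1)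
  set g : (Fin 3 → ℤ) → Sm := fun k => σ.m k • proj k f with hg
  have hDg : ∀ a k, Sm.D a (g k) = σ.m k • proj k (Sm.D a f) := by
    intro a k; simp only [hg]; rw [Derivation.map_smul, D_proj]
  have hs : IsOpen (Metric.ball z.1 1 ×ˢ (univ : Set E3)) := Metric.isOpen_ball.prod isOpen_univ
  have hz : z ∈ Metric.ball z.1 1 ×ˢ (univ : Set E3) := by simp
  have hb : ∀ (k : Fin 3 → ℤ) (w : ℝ × E3), w ∈ Metric.ball z.1 1 ×ˢ (univ : Set E3) →
      ‖fderiv ℝ (g k).unc w‖ ≤ (C + ∑ i, C' i) * ((1 + freqSq k) ^ 3)⁻¹ := by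
    intro k w hw
    refine ((g k).norm_fderiv_le w).trans ?_
    rw [add_mul, Finset.sum_mul]
    have hw1 := Metric.ball_subset_closedBall hw.1
    refine add_le_add ?_ (Finset.sum_le_sum fun i _ => ?_)
    · rw [Sm.dt, hDg]
      exact abs_symb_mul_le σ k (hC _ hw1 k _)
    · rw [Sm.dx, hDg]
      exact abs_symb_mul_le σ k (hC' i _ hw1 k _)
  have hu : Summable fun k => (C + ∑ i, C' i) * ((1 + freqSq k) ^ 3)⁻¹ :=
    summable_freqSq.mul_left _
  have key := hasFDerivAt_tsum_of_isPreconnected (𝕜 := ℝ) hu hs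
    ((convex_ball z.1 1).prod convex_univ).isPreconnected
    (f := fun k w => (g k).unc w) (f' := fun k w => fderiv ℝ (g k).unc w)
    (fun k w _ => ((g k).differentiable w).hasFDerivAt) hb hz (summable_mult σ f z.1 z.2) hz
  refine ⟨_, key, fun a => ?_⟩
  have hsum : Summable fun k => fderiv ℝ (g k).unc z :=
    Summable.of_norm_bounded hu fun k => hb k z hz
  have h2 := ((ContinuousLinearMap.apply ℝ ℝ a).hasSum hsum.hasSum).tsum_eq
  simp only [ContinuousLinearMap.apply_apply] at h2
  rw [← h2]
  refine tsum_congr fun k => ?_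
  have := congrFun (congrFun (congrArg Sm.fn (hDg a k)) z.1) z.2
  exact this

theorem multFun_periodic (σ : Symb) (f : Sm) (t : ℝ) : Periodic3 fun x => multFun σ f (t, x) := by
  intro i x
  simp only [multFun]
  refine tsum_congr fun k => ?_
  rw [(proj k f).periodic t i]

/-- The Fourier multiplier with a given symbol. -/
def mult (σ : Symb) : Sm →ₗ[ℝ] Sm where
  toFun f := ⟨fun t x => multFun σ f (t, x),
    contDiff_of_intertwine _ (hasFDerivAt_multFun σ) f, multFun_periodic σ f⟩
  map_add' f g := by
    ext t x
    change ∑' k, σ.m k * proj k (f + g) t x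
      = (∑' k, σ.m k * proj k f t x) + ∑' k, σ.m k * proj k g t x
    simp only [proj_add, Sm.add_apply, mul_add]
    exact Summable.tsum_add (summable_mult σ f t x) (summable_mult σ g t x)
  map_smul' r f := by
    ext t x
    change ∑' k, σ.m k * proj k (r • f) t x = r * ∑' k, σ.m k * proj k f t x
    simp only [proj_smul, Sm.smul_apply, mul_left_comm _ r]
    exact tsum_mul_left

theorem mult_apply (σ : Symb) (f : Sm) (t : ℝ) (x : E3) :
    mult σ f t x = ∑' k, σ.m k * proj k f t x := rfl

theorem D_mult (σ : Symb) (a : ℝ × E3) (f : Sm) : Sm.D a (mult σ f) = mult σ (Sm.D a f) := by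
  ext t x
  obtain ⟨L, hL, hLa⟩ := hasFDerivAt_multFun σ f (t, x)
  rw [Sm.D_apply]
  change fderiv ℝ (multFun σ f) (t, x) a = _
  rw [hL.fderiv, hLa]
  rfl

theorem dx_mult (σ : Symb) (i : Fin 3) (f : Sm) : Sm.dx i (mult σ f) = mult σ (Sm.dx i f) :=
  D_mult σ _ f

/-- A crude bound that loses eight derivatives. It is applied through the inverse Laplacian to
remainders of very negative order, where the loss is harmless. -/
theorem exists_mult_bound (σ : Symb) : ∃ A, 0 < A ∧ ∀ (f : Sm) (t C : ℝ),
    (∀ y, |(oneSubLap^[4] f) t y| ≤ C) → ∀ x, |mult σ f t x| ≤ A * C := by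
  refine ⟨∑' k : Fin 3 → ℤ, ((1 + freqSq k) ^ 3)⁻¹, ?_, fun f t C hC x => ?_⟩
  · refine summable_freqSq.tsum_pos (fun k => ?_) 0 ?_
    · have := freqSq_nonneg k; positivity
    · have := freqSq_nonneg 0; positivity
  · rw [mul_comm, ← tsum_mul_left, mult_apply]
    exact tsum_of_norm_bounded (f := fun k => σ.m k * proj k f t x)
      (summable_freqSq.mul_left C).hasSum fun k =>
      abs_symb_mul_le σ k (abs_proj_le_decay 4 k f t C hC x)

/-! ### Fourier inversion -/

theorem mFourier_torusClass (k : Fin 3 → ℤ) (x : E3) :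
    UnitAddTorus.mFourier k (torusClass x) = Complex.exp (Complex.I * (phase k x : ℂ)) := by
  have hp : (Real.pi : ℂ) ≠ 0 := by exact_mod_cast Real.pi_ne_zero
  change ∏ i, fourier (k i) (torusClass x i) = _
  simp only [torusClass, fourier_coe_apply, ← Complex.exp_sum]
  congr 1
  simp only [phase, Complex.ofReal_sum, Finset.mul_sum]
  refine Finset.sum_congr rfl fun i _ => ?_
  push_cast
  field_simp

theorem periodic_exp_phase (k : Fin 3 → ℤ) :
    Periodic3 fun x => Complex.exp (-(Complex.I * (phase k x : ℂ))) := by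
  intro i x
  beta_reduce
  rw [phase_add, phase_smul_stdVec]
  have : -(Complex.I * ((phase k x + 2 * Real.pi * k i : ℝ) : ℂ))
      = -(Complex.I * (phase k x : ℂ)) + ((-k i : ℤ) : ℂ) * (2 * Real.pi * Complex.I) := by
    push_cast; ring
  rw [this, Complex.exp_add, Complex.exp_int_mul_two_pi_mul_I, mul_one]

theorem mFourierCoeff_liftTorus {f : E3 → ℝ} (hf : Periodic3 f) (k : Fin 3 → ℤ) :
    UnitAddTorus.mFourierCoeff (liftTorus fun x => (f x : ℂ)) k = fourierCoef f k := by
  have hper : Periodic3 fun x => (f x : ℂ) * Complex.exp (-(Complex.I * (phase k x : ℂ))) := by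
    intro i x
    have := periodic_exp_phase k i x
    beta_reduce at this ⊢
    rw [hf i x, this]
  rw [fourierCoef, setIntegral_cube_eq hper, inv_smul_smul₀ (by positivity)]
  rw [UnitAddTorus.mFourierCoeff]
  congr 1
  funext y
  rw [smul_eq_mul, mul_comm, ← torusClass_torusPt y, liftTorus_class hper,
    liftTorus_class (fun i x => by beta_reduce; rw [hf i x]), mFourier_torusClass]
  congr 2
  simp [phase]

theorem fourierCoef_eq (k : Fin 3 → ℤ) (f : Sm) (t : ℝ) :
    fourierCoef (f t) k = (cosCoef k f t : ℂ) - Complex.I * sinCoef k f t := by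
  have h1 : ∀ x, (f t x : ℂ) * Complex.exp (-(Complex.I * (phase k x : ℂ)))
      = ((Real.cos (phase k x) * f t x : ℝ) : ℂ)
        - Complex.I * ((Real.sin (phase k x) * f t x : ℝ) : ℂ) := by
    intro x
    rw [show -(Complex.I * (phase k x : ℂ)) = (-(phase k x) : ℂ) * Complex.I by ring,
      Complex.exp_mul_I]
    simp only [Complex.cos_neg, Complex.sin_neg]
    push_cast
    ring
  rw [fourierCoef]
  simp_rw [h1]
  rw [integral_sub (integrableOn_cos k f t).ofReal ((integrableOn_sin k f t).ofReal.const_mul _),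
    integral_const_mul, integral_complex_ofReal, integral_complex_ofReal, cosCoef, sinCoef]
  simp only [Complex.real_smul]
  push_cast
  ring

theorem re_fourierCoef_mul_exp (k : Fin 3 → ℤ) (f : Sm) (t : ℝ) (x : E3) :
    (fourierCoef (f t) k * Complex.exp (Complex.I * (phase k x : ℂ))).re = proj k f t x := by
  rw [fourierCoef_eq, proj_eq_cos_sin, mul_comm Complex.I (phase k x : ℂ), Complex.exp_mul_I,
    ← Complex.ofReal_cos, ← Complex.ofReal_sin]
  simp only [Complex.mul_re, Complex.sub_re, Complex.sub_im, Complex.add_re, Complex.add_im,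
    Complex.ofReal_re, Complex.ofReal_im, Complex.I_re, Complex.I_im, Complex.mul_im]
  ring

/-- A shift along an axis with `kᵢ ≠ 0` turns the argument of the coefficient to zero. Sup bounds on
the real modes thereby become bounds on the complex coefficients. -/
theorem exists_norm_fourierCoef_eq (k : Fin 3 → ℤ) (f : Sm) (t : ℝ) :
    ∃ x, ‖fourierCoef (f t) k‖ = |proj k f t x| := by
  by_cases hk : k = 0
  · refine ⟨0, ?_⟩
    have hs : sinCoef k f t = 0 := by simp [sinCoef, hk, phase]
    rw [fourierCoef_eq, proj_eq_cos_sin, hs]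
    simp [phase]
  · obtain ⟨i, hi⟩ := Function.ne_iff.1 hk
    have hi' : (k i : ℝ) ≠ 0 := by exact_mod_cast hi
    set c := fourierCoef (f t) k with hc
    refine ⟨(-(Complex.arg c) / k i) • stdVec i, ?_⟩
    rw [← re_fourierCoef_mul_exp, ← hc, phase_smul_stdVec, div_mul_cancel₀ _ hi']
    have h1 : (c.arg : ℂ) * Complex.I + Complex.I * ((-c.arg : ℝ) : ℂ) = 0 := by push_cast; ring
    have h2 : c * Complex.exp (Complex.I * ((-c.arg : ℝ) : ℂ)) = (‖c‖ : ℂ) := by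
      nth_rewrite 1 [← Complex.norm_mul_exp_arg_mul_I c]
      rw [mul_assoc, ← Complex.exp_add, h1, Complex.exp_zero, mul_one]
    rw [h2, Complex.ofReal_re, abs_norm]

theorem norm_fourierCoef_le (f : Sm) (t : ℝ) : ∃ C, 0 < C ∧ ∀ k,
    ‖fourierCoef (f t) k‖ ≤ C * ((1 + freqSq k) ^ 4)⁻¹ := by
  obtain ⟨C, hC0, hC⟩ := f.exists_decay (isCompact_singleton (x := t))
  refine ⟨C, hC0, fun k => ?_⟩
  obtain ⟨x, hx⟩ := exists_norm_fourierCoef_eq k f t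
  rw [hx]
  exact hC t rfl k x

/-- Fourier inversion for absolutely summable coefficients. Taking real parts turns each exponential
term into a real mode, so the sum runs over all of `ℤ³`. -/
theorem hasSum_proj (f : Sm) (t : ℝ) (x : E3) : HasSum (fun k => proj k f t x) (f t x) := by
  have hper : Periodic3 fun x => (f t x : ℂ) := fun i x => by
    beta_reduce; rw [f.periodic t i x]
  let g : C(UnitAddTorus (Fin 3), ℂ) := ⟨liftTorus fun x => (f t x : ℂ),
    continuous_liftTorus hper (Complex.continuous_ofReal.comp (f.continuous_slice t))⟩
  have hg : ∀ k, UnitAddTorus.mFourierCoeff g k = fourierCoef (f t) k := fun k =>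
    mFourierCoeff_liftTorus (f.periodic t) k
  obtain ⟨C, hC0, hC⟩ := norm_fourierCoef_le f t
  have hs : Summable (UnitAddTorus.mFourierCoeff g) := by
    refine Summable.of_norm_bounded (summable_freqSq.mul_left C) fun k => ?_
    rw [hg]
    refine (hC k).trans ?_
    have hk := freqSq_nonneg k
    gcongr
    · linarith
    · norm_num
  have h := UnitAddTorus.hasSum_mFourier_series_apply_of_summable hs (torusClass x)
  have h2 := Complex.hasSum_re h
  simp only [hg, mFourier_torusClass, smul_eq_mul, re_fourierCoef_mul_exp] at h2
  have h3 : g (torusClass x) = (f t x : ℂ) := liftTorus_class hper x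
  rw [h3, Complex.ofReal_re] at h2
  exact h2

/-- Parseval on the torus with its probability measure, for which the mean square is at most the
squared supremum. -/
theorem tsum_sq_fourierCoef_le (f : Sm) (t : ℝ) (C : ℝ) (hC : ∀ x, |f t x| ≤ C) :
    ∑' k, ENNReal.ofReal (‖fourierCoef (f t) k‖ ^ 2) ≤ ENNReal.ofReal (C ^ 2) := by
  have hper : Periodic3 fun x => (f t x : ℂ) := fun i x => by
    beta_reduce; rw [f.periodic t i x]
  let g : C(UnitAddTorus (Fin 3), ℂ) := ⟨liftTorus fun x => (f t x : ℂ),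
    continuous_liftTorus hper (Complex.continuous_ofReal.comp (f.continuous_slice t))⟩
  have hg : ∀ k, UnitAddTorus.mFourierCoeff g k = fourierCoef (f t) k := fun k =>
    mFourierCoeff_liftTorus (f.periodic t) k
  have h := UnitAddTorus.hasSum_sq_mFourierCoeff (ContinuousMap.toLp 2 volume ℂ g)
  simp only [UnitAddTorus.mFourierCoeff_toLp, hg] at h
  rw [← ENNReal.ofReal_tsum_of_nonneg (fun k => by positivity) h.summable, h.tsum_eq]
  refine ENNReal.ofReal_le_ofReal ?_
  have h1 : ∫ y, ‖(ContinuousMap.toLp 2 volume ℂ g) y‖ ^ 2 = ∫ y, ‖g y‖ ^ 2 := by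
    refine integral_congr_ae ?_
    filter_upwards [ContinuousMap.coeFn_toLp (p := 2) (𝕜 := ℂ) volume g] with y hy
    rw [hy]
  rw [h1]
  have h2 := norm_integral_le_of_norm_le_const (μ := (volume : Measure (UnitAddTorus (Fin 3))))
    (f := fun y => ‖g y‖ ^ 2) (C := C ^ 2) (Eventually.of_forall fun y => by
      have : ‖g y‖ ≤ C := by
        change ‖((f t (torusPt y) : ℝ) : ℂ)‖ ≤ C
        rw [Complex.norm_real]
        exact hC _
      rw [norm_pow, norm_norm]
      gcongr)
  refine (le_abs_self _).trans (h2.trans ?_)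
  simp

/-! ### The inverse Laplacian and the fractional Laplacian -/

/-- The symbol of the inverse Laplacian. -/
def invLapSymb : Symb where
  -- At `k = 0` the inverse of zero is zero, so the mean is discarded.
  m k := -(freqSq k)⁻¹
  bound k := by
    have hk := freqSq_nonneg k
    rw [abs_neg, abs_of_nonneg (inv_nonneg.2 hk)]
    by_cases h0 : k = 0
    · subst h0
      simp [freqSq]
    · have : 1 ≤ freqSq k := by
        obtain ⟨i, hi⟩ := Function.ne_iff.1 h0
        have h1 : (1 : ℝ) ≤ (k i : ℝ) ^ 2 := by
          have : (1 : ℤ) ≤ (k i) ^ 2 := by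
            have := Int.one_le_abs hi
            rw [← sq_abs]; nlinarith
          exact_mod_cast this
        exact h1.trans (Finset.single_le_sum (f := fun i => (k i : ℝ) ^ 2)
          (fun _ _ => sq_nonneg _) (Finset.mem_univ i))
      exact (inv_le_one_of_one_le₀ this).trans (by linarith)

theorem freqSq_eq_zero {k : Fin 3 → ℤ} : freqSq k = 0 ↔ k = 0 := by
  constructor
  · intro h
    rw [freqSq, Finset.sum_eq_zero_iff_of_nonneg (fun _ _ => sq_nonneg _)] at h
    funext i
    have := h i (Finset.mem_univ i)
    simpa using this
  · rintro rfl; simp [freqSq]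

theorem lap_mult (σ : Symb) (f : Sm) : lap (mult σ f) = mult σ (lap f) := by
  simp only [lap, dx_mult, map_sum]

/-- The inverse Laplacian on functions of mean zero. -/
def invLap : Sm →ₗ[ℝ] Sm := mult invLapSymb

theorem lap_invLap (f : Sm) : lap (invLap f) = f - proj 0 f := by
  ext t x
  rw [invLap, lap_mult, mult_apply, Sm.sub_apply]
  have h := hasSum_proj f t x
  have h2 : HasSum (fun k : Fin 3 → ℤ => if k = 0 then proj 0 f t x else 0) (proj 0 f t x) :=
    hasSum_ite_eq 0 _
  rw [← (h.sub h2).tsum_eq]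
  refine tsum_congr fun k => ?_
  rw [proj_lap, Sm.smul_apply]
  by_cases hk : k = 0
  · subst hk
    simp [invLapSymb, freqSq]
  · have : freqSq k ≠ 0 := fun h => hk (freqSq_eq_zero.1 h)
    simp only [hk, if_false, sub_zero, invLapSymb]
    field_simp

/-- The symbol of the fractional Laplacian `(-Δ)^s`, `0 ≤ s ≤ 1`. -/
def fracSymb (s : ℝ) (h0 : 0 ≤ s) (h1 : s ≤ 1) : Symb where
  m k := freqSq k ^ s
  bound k := by
    have hk := freqSq_nonneg k
    rw [abs_of_nonneg (Real.rpow_nonneg hk s)]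
    calc freqSq k ^ s ≤ (1 + freqSq k) ^ s := Real.rpow_le_rpow hk (by linarith) h0
      _ ≤ (1 + freqSq k) ^ (1 : ℝ) := Real.rpow_le_rpow_of_exponent_le (by linarith) h1
      _ = 1 + freqSq k := Real.rpow_one _

theorem fracLap_eq_mult {s : ℝ} (h0 : 0 ≤ s) (h1 : s ≤ 1) (f : Sm) (t : ℝ) (x : E3) :
    fracLap s (f t) x = mult (fracSymb s h0 h1) f t x := by
  rw [fracLap, mult_apply, Complex.re_tsum]
  · refine tsum_congr fun k => ?_
    rw [mul_assoc, Complex.re_ofReal_mul, re_fourierCoef_mul_exp]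
    rfl
  · obtain ⟨C, hC0, hC⟩ := norm_fourierCoef_le f t
    refine Summable.of_norm_bounded (summable_freqSq.mul_left C) fun k => ?_
    rw [mul_comm Complex.I, norm_mul, norm_mul, Complex.norm_exp_ofReal_mul_I, mul_one,
      Complex.norm_real, Real.norm_eq_abs, ← abs_norm (fourierCoef (f t) k), ← abs_mul]
    exact abs_symb_mul_le (fracSymb s h0 h1) k (by rw [abs_norm]; exact hC k)

end TorusIntegration

/-! ### The singular integral for the fractional Laplacian -/

/-- The kernel `|y| ^ (-3 - 2 * s)`. -/
def rieszKer (s : ℝ) (y : E3) : ℝ := ‖y‖ ^ (-3 - 2 * s)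

theorem rieszKer_nonneg (s : ℝ) (y : E3) : 0 ≤ rieszKer s y := Real.rpow_nonneg (norm_nonneg y) _

theorem measurable_rieszKer (s : ℝ) : Measurable (rieszKer s) := by
  unfold rieszKer; fun_prop

/-- In polar coordinates the integrand behaves like `r^{1-2s}` at the origin and `r^{-1-2s}` at
infinity, integrable exactly because `0 < s < 1`. -/
theorem integrable_min_rieszKer {s : ℝ} (h0 : 0 < s) (h1 : s < 1) :
    Integrable fun y : E3 => min 1 (‖y‖ ^ 2) * rieszKer s y := by
  have h := integrable_fun_norm_addHaar (volume : Measure E3)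
    (f := fun r : ℝ => min 1 (r ^ 2) * r ^ (-3 - 2 * s))
  refine h.2 ?_
  rw [← Ioc_union_Ioi_eq_Ioi (zero_le_one (α := ℝ))]
  have hd : Module.finrank ℝ E3 - 1 = 2 := by simp
  rw [hd]
  have hm : Measurable fun y : ℝ => y ^ 2 • (min 1 (y ^ 2) * y ^ (-3 - 2 * s)) := by fun_prop
  refine IntegrableOn.union ?_ ?_
  · have hi : IntegrableOn (fun y : ℝ => y ^ (1 - 2 * s)) (Ioc 0 1) :=
      (intervalIntegrable_iff_integrableOn_Ioc_of_le zero_le_one).1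
        (intervalIntegral.intervalIntegrable_rpow' (by linarith))
    refine hi.mono' hm.aestronglyMeasurable ?_
    filter_upwards [ae_restrict_mem measurableSet_Ioc] with y hy
    have hy0 : 0 < y := hy.1
    rw [Real.norm_of_nonneg (by positivity), smul_eq_mul]
    calc y ^ 2 * (min 1 (y ^ 2) * y ^ (-3 - 2 * s)) ≤ y ^ 2 * (y ^ 2 * y ^ (-3 - 2 * s)) := by
          gcongr; exact min_le_right _ _
      _ = y ^ (2 : ℝ) * (y ^ (2 : ℝ) * y ^ (-3 - 2 * s)) := by norm_cast
      _ = y ^ (1 - 2 * s) := by rw [← Real.rpow_add hy0, ← Real.rpow_add hy0]; congr 1; ring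
  · have hi : IntegrableOn (fun y : ℝ => y ^ (-1 - 2 * s)) (Ioi 1) :=
      integrableOn_Ioi_rpow_of_lt (by linarith) one_pos
    refine hi.mono' hm.aestronglyMeasurable ?_
    filter_upwards [ae_restrict_mem measurableSet_Ioi] with y hy
    have hy0 : 0 < y := zero_lt_one.trans hy
    rw [Real.norm_of_nonneg (by positivity), smul_eq_mul]
    calc y ^ 2 * (min 1 (y ^ 2) * y ^ (-3 - 2 * s)) ≤ y ^ 2 * (1 * y ^ (-3 - 2 * s)) := by
          gcongr; exact min_le_left _ _
      _ = y ^ (2 : ℝ) * (1 * y ^ (-3 - 2 * s)) := by norm_cast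
      _ = y ^ (-1 - 2 * s) := by rw [one_mul, ← Real.rpow_add hy0]; congr 1; ring

theorem integral_comp_smul_rieszKer (s : ℝ) (h : E3 → ℝ) {r : ℝ} (hr : 0 < r) :
    ∫ y, h (r • y) * rieszKer s y = r ^ (2 * s) * ∫ y, h y * rieszKer s y := by
  have h1 : ∀ y, h (r • y) * rieszKer s y
      = r ^ (3 + 2 * s) * (fun z => h z * rieszKer s z) (r • y) := by
    intro y
    simp only [rieszKer, norm_smul, Real.norm_of_nonneg hr.le,
      Real.mul_rpow hr.le (norm_nonneg y)]
    have : r ^ (3 + 2 * s) * r ^ (-3 - 2 * s) = 1 := by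
      rw [← Real.rpow_add hr]; ring_nf; simp
    linear_combination (-(h (r • y) * ‖y‖ ^ (-3 - 2 * s))) * this
  simp_rw [h1]
  have h2 := Measure.integral_comp_smul volume (fun z : E3 => h z * rieszKer s z) r
  beta_reduce at h2
  rw [integral_const_mul, h2]
  have hd : Module.finrank ℝ E3 = 3 := by simp
  rw [hd, abs_of_pos (by positivity), smul_eq_mul, ← mul_assoc]
  congr 1
  rw [show (3 + 2 * s) = 2 * s + (3 : ℕ) by push_cast; ring, Real.rpow_add_natCast hr.ne']
  field_simp

theorem integral_comp_isometry_rieszKer (s : ℝ) (h : E3 → ℝ) (U : E3 ≃ₗᵢ[ℝ] E3) :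
    ∫ y, h (U y) * rieszKer s y = ∫ y, h y * rieszKer s y := by
  rw [← U.measurePreserving.integral_comp U.toHomeomorph.measurableEmbedding
    (fun y => h y * rieszKer s y)]
  simp [rieszKer]

/-- The frequency as a vector. -/
def freqVec (k : Fin 3 → ℤ) : E3 := WithLp.toLp 2 fun i => (k i : ℝ)

theorem phase_eq_inner (k : Fin 3 → ℤ) (y : E3) : phase k y = inner ℝ (freqVec k) y := by
  simp [phase, freqVec, PiLp.inner_apply, mul_comm]

theorem norm_freqVec_sq (k : Fin 3 → ℤ) : ‖freqVec k‖ ^ 2 = freqSq k := by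
  simp [EuclideanSpace.norm_sq_eq, freqVec, freqSq]

theorem one_sub_cos_le (κ y : E3) :
    1 - Real.cos (inner ℝ κ y) ≤ 2 * (1 + ‖κ‖ ^ 2) * min 1 (‖y‖ ^ 2) := by
  have h1 : (inner ℝ κ y) ^ 2 ≤ (‖κ‖ * ‖y‖) ^ 2 := by
    rw [← sq_abs]; gcongr; exact abs_real_inner_le_norm κ y
  have h2 := Real.one_sub_sq_div_two_le_cos (x := inner ℝ κ y)
  have h3 := Real.neg_one_le_cos (inner ℝ κ y)
  have a := sq_nonneg ‖κ‖
  have b := sq_nonneg ‖y‖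
  rw [mul_min_of_nonneg _ _ (by positivity)]
  refine le_min ?_ ?_ <;> nlinarith

theorem integrable_one_sub_cos {s : ℝ} (h0 : 0 < s) (h1 : s < 1) (κ : E3) :
    Integrable fun y : E3 => (1 - Real.cos (inner ℝ κ y)) * rieszKer s y := by
  have hm := measurable_rieszKer s
  refine ((integrable_min_rieszKer h0 h1).const_mul (2 * (1 + ‖κ‖ ^ 2))).mono'
    (by fun_prop) (Eventually.of_forall fun y => ?_)
  have h2 := Real.cos_le_one (inner ℝ κ y)
  have h3 := rieszKer_nonneg s y
  rw [Real.norm_of_nonneg (mul_nonneg (by linarith) h3), ← mul_assoc]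
  exact mul_le_mul_of_nonneg_right (one_sub_cos_le κ y) h3

/-- The normalizing constant of the kernel. -/
def rieszConst (s : ℝ) : ℝ := ∫ y : E3, (1 - Real.cos (inner ℝ (stdVec 0) y)) * rieszKer s y

theorem rieszConst_pos {s : ℝ} (h0 : 0 < s) (h1 : s < 1) : 0 < rieszConst s := by
  unfold rieszConst
  rw [integral_pos_iff_support_of_nonneg
    (fun y => mul_nonneg (by simpa using Real.cos_le_one _) (rieszKer_nonneg s y))
    (integrable_one_sub_cos h0 h1 _)]
  have ho : IsOpen {y : E3 | Real.cos (inner ℝ (stdVec 0) y) < 0} :=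
    isOpen_lt (by fun_prop) continuous_const
  refine (ho.measure_pos volume ⟨Real.pi • stdVec 0, ?_⟩).trans_le (measure_mono fun y hy => ?_)
  · simp [inner_smul_right, stdVec]
  · have hy0 : y ≠ 0 := by
      rintro rfl
      simp only [mem_ofPred_eq, inner_zero_right, Real.cos_zero] at hy
      linarith
    refine mul_ne_zero ?_ (Real.rpow_pos_of_pos (norm_pos_iff.2 hy0) _).ne'
    simp only [mem_ofPred_eq] at hy
    linarith

/-- The kernel is homogeneous and rotation invariant: a dilation extracts `|κ|^{2s}`, and an
isometry moves the direction of `κ` to the first axis. -/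
theorem integral_one_sub_cos {s : ℝ} (h0 : 0 < s) (κ : E3) :
    ∫ y : E3, (1 - Real.cos (inner ℝ κ y)) * rieszKer s y = (‖κ‖ ^ 2) ^ s * rieszConst s := by
  by_cases hκ : κ = 0
  · simp [hκ, Real.zero_rpow h0.ne']
  have hpos : 0 < ‖κ‖ := norm_pos_iff.2 hκ
  set e : E3 := ‖κ‖⁻¹ • κ with he
  have hκe : κ = ‖κ‖ • e := by rw [he, smul_smul, mul_inv_cancel₀ hpos.ne', one_smul]
  have hen : ‖e‖ = ‖stdVec 0‖ := by
    rw [he, norm_smul, norm_inv, norm_norm, inv_mul_cancel₀ hpos.ne']; simp [stdVec]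
  -- The reflection in the hyperplane bisecting two vectors of equal length exchanges them.
  set U := Submodule.reflection (ℝ ∙ (e - stdVec 0))ᗮ with hU
  have hUe : U e = stdVec 0 := Submodule.reflection_sub hen
  have h1 : ∀ y, Real.cos (inner ℝ κ y) = Real.cos (inner ℝ (stdVec 0) (‖κ‖ • U y)) := by
    intro y
    rw [← hUe, inner_smul_right, U.inner_map_map]
    conv_lhs => rw [hκe, inner_smul_left]
    simp
  simp_rw [h1]
  rw [integral_comp_isometry_rieszKer s (fun y => 1 - Real.cos (inner ℝ (stdVec 0) (‖κ‖ • y))) U,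
    integral_comp_smul_rieszKer s (fun y => 1 - Real.cos (inner ℝ (stdVec 0) y)) hpos, rieszConst]
  congr 1
  rw [← Real.rpow_natCast, ← Real.rpow_mul (norm_nonneg κ)]
  norm_num

/-- Sum and integral are exchanged in the Fourier series of the symmetric second difference; each
mode contributes `1 - cos (k·y)`, whose integral against the kernel is a multiple of `|k|^{2s}`. -/
theorem mult_frac_eq_integral {s : ℝ} (h0 : 0 < s) (h1 : s < 1) (f : Sm) (t : ℝ) (x : E3) :
    rieszConst s * mult (fracSymb s h0.le h1.le) f t x
      = ∫ y, (f t x - (f t (x + y) + f t (x - y)) / 2) * rieszKer s y := by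
  have hI : ∀ k, ∫ y, (1 - Real.cos (phase k y)) * rieszKer s y = freqSq k ^ s * rieszConst s := by
    intro k
    simp_rw [phase_eq_inner]
    rw [integral_one_sub_cos h0, norm_freqVec_sq]
  have hInt : ∀ k, Integrable fun y => (1 - Real.cos (phase k y)) * rieszKer s y := by
    intro k
    simp_rw [phase_eq_inner]
    exact integrable_one_sub_cos h0 h1 _
  have hnorm : ∀ k, ∫ y, ‖proj k f t x * ((1 - Real.cos (phase k y)) * rieszKer s y)‖
      = |freqSq k ^ s * proj k f t x| * rieszConst s := by
    intro k
    have : ∀ y, ‖proj k f t x * ((1 - Real.cos (phase k y)) * rieszKer s y)‖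
        = |proj k f t x| * ((1 - Real.cos (phase k y)) * rieszKer s y) := by
      intro y
      rw [norm_mul, Real.norm_eq_abs, Real.norm_of_nonneg
        (mul_nonneg (by linarith [Real.cos_le_one (phase k y)]) (rieszKer_nonneg s y))]
    simp_rw [this]
    rw [integral_const_mul, hI, abs_mul, abs_of_nonneg (Real.rpow_nonneg (freqSq_nonneg k) s)]
    ring
  have key := hasSum_integral_of_summable_integral_norm (μ := (volume : Measure E3))
    (F := fun (k : Fin 3 → ℤ) (y : E3) => proj k f t x * ((1 - Real.cos (phase k y)) * rieszKer s y))
    (fun k => (hInt k).const_mul _)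
    (by
      simp_rw [hnorm]
      exact (summable_mult (fracSymb s h0.le h1.le) f t x).abs.mul_right _)
  have h2 : ∀ y, ∑' k, proj k f t x * ((1 - Real.cos (phase k y)) * rieszKer s y)
      = (f t x - (f t (x + y) + f t (x - y)) / 2) * rieszKer s y := by
    intro y
    have := ((hasSum_proj f t x).sub
      (((hasSum_proj f t (x + y)).add (hasSum_proj f t (x - y))).div_const 2)).mul_right
        (rieszKer s y)
    rw [← this.tsum_eq]
    refine tsum_congr fun k => ?_
    rw [proj_add_proj_sub]
    ring
  simp_rw [h2] at key
  rw [← key.tsum_eq, mult_apply, ← tsum_mul_left]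
  refine tsum_congr fun k => ?_
  rw [integral_const_mul, hI]
  simp only [fracSymb]
  ring

namespace Sm

theorem norm_slice_deriv_le (f : Sm) (t : ℝ) (x : E3) :
    ‖fderiv ℝ (f t) x‖ ≤ ∑ i, |dx i f t x| := by
  rw [(f.hasFDerivAt_slice t x).fderiv]
  refine ContinuousLinearMap.opNorm_le_bound _ (by positivity) fun a => ?_
  have : ((fderiv ℝ f.unc (t, x)).comp (ContinuousLinearMap.inr ℝ ℝ E3)) a
      = ∑ i, a i * dx i f t x := by
    simp [fderiv_eq]
  rw [this, Finset.sum_mul]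
  refine (Finset.abs_sum_le_sum_abs _ _).trans (Finset.sum_le_sum fun i _ => ?_)
  rw [abs_mul, mul_comm]
  exact mul_le_mul_of_nonneg_left (PiLp.norm_apply_le a i) (abs_nonneg _)

theorem abs_sub_le_of_dx_bound (f : Sm) (t C : ℝ) (hC : ∀ i x, |dx i f t x| ≤ C) (a b : E3) :
    |f t a - f t b| ≤ 3 * C * ‖a - b‖ := by
  refine Convex.norm_image_sub_le_of_norm_fderiv_le (𝕜 := ℝ) (f := f t) (s := univ)
    (fun x _ => (f.hasFDerivAt_slice t x).differentiableAt) (fun x _ => ?_) convex_univ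
    (mem_univ b) (mem_univ a)
  refine (f.norm_slice_deriv_le t x).trans ((Finset.sum_le_sum fun i _ => hC i x).trans ?_)
  simp

theorem second_difference_le (f : Sm) (t C : ℝ) (hC : ∀ i j x, |dx i (dx j f) t x| ≤ C)
    (x y : E3) : |f t x - (f t (x + y) + f t (x - y)) / 2| ≤ 9 * C * ‖y‖ ^ 2 := by
  have hC0 : 0 ≤ C := (abs_nonneg _).trans (hC 0 0 0)
  have hd : ∀ r : ℝ, ∀ a b : E3, HasDerivAt (fun r : ℝ => f t (a + r • b))
      (∑ i, b i * dx i f t (a + r • b)) r := by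
    intro r a b
    have h1 : HasDerivAt (fun r : ℝ => a + r • b) b r := by
      simpa using ((hasDerivAt_id r).smul_const b).const_add a
    have h2 := (f.hasFDerivAt_slice t (a + r • b)).comp_hasDerivAt r h1
    exact h2.congr_deriv (by simp [fderiv_eq])
  have hφ : ∀ r : ℝ, HasDerivAt (fun r : ℝ => f t (x + r • y) + f t (x + r • (-y)))
      (∑ i, y i * (dx i f t (x + r • y) - dx i f t (x + r • (-y)))) r := by
    intro r
    refine ((hd r x y).fun_add (hd r x (-y))).congr_deriv ?_
    rw [← Finset.sum_add_distrib]
    refine Finset.sum_congr rfl fun i _ => ?_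
    simp only [PiLp.neg_apply]
    ring
  -- The constant is `3` coordinates times `3C` (Lipschitz constant of a first derivative) times the
  -- distance `2|y|`; the second difference is half of this.
  have hb : ∀ r ∈ Icc (0 : ℝ) 1,
      ‖∑ i, y i * (dx i f t (x + r • y) - dx i f t (x + r • (-y)))‖ ≤ 18 * C * ‖y‖ ^ 2 := by
    intro r hr
    have h1 : ∀ i, |y i * (dx i f t (x + r • y) - dx i f t (x + r • (-y)))|
        ≤ ‖y‖ * (3 * C * (2 * ‖y‖)) := by
      intro i
      rw [abs_mul]
      refine mul_le_mul (PiLp.norm_apply_le y i) ?_ (abs_nonneg _) (norm_nonneg _)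
      refine ((dx i f).abs_sub_le_of_dx_bound t C (fun j x => hC j i x) _ _).trans ?_
      have : x + r • y - (x + r • (-y)) = (2 * r) • y := by
        rw [mul_smul, two_smul]; simp only [smul_neg]; abel
      rw [this, norm_smul]
      have : ‖2 * r‖ ≤ 2 := by
        rw [Real.norm_eq_abs, abs_of_nonneg (by linarith [hr.1])]; linarith [hr.2]
      gcongr
    refine (Finset.abs_sum_le_sum_abs _ _).trans ((Finset.sum_le_sum fun i _ => h1 i).trans ?_)
    simp only [Finset.sum_const, Finset.card_univ, Fintype.card_fin, nsmul_eq_mul]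
    push_cast
    nlinarith [norm_nonneg y]
  have := (convex_Icc (0 : ℝ) 1).norm_image_sub_le_of_norm_hasDerivWithin_le
    (fun r _ => (hφ r).hasDerivWithinAt) hb (left_mem_Icc.2 zero_le_one)
    (right_mem_Icc.2 zero_le_one)
  simp only [one_smul, zero_smul, add_zero, sub_zero, norm_one, mul_one, Real.norm_eq_abs] at this
  rw [abs_le] at this ⊢
  simp only [← sub_eq_add_neg] at this
  constructor <;> linarith [this.1, this.2]

end Sm

/-- The second difference is at most a constant times `A min(1, (n|y|)²)`, and scaling the kernel
yields `n^{2s}`. Thus `(-Δ)^s` costs exactly `2s` powers of the frequency in the supremum norm, with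
no loss at the end point. -/
theorem exists_fracMult_bound {s : ℝ} (h0 : 0 < s) (h1 : s < 1) :
    ∃ A₀, 0 < A₀ ∧ ∀ (f : Sm) (t A n : ℝ), 0 < n → (∀ x, |f t x| ≤ A) →
      (∀ i j x, |Sm.dx i (Sm.dx j f) t x| ≤ A * n ^ 2) →
      ∀ x, |mult (fracSymb s h0.le h1.le) f t x| ≤ A₀ * A * n ^ (2 * s) := by
  set J := ∫ y : E3, min 1 (‖y‖ ^ 2) * rieszKer s y with hJ
  have hJ0 : 0 ≤ J := integral_nonneg fun y => mul_nonneg (by positivity) (rieszKer_nonneg s y)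
  have hc := rieszConst_pos h0 h1
  refine ⟨(9 * J + 1) / rieszConst s, by positivity, fun f t A n hn hA hA2 x => ?_⟩
  have hA0 : 0 ≤ A := (abs_nonneg _).trans (hA 0)
  have hb : ∀ y, ‖(f t x - (f t (x + y) + f t (x - y)) / 2) * rieszKer s y‖
      ≤ 9 * A * ((fun z : E3 => min 1 (‖z‖ ^ 2)) (n • y) * rieszKer s y) := by
    intro y
    rw [norm_mul, Real.norm_of_nonneg (rieszKer_nonneg s y), ← mul_assoc]
    refine mul_le_mul_of_nonneg_right ?_ (rieszKer_nonneg s y)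
    beta_reduce
    rw [mul_min_of_nonneg _ _ (by positivity)]
    refine le_min ?_ ?_
    · have e1 := abs_le.1 (hA x)
      have e2 := abs_le.1 (hA (x + y))
      have e3 := abs_le.1 (hA (x - y))
      rw [Real.norm_eq_abs, abs_le]
      constructor <;> linarith [e1.1, e1.2, e2.1, e2.2, e3.1, e3.2]
    · refine (f.second_difference_le t _ hA2 x y).trans (le_of_eq ?_)
      rw [norm_smul, Real.norm_of_nonneg hn.le]
      ring
  have hi : Integrable fun y => (fun z : E3 => min 1 (‖z‖ ^ 2)) (n • y) * rieszKer s y := by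
    have hm := measurable_rieszKer s
    refine ((integrable_min_rieszKer h0 h1).const_mul (1 + n ^ 2)).mono' (by fun_prop)
      (Eventually.of_forall fun y => ?_)
    rw [Real.norm_of_nonneg (mul_nonneg (by positivity) (rieszKer_nonneg s y)), ← mul_assoc]
    refine mul_le_mul_of_nonneg_right ?_ (rieszKer_nonneg s y)
    beta_reduce
    rw [mul_min_of_nonneg _ _ (by positivity), norm_smul, Real.norm_of_nonneg hn.le, mul_pow]
    refine min_le_min ?_ ?_ <;> nlinarith [sq_nonneg n, sq_nonneg ‖y‖]
  have h3 := norm_integral_le_of_norm_le (hi.const_mul (9 * A)) (Eventually.of_forall hb)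
  rw [integral_const_mul, integral_comp_smul_rieszKer s (fun z : E3 => min 1 (‖z‖ ^ 2)) hn, ← hJ,
    ← mult_frac_eq_integral h0 h1 f t x, norm_mul, Real.norm_of_nonneg hc.le,
    Real.norm_eq_abs] at h3
  have h4 : |mult (fracSymb s h0.le h1.le) f t x| ≤ (9 * A * (n ^ (2 * s) * J)) / rieszConst s := by
    rw [le_div_iff₀ hc]; linarith
  refine h4.trans ?_
  rw [div_mul_eq_mul_div, div_mul_eq_mul_div]
  refine div_le_div_of_nonneg_right ?_ hc.le
  have : 0 ≤ A * n ^ (2 * s) := by positivity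
  nlinarith

section OdeFlow

set_option linter.unusedSectionVars false

/-! ### Smooth dependence of solutions of ordinary differential equations -/

/-- The continuous curves in `E` defined on the unit interval, with the supremum norm. -/
def Curve (E : Type) [NormedAddCommGroup E] : Type := C(unitInterval, E)

namespace Curve

variable {E : Type} [NormedAddCommGroup E]

instance : NormedAddCommGroup (Curve E) := inferInstanceAs (NormedAddCommGroup C(unitInterval, E))

instance [NormedSpace ℝ E] : NormedSpace ℝ (Curve E) :=
  inferInstanceAs (NormedSpace ℝ C(unitInterval, E))

instance [CompleteSpace E] : CompleteSpace (Curve E) :=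
  inferInstanceAs (CompleteSpace C(unitInterval, E))

instance : CoeFun (Curve E) fun _ => unitInterval → E := ⟨fun γ => ContinuousMap.toFun γ⟩

theorem continuous (γ : Curve E) : Continuous γ := ContinuousMap.continuous γ

theorem norm_le (γ : Curve E) {C : ℝ} (hC : 0 ≤ C) : ‖γ‖ ≤ C ↔ ∀ σ, ‖γ σ‖ ≤ C :=
  ContinuousMap.norm_le (α := unitInterval) (E := E) γ hC

theorem norm_coe_le_norm (γ : Curve E) (σ : unitInterval) : ‖γ σ‖ ≤ ‖γ‖ :=
  ContinuousMap.norm_coe_le_norm (α := unitInterval) (E := E) γ σ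

theorem ext {γ δ : Curve E} (h : ∀ σ, γ σ = δ σ) : γ = δ := ContinuousMap.ext h

/-- The constant curve. -/
def const (z : E) : Curve E := ContinuousMap.const _ z

/-- Evaluation at a parameter. -/
def evalCLM [NormedSpace ℝ E] (σ : unitInterval) : Curve E →L[ℝ] E :=
  LinearMap.mkContinuous
    { toFun := fun γ => γ σ
      map_add' := fun _ _ => rfl
      map_smul' := fun _ _ => rfl }
    1 (fun γ => by rw [one_mul]; exact γ.norm_coe_le_norm σ)

end Curve

/-! ### Superposition operators on spaces of curves. -/

section Superposition

variable {E F : Type} [NormedAddCommGroup E] [NormedSpace ℝ E] [NormedAddCommGroup F]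
  [NormedSpace ℝ F]

/-- Pointwise application of operator-valued functions. -/
def pointwiseApply : Curve (E →L[ℝ] F) →L[ℝ] Curve E →L[ℝ] Curve F :=
  LinearMap.mkContinuous₂
    (LinearMap.mk₂ ℝ
      (fun (A : Curve (E →L[ℝ] F)) (h : Curve E) =>
        (show Curve F from ⟨fun σ => A σ (h σ), A.continuous.clm_apply h.continuous⟩))
      (fun _ _ _ => Curve.ext fun _ => rfl) (fun _ _ _ => Curve.ext fun _ => rfl)
      (fun A _ _ => Curve.ext fun σ => map_add (A σ) _ _)
      (fun _ A _ => Curve.ext fun σ => map_smul (A σ) _ _))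
    1 (fun A h => by
      rw [Curve.norm_le _ (by positivity)]
      intro σ
      rw [one_mul]
      exact ((A σ).le_opNorm _).trans (mul_le_mul (A.norm_coe_le_norm σ) (h.norm_coe_le_norm σ)
        (norm_nonneg _) (norm_nonneg _)))

/-- The superposition operator `γ ↦ g ∘ γ`. -/
def superpose (g : E → F) (hg : Continuous g) (γ : Curve E) : Curve F :=
  (⟨g, hg⟩ : C(E, F)).comp (show C(unitInterval, E) from γ)

theorem continuous_superpose (g : E → F) (hg : Continuous g) : Continuous (superpose g hg) :=
  ContinuousMap.continuous_postcomp (X := unitInterval) (⟨g, hg⟩ : C(E, F))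

/-- The remainder must be small uniformly along the curve although `E` need not be locally compact.
The uniformity is taken from continuity of the superposition operator of `fderiv ℝ g` at `γ`. -/
theorem hasFDerivAt_superpose (g : E → F) (hg : ContDiff ℝ 1 g) (γ : Curve E) :
    HasFDerivAt (superpose g hg.continuous)
      (pointwiseApply (superpose (fderiv ℝ g) (hg.continuous_fderiv one_ne_zero) γ)) γ := by
  rw [hasFDerivAt_iff_isLittleO_nhds_zero, Asymptotics.isLittleO_iff]
  intro ε hε
  have hc := (continuous_superpose (fderiv ℝ g) (hg.continuous_fderiv one_ne_zero)).continuousAt (x := γ)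
  obtain ⟨δ, hδ, hδ'⟩ := Metric.continuousAt_iff.1 hc ε hε
  filter_upwards [Metric.ball_mem_nhds (0 : Curve E) hδ] with h hh
  rw [mem_ball_zero_iff] at hh
  rw [Curve.norm_le _ (by positivity)]
  intro σ
  have hb : ∀ y ∈ Metric.ball (γ σ) δ, ‖fderiv ℝ g y - fderiv ℝ g (γ σ)‖ ≤ ε := by
    intro y hy
    -- Translating the whole curve by a constant vector turns closeness of two points into closeness
    -- of two curves.
    have h1 : dist (γ + Curve.const (y - γ σ)) γ < δ := by
      rw [dist_eq_norm, add_sub_cancel_left]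
      refine lt_of_le_of_lt ((Curve.norm_le _ (norm_nonneg _)).2 fun _ => le_rfl) ?_
      rwa [mem_ball_iff_norm] at hy
    have h2 := hδ' h1
    rw [dist_eq_norm] at h2
    have h3 := (Curve.norm_coe_le_norm _ σ).trans h2.le
    change ‖fderiv ℝ g (γ σ + (y - γ σ)) - fderiv ℝ g (γ σ)‖ ≤ ε at h3
    rwa [add_sub_cancel] at h3
  have h4 := (convex_ball (γ σ) δ).norm_image_sub_le_of_norm_hasFDerivWithin_le'
    (f := g) (f' := fderiv ℝ g) (φ := fderiv ℝ g (γ σ))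
    (fun y _ => ((hg.differentiable one_ne_zero) y).hasFDerivAt.hasFDerivWithinAt) hb
    (Metric.mem_ball_self hδ) (y := γ σ + h σ) (by
      rw [mem_ball_iff_norm, add_sub_cancel_left]
      exact (h.norm_coe_le_norm σ).trans_lt hh)
  rw [add_sub_cancel_left] at h4
  exact h4.trans (mul_le_mul_of_nonneg_left (h.norm_coe_le_norm σ) hε.le)

end Superposition

/-- The derivative is the superposition operator of `fderiv ℝ g` followed by a continuous linear
map; the target space varies in the induction for this reason. -/
theorem contDiff_superpose {E : Type} [NormedAddCommGroup E] [NormedSpace ℝ E] (n : ℕ) :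
    ∀ {F : Type} [NormedAddCommGroup F] [NormedSpace ℝ F] (g : E → F) (hg : ContDiff ℝ ∞ g),
      ContDiff ℝ n (superpose g hg.continuous) := by
  induction n with
  | zero => exact fun g hg => contDiff_zero.2 (continuous_superpose g _)
  | succ n ih =>
    intro F _ _ g hg
    have hd := hasFDerivAt_superpose g (hg.of_le (by exact_mod_cast le_top))
    push_cast
    rw [contDiff_succ_iff_fderiv]
    refine ⟨fun γ => (hd γ).differentiableAt, by simp, ?_⟩
    have : fderiv ℝ (superpose g hg.continuous) = fun γ => pointwiseApply
        (superpose (fderiv ℝ g) (hg.fderiv_right (m := ∞) (by simp)).continuous γ) :=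
      funext fun γ => (hd γ).fderiv
    rw [this]
    exact pointwiseApply.contDiff.comp (ih (fderiv ℝ g) (hg.fderiv_right (m := ∞) (by simp)))

/-! ### Flows of bounded Lipschitz fields and their smoothness. -/

section Flow

variable {E : Type} [NormedAddCommGroup E] [NormedSpace ℝ E] [CompleteSpace E]

/-- The primitive vanishing at zero. -/
def primitive : Curve E →L[ℝ] Curve E :=
  LinearMap.mkContinuous
    { toFun := fun h => show Curve E from ⟨fun σ => ∫ r in (0 : ℝ)..σ, h (projIcc 0 1 zero_le_one r),
        (intervalIntegral.continuous_primitive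
          (fun a b => (h.continuous.comp continuous_projIcc).intervalIntegrable a b) 0).comp
          continuous_subtype_val⟩
      map_add' := fun h k => by
        refine Curve.ext fun σ => ?_
        exact intervalIntegral.integral_add
          ((h.continuous.comp continuous_projIcc).intervalIntegrable _ _)
          ((k.continuous.comp continuous_projIcc).intervalIntegrable _ _)
      map_smul' := fun c h => by
        refine Curve.ext fun σ => ?_
        exact intervalIntegral.integral_smul c _ }
    1 (fun h => by
      rw [one_mul, Curve.norm_le _ (norm_nonneg _)]
      intro σ
      have h1 := intervalIntegral.norm_integral_le_of_norm_le_const (a := 0) (b := (σ : ℝ))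
        (f := fun r => h (projIcc 0 1 zero_le_one r)) (C := ‖h‖)
        (fun r _ => h.norm_coe_le_norm _)
      refine h1.trans ?_
      rw [sub_zero, abs_of_nonneg σ.2.1]
      exact mul_le_of_le_one_right (norm_nonneg _) σ.2.2)

theorem primitive_apply (h : Curve E) (σ : unitInterval) :
    primitive h σ = ∫ r in (0 : ℝ)..σ, h (projIcc 0 1 zero_le_one r) := rfl

theorem norm_primitive_le : ‖(primitive : Curve E →L[ℝ] Curve E)‖ ≤ 1 :=
  LinearMap.mkContinuous_norm_le _ zero_le_one _

/-- The constant functions, as a continuous linear map. -/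
def constCLM : E →L[ℝ] Curve E :=
  LinearMap.mkContinuous
    { toFun := fun z => Curve.const z
      map_add' := fun _ _ => rfl
      map_smul' := fun _ _ => rfl }
    1 (fun z => by
      rw [one_mul]
      exact (Curve.norm_le _ (norm_nonneg _)).2 fun _ => le_rfl)

/-- The equation of the flow, in integrated form and in rescaled time. -/
def flowEq (V : E → E) (hV : Continuous V) (p : (ℝ × E) × Curve E) :
    Curve E :=
  p.2 - constCLM p.1.2 - p.1.1 • primitive (superpose V hV p.2)

theorem contDiff_flowEq (V : E → E) (hV : ContDiff ℝ ∞ V) :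
    ContDiff ℝ ∞ (flowEq V hV.continuous) := by
  have h1 : ContDiff ℝ ∞ (superpose V hV.continuous) :=
    contDiff_infty.2 fun n => contDiff_superpose n V hV
  have h2 : ContDiff ℝ ∞ fun p : (ℝ × E) × Curve E =>
      primitive (superpose V hV.continuous p.2) :=
    primitive.contDiff.comp (h1.comp contDiff_snd)
  have h3 : ContDiff ℝ ∞ fun p : (ℝ × E) × Curve E => constCLM p.1.2 :=
    constCLM.contDiff.comp (contDiff_snd.comp contDiff_fst)
  exact (contDiff_snd.sub h3).sub ((contDiff_fst.comp contDiff_fst).smul h2)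

/-- The derivative in the curve is `1 - K` with `‖K‖ ≤ |s| L < 1`, hence invertible by the Neumann
series. -/
theorem isInvertible_flowEq (V : E → E) (hV : ContDiff ℝ ∞ V) {L : NNReal} (hL : LipschitzWith L V)
    (s : ℝ) (hs : |s| * L < 1) (z : E) (γ : Curve E) :
    (fderiv ℝ (flowEq V hV.continuous) ((s, z), γ) ∘L
      .inr ℝ (ℝ × E) (Curve E)).IsInvertible := by
  set A := superpose (fderiv ℝ V) (hV.continuous_fderiv (by simp)) γ with hA
  set K : Curve E →L[ℝ] Curve E := s • (primitive ∘L pointwiseApply A) with hK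
  have h1 : HasFDerivAt (fun γ => flowEq V hV.continuous ((s, z), γ)) (1 - K) γ := by
    have hd := hasFDerivAt_superpose V (hV.of_le (by exact_mod_cast le_top)) γ
    have h2 := ((primitive.hasFDerivAt (x := superpose V hV.continuous γ)).comp γ hd).const_smul s
    exact ((hasFDerivAt_id γ).sub_const (constCLM z)).fun_sub h2
  have h2 : HasFDerivAt (fun γ => flowEq V hV.continuous ((s, z), γ))
      (fderiv ℝ (flowEq V hV.continuous) ((s, z), γ) ∘L .inr ℝ (ℝ × E) (Curve E)) γ :=
    (((contDiff_flowEq V hV).differentiable (by simp)) ((s, z), γ)).hasFDerivAt.comp γ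
      (hasFDerivAt_prodMk_right (s, z) γ)
  rw [h2.unique h1]
  have hA1 : ‖A‖ ≤ L := (Curve.norm_le _ L.2).2 fun σ => norm_fderiv_le_of_lipschitz ℝ hL
  have hPA : ‖(pointwiseApply A : Curve E →L[ℝ] Curve E)‖ ≤ L := by
    refine ContinuousLinearMap.opNorm_le_bound _ L.2 fun h => ?_
    rw [Curve.norm_le _ (by positivity)]
    intro σ
    exact ((A σ).le_opNorm _).trans (mul_le_mul ((A.norm_coe_le_norm σ).trans hA1)
      (h.norm_coe_le_norm σ) (norm_nonneg _) L.2)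
  have hK1 : ‖K‖ < 1 := by
    refine lt_of_le_of_lt ?_ hs
    rw [hK, norm_smul, Real.norm_eq_abs]
    refine mul_le_mul_of_nonneg_left ((ContinuousLinearMap.opNorm_comp_le _ _).trans ?_)
      (abs_nonneg s)
    calc _ ≤ 1 * (L : ℝ) := mul_le_mul norm_primitive_le hPA (norm_nonneg _) zero_le_one
      _ = L := one_mul _
  obtain ⟨u, hu⟩ := isUnit_one_sub_of_norm_lt_one hK1
  exact ⟨ContinuousLinearEquiv.ofUnit u, by rw [← hu]; rfl⟩

/-- A global flow of an autonomous vector field. -/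
structure IsFlow (V : E → E) (φ : ℝ → E → E) : Prop where
  zero : ∀ z, φ 0 z = z
  deriv : ∀ s z, HasDerivAt (fun s => φ s z) (V (φ s z)) s

/-- A bounded field cannot leave the ball of radius `M(m+1)` before time `m+1`, so Picard–Lindelöf
applies on each such interval; uniqueness glues the solutions. -/
theorem exists_isFlow {V : E → E} {L : NNReal} (hL : LipschitzWith L V) {M : NNReal}
    (hM : ∀ z, ‖V z‖ ≤ M) : ∃ φ, IsFlow V φ := by
  have h1 : ∀ (m : ℕ) (z : E), ∃ α : ℝ → E, α 0 = z ∧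
      ∀ t ∈ Ioo (-(m + 1) : ℝ) (m + 1), HasDerivAt α (V (α t)) t := by
    intro m z
    have hm : (0 : ℝ) ∈ Icc (-(m + 1) : ℝ) (m + 1) := ⟨by linarith [m.cast_nonneg (α := ℝ)], by positivity⟩
    have hp : IsPicardLindelof (fun _ => V) (⟨0, hm⟩ : Icc (-(m + 1) : ℝ) (m + 1)) z
        (M * (m + 1)) 0 M L :=
      { lipschitzOnWith := fun _ _ => hL.lipschitzOnWith
        continuousOn := fun _ _ => continuousOn_const
        norm_le := fun _ _ x _ => hM x
        mul_max_le := by simp }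
    obtain ⟨α, hα, hα'⟩ := hp.exists_eq_forall_mem_Icc_hasDerivWithinAt₀
    exact ⟨α, hα, fun t ht => (hα' t (Ioo_subset_Icc_self ht)).hasDerivAt (Icc_mem_nhds ht.1 ht.2)⟩
  choose α hα hα' using h1
  have hmem : ∀ (m : ℕ) (t : ℝ), ⌊|t|⌋₊ ≤ m → t ∈ Ioo (-(m + 1) : ℝ) (m + 1) := by
    intro m t h
    have := (Nat.lt_floor_add_one |t|)
    have h2 : (⌊|t|⌋₊ : ℝ) ≤ m := by exact_mod_cast h
    rw [mem_Ioo, ← abs_lt]; linarith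
  have huniq : ∀ (m m' : ℕ) (z : E) (t : ℝ), ⌊|t|⌋₊ ≤ m → ⌊|t|⌋₊ ≤ m' → α m z t = α m' z t := by
    have key : ∀ (m m' : ℕ) (z : E) (t : ℝ), ⌊|t|⌋₊ ≤ m → m ≤ m' → α m z t = α m' z t := by
      intro m m' z t h h'
      have hmm : (m : ℝ) ≤ m' := by exact_mod_cast h'
      refine ODE_solution_unique_of_mem_Ioo (v := fun _ => V) (s := fun _ => univ) (K := L)
        (fun _ _ => hL.lipschitzOnWith) (hmem m 0 (by simp))
        (fun t ht => ⟨hα' m z t ht, mem_univ _⟩)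
        (fun t ht => ⟨hα' m' z t ⟨by linarith [ht.1], by linarith [ht.2]⟩, mem_univ _⟩)
        (by rw [hα, hα]) (hmem m t h)
    intro m m' z t h h'
    rcases le_total m m' with hm | hm
    · exact key m m' z t h hm
    · exact (key m' m z t h' hm).symm
  refine ⟨fun s z => α ⌊|s|⌋₊ z s, fun z => hα _ z, fun s z => ?_⟩
  have h2 := hα' (⌊|s|⌋₊ + 1) z s (hmem _ s (Nat.le_succ _))
  rw [huniq (⌊|s|⌋₊ + 1) ⌊|s|⌋₊ z s (Nat.le_succ _) le_rfl] at h2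
  refine h2.congr_of_eventuallyEq ?_
  have ho : ∀ᶠ r : ℝ in 𝓝 s, |r| < (⌊|s|⌋₊ : ℝ) + 1 :=
    (continuous_abs.tendsto s).eventually_lt_const (Nat.lt_floor_add_one |s|)
  filter_upwards [ho] with r hr
  refine huniq _ _ z r le_rfl ?_
  have : ⌊|r|⌋₊ < ⌊|s|⌋₊ + 1 := by
    rw [Nat.floor_lt (abs_nonneg r)]; exact_mod_cast hr
  omega

namespace IsFlow

variable {V : E → E} {φ : ℝ → E → E} {L : NNReal}

theorem unique (h : IsFlow V φ) (hL : LipschitzWith L V) {α : ℝ → E} {z : E} (h0 : α 0 = z)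
    (h1 : ∀ s, HasDerivAt α (V (α s)) s) (s : ℝ) : α s = φ s z := by
  refine congrFun (ODE_solution_unique_univ (v := fun _ => V) (s := fun _ => univ) (K := L)
    (t₀ := 0) (fun _ => hL.lipschitzOnWith) (fun t => ⟨h1 t, mem_univ _⟩)
    (fun t => ⟨h.deriv t z, mem_univ _⟩) ?_) s
  rw [h0, h.zero]

theorem add (h : IsFlow V φ) (hL : LipschitzWith L V) (s r : ℝ) (z : E) :
    φ (s + r) z = φ s (φ r z) := by
  refine h.unique hL (α := fun s => φ (s + r) z) (by simp) (fun s => ?_) s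
  have := (h.deriv (s + r) z).scomp s ((hasDerivAt_id s).add_const r)
  simpa using! this

theorem flowEq_eq_zero (h : IsFlow V φ) (hV : Continuous V) (s : ℝ) (z : E)
    (γ : Curve E) (hγ : ∀ σ : unitInterval, γ σ = φ (s * σ) z) :
    flowEq V hV ((s, z), γ) = 0 := by
  refine Curve.ext fun σ => ?_
  have hd : ∀ r : ℝ, HasDerivAt (fun r => φ (s * r) z) (s • V (φ (s * r) z)) r := by
    intro r
    have h1 : HasDerivAt (fun r : ℝ => s * r) s r := by simpa using (hasDerivAt_id r).const_mul s
    exact (h.deriv (s * r) z).scomp r h1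
  have hc : Continuous fun r => φ (s * r) z :=
    continuous_iff_continuousAt.2 fun r => (hd r).continuousAt
  have hI := intervalIntegral.integral_eq_sub_of_hasDerivAt (a := 0) (b := (σ : ℝ))
    (fun r _ => hd r) ((continuous_const.smul (hV.comp hc)).intervalIntegrable _ _)
  simp only [mul_zero, h.zero] at hI
  change γ σ - z - s • primitive (superpose V hV γ) σ = 0
  rw [primitive_apply, ← intervalIntegral.integral_smul, hγ σ, sub_sub, sub_eq_zero]
  rw [eq_add_of_sub_eq' hI.symm]
  congr 1
  refine intervalIntegral.integral_congr fun r hr => ?_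
  rw [uIcc_of_le σ.2.1] at hr
  have hr1 : r ∈ Icc (0 : ℝ) 1 := ⟨hr.1, hr.2.trans σ.2.2⟩
  change s • V (φ (s * r) z) = s • V (γ (projIcc 0 1 zero_le_one r))
  rw [hγ, projIcc_of_mem zero_le_one hr1]

/-- Converse of `flowEq_eq_zero`: it identifies the implicit function evaluated at the end of the
curve with the flow. -/
theorem eq_of_flowEq_eq_zero (h : IsFlow V φ) (hL : LipschitzWith L V) (s : ℝ) (z : E)
    (γ : Curve E) (hγ : flowEq V hL.continuous ((s, z), γ) = 0) : γ 1 = φ s z := by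
  set c : ℝ → E := fun r => γ (projIcc 0 1 zero_le_one r) with hc
  have hcc : Continuous c := γ.continuous.comp continuous_projIcc
  have h1 : ∀ r ∈ Icc (0 : ℝ) 1, c r = z + s • ∫ r in (0 : ℝ)..r, V (c r) := by
    intro r hr
    have h2 := congrArg (fun f : Curve E => f ⟨r, hr⟩) hγ
    change γ ⟨r, hr⟩ - z - s • primitive (superpose V hL.continuous γ) ⟨r, hr⟩ = 0 at h2
    rw [primitive_apply, sub_sub, sub_eq_zero] at h2
    rw [hc]
    beta_reduce
    rw [projIcc_of_mem zero_le_one hr, h2]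
    rfl
  have hd : ∀ r : ℝ, HasDerivAt (fun r => z + s • ∫ r in (0 : ℝ)..r, V (c r)) (s • V (c r)) r :=
    fun r => ((intervalIntegral.integral_hasDerivAt_right
      ((hL.continuous.comp hcc).intervalIntegrable _ _)
      ((hL.continuous.comp hcc).stronglyMeasurableAtFilter _ _)
      (hL.continuous.comp hcc).continuousAt).const_smul s).const_add z
  have hd2 : ∀ r : ℝ, HasDerivAt (fun r => φ (s * r) z) (s • V (φ (s * r) z)) r := by
    intro r
    have h1 : HasDerivAt (fun r : ℝ => s * r) s r := by simpa using (hasDerivAt_id r).const_mul s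
    exact (h.deriv (s * r) z).scomp r h1
  have key := ODE_solution_unique (v := fun _ x => s • V x) (K := ‖s‖₊ * L) (a := 0) (b := 1)
    (fun _ => (lipschitzWith_smul s).comp hL)
    (f := fun r => z + s • ∫ r in (0 : ℝ)..r, V (c r)) (g := fun r => φ (s * r) z)
    (fun r _ => (hd r).continuousAt.continuousWithinAt)
    (fun r hr => by
      rw [← h1 r (Ico_subset_Icc_self hr)]
      exact (hd r).hasDerivWithinAt)
    (fun r _ => (hd2 r).continuousAt.continuousWithinAt)
    (fun r _ => (hd2 r).hasDerivWithinAt) (by simp [h.zero])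
  have h3 := key (right_mem_Icc.2 zero_le_one)
  beta_reduce at h3
  rw [← h1 1 (right_mem_Icc.2 zero_le_one), mul_one] at h3
  rw [← h3, hc]
  beta_reduce
  rw [projIcc_right]
  rfl

/-- The implicit function theorem in the Banach space of curves makes the solution curve depend
smoothly on time and initial point jointly, time having been scaled into a parameter. -/
theorem contDiffAt_of_small (h : IsFlow V φ) (hV : ContDiff ℝ ∞ V) (hL : LipschitzWith L V)
    (s : ℝ) (hs : |s| * L < 1) (z : E) : ContDiffAt ℝ ∞ (fun p : ℝ × E => φ p.1 p.2) (s, z) := by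
  have hc : Continuous fun r => φ r z :=
    continuous_iff_continuousAt.2 fun r => (h.deriv r z).continuousAt
  let γ : Curve E := show Curve E from ⟨fun σ => φ (s * σ) z,
    hc.comp (continuous_const.mul continuous_subtype_val)⟩
  have hF := (contDiff_flowEq V hV).contDiffAt (x := ((s, z), γ))
  have hinv := isInvertible_flowEq V hV hL s hs z γ
  have h0 : flowEq V hV.continuous ((s, z), γ) = 0 := h.flowEq_eq_zero _ s z γ fun _ => rfl
  have h1 := hF.eventually_apply_implicitFunction (by simp) hinv
  have h2 := hF.contDiffAt_implicitFunction (by simp) hinv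
  have h3 : ContDiffAt ℝ ∞ (fun p : ℝ × E => (hF.implicitFunction (by simp) hinv p) 1) (s, z) :=
    (Curve.evalCLM (E := E) (1 : unitInterval)).contDiff.contDiffAt.comp (s, z) h2
  refine h3.congr_of_eventuallyEq ?_
  filter_upwards [h1] with p hp
  rw [h0] at hp
  exact (h.eq_of_flowEq_eq_zero hL p.1 p.2 _ hp).symm

/-- Smallness of the time is removed by halving, since `φ_s = φ_{s/2} ∘ φ_{s/2}`. -/
theorem contDiff (h : IsFlow V φ) (hV : ContDiff ℝ ∞ V) (hL : LipschitzWith L V) :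
    ContDiff ℝ ∞ (fun p : ℝ × E => φ p.1 p.2) := by
  have key : ∀ m : ℕ, ∀ s : ℝ, |s| * L < 2 ^ m → ∀ z,
      ContDiffAt ℝ ∞ (fun p : ℝ × E => φ p.1 p.2) (s, z) := by
    intro m
    induction m with
    | zero => intro s hs z; exact h.contDiffAt_of_small hV hL s (by simpa using hs) z
    | succ m ih =>
      intro s hs z
      have hs' : |s / 2| * L < 2 ^ m := by
        rw [abs_div, abs_two, div_mul_eq_mul_div, div_lt_iff₀ two_pos]
        rwa [pow_succ] at hs
      have h1 : (fun p : ℝ × E => φ p.1 p.2) = fun p => φ (p.1 / 2) (φ (p.1 / 2) p.2) := by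
        funext p; rw [← h.add hL, add_halves]
      rw [h1]
      have h2 : ContDiffAt ℝ ∞ (fun p : ℝ × E => (p.1 / 2, p.2)) (s, z) :=
        ((contDiff_fst.div_const 2).prodMk contDiff_snd).contDiffAt
      have h3 : ContDiffAt ℝ ∞ (fun p : ℝ × E => φ (p.1 / 2) p.2) (s, z) :=
        ContDiffAt.comp (g := fun p : ℝ × E => φ p.1 p.2) (s, z) (ih (s / 2) hs' z) h2
      exact ContDiffAt.comp (g := fun p : ℝ × E => φ p.1 p.2) (s, z)
        (ih (s / 2) hs' (φ (s / 2) z)) ((contDiff_fst.div_const 2).contDiffAt.prodMk h3)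
  refine contDiff_iff_contDiffAt.2 fun p => ?_
  obtain ⟨m, hm⟩ := pow_unbounded_of_one_lt (|p.1| * L) (one_lt_two (α := ℝ))
  exact key m p.1 hm p.2

end IsFlow

end Flow

end OdeFlow

/-! ### The Lagrangian coordinates of a vector field -/

/-- The coordinates transported by the vector field `v`, their gradient and its inverse. -/
structure TransportMap (v : Fin 3 → Sm) where
  /-- the coordinate map -/
  map : ℝ × E3 → E3
  /-- `grad l i` is the derivative of the `l`-th coordinate in the direction `i` -/
  grad : Fin 3 → Fin 3 → Sm
  /-- the inverse matrix of the gradient -/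
  inv : Fin 3 → Fin 3 → Sm
  differentiable : Differentiable ℝ map
  contDiff : ContDiff ℝ ∞ map
  translate : ∀ i z, map (z + (0, (2 * Real.pi) • stdVec i)) = map z + (2 * Real.pi) • stdVec i
  fderiv_eq : ∀ z a l, fderiv ℝ map z a l
    = ∑ i, (a.2 i - a.1 * v i z.1 z.2) * grad l i z.1 z.2
  grad_mul_inv : ∀ l q, ∑ m, grad l m * inv m q = if l = q then 1 else 0

/-- The derivatives of a map of the torus. -/
def torusMapDeriv (F : ℝ × E3 → E3) (hF : ContDiff ℝ ∞ F)
    (hp : ∀ i z, F (z + (0, (2 * Real.pi) • stdVec i)) = F z + (2 * Real.pi) • stdVec i)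
    (a : ℝ × E3) (l : Fin 3) : Sm :=
  ⟨fun t x => fderiv ℝ F (t, x) a l,
    (EuclideanSpace.proj (𝕜 := ℝ) l).contDiff.comp
      ((hF.fderiv_right (m := ∞) (by simp)).clm_apply contDiff_const),
    fun t i x => by
      beta_reduce
      have h := fderiv_comp_add_right (𝕜 := ℝ) (f := F) (x := (t, x))
        ((0, (2 * Real.pi) • stdVec i) : ℝ × E3)
      rw [show (fun z => F (z + (0, (2 * Real.pi) • stdVec i)))
        = fun z => F z + (2 * Real.pi) • stdVec i from funext (hp i), fderiv_add_const] at h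
      rw [h]
      simp⟩

theorem torusMapDeriv_apply (F : ℝ × E3 → E3) (hF : ContDiff ℝ ∞ F)
    (hp : ∀ i z, F (z + (0, (2 * Real.pi) • stdVec i)) = F z + (2 * Real.pi) • stdVec i)
    (a : ℝ × E3) (l : Fin 3) (t : ℝ) (x : E3) :
    torusMapDeriv F hF hp a l t x = fderiv ℝ F (t, x) a l := rfl

/-- The composition of a smooth function with a map of the torus. -/
def compTorusMap (F : ℝ × E3 → E3) (hF : ContDiff ℝ ∞ F)
    (hp : ∀ i z, F (z + (0, (2 * Real.pi) • stdVec i)) = F z + (2 * Real.pi) • stdVec i)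
    (n : ℕ) (f : Sm) : Sm :=
  ⟨fun t x => f t ((n : ℝ) • F (t, x)),
    f.smooth.comp (contDiff_fst.prodMk (contDiff_const.fun_smul hF) :
      ContDiff ℝ ∞ fun z : ℝ × E3 => (z.1, (n : ℝ) • F z)),
    fun t i x => by
      beta_reduce
      have h := hp i (t, x)
      simp only [Prod.mk_add_mk, add_zero] at h
      rw [h, smul_add, smul_smul]
      have h2 := (f.periodic t).add_int i n ((n : ℝ) • F (t, x))
      rw [← h2]
      simp only [Int.cast_natCast]
      ring_nf⟩

theorem compTorusMap_apply (F : ℝ × E3 → E3) (hF : ContDiff ℝ ∞ F)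
    (hp : ∀ i z, F (z + (0, (2 * Real.pi) • stdVec i)) = F z + (2 * Real.pi) • stdVec i)
    (n : ℕ) (f : Sm) (t : ℝ) (x : E3) :
    compTorusMap F hF hp n f t x = f t ((n : ℝ) • F (t, x)) := rfl

/-- The space-time vector field `(1, v)`. -/
def spaceTimeField (v : Fin 3 → Sm) (z : ℝ × E3) : ℝ × E3 :=
  (1, WithLp.toLp 2 fun i => v i z.1 z.2)

theorem contDiff_spaceTimeField (v : Fin 3 → Sm) : ContDiff ℝ ∞ (spaceTimeField v) := by
  refine contDiff_const.prodMk (contDiff_euclidean.2 fun i => ?_)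
  exact (v i).smooth

theorem spaceTimeField_translate (v : Fin 3 → Sm) (i : Fin 3) (z : ℝ × E3) :
    spaceTimeField v (z + (0, (2 * Real.pi) • stdVec i)) = spaceTimeField v z := by
  simp [spaceTimeField, (v _).periodic z.1 i z.2]

/-- The field and its derivative are periodic in space, and for large times the field is constant;
compactness covers the rest. -/
theorem exists_bound_spaceTimeField (v : Fin 3 → Sm) (B : ℝ)
    (hB : ∀ i t x, B < |t| → v i t x = 0) :
    (∃ M : NNReal, ∀ z, ‖spaceTimeField v z‖ ≤ M) ∧
      ∃ L : NNReal, LipschitzWith L (spaceTimeField v) := by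
  have hV := contDiff_spaceTimeField v
  constructor
  · obtain ⟨C, hC0, hC⟩ := exists_bound_of_periodic hV.continuous (fun t i x => by
      simpa using spaceTimeField_translate v i (t, x)) (isCompact_Icc (a := -B) (b := B))
    refine ⟨⟨C + 1, by linarith⟩, fun z => ?_⟩
    change _ ≤ C + 1
    by_cases h : B < |z.1|
    · have : spaceTimeField v z = (1, 0) := by
        ext j
        · rfl
        · simp [spaceTimeField, hB j z.1 z.2 h]
      rw [this, Prod.norm_mk]; simp [hC0.le]
    · exact (hC z.1 (abs_le.1 (not_lt.1 h)) z.2).trans (by linarith)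
  · obtain ⟨C, hC0, hC⟩ := exists_bound_of_periodic
      (hV.continuous_fderiv (by simp)) (fun t i x => by
        have h := fderiv_comp_add_right (𝕜 := ℝ) (f := spaceTimeField v) (x := (t, x))
          ((0, (2 * Real.pi) • stdVec i) : ℝ × E3)
        rw [funext (spaceTimeField_translate v i)] at h
        beta_reduce; rw [h]; simp) (isCompact_Icc (a := -B) (b := B))
    refine ⟨⟨C, hC0.le⟩, lipschitzWith_of_nnnorm_fderiv_le (hV.differentiable (by simp)) fun z => ?_⟩
    change ‖fderiv ℝ (spaceTimeField v) z‖ ≤ C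
    by_cases h : B < |z.1|
    · have ho : ∀ᶠ w : ℝ × E3 in 𝓝 z, B < |w.1| :=
        ((continuous_abs.comp continuous_fst).tendsto z).eventually_const_lt h
      have : spaceTimeField v =ᶠ[𝓝 z] fun _ => (1, 0) := by
        filter_upwards [ho] with w hw
        ext j
        · rfl
        · simp [spaceTimeField, hB j w.1 w.2 hw]
      rw [this.fderiv_eq]
      simp [hC0.le]
    · exact hC z.1 (abs_le.1 (not_lt.1 h)) z.2

/-- The flow of the autonomous field `(1, v)` carries `(t, x)` back to time zero, which defines the
coordinates; the forward flow is their inverse and supplies the inverse gradient. -/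
theorem exists_transportMap (v : Fin 3 → Sm) (B : ℝ) (hB : ∀ i t x, B < |t| → v i t x = 0) :
    Nonempty (TransportMap v) := by
  obtain ⟨⟨M, hM⟩, L, hL⟩ := exists_bound_spaceTimeField v B hB
  obtain ⟨φ, hφ⟩ := exists_isFlow hL hM
  have hV := contDiff_spaceTimeField v
  have hs := hφ.contDiff hV hL
  have hfst : ∀ s z, (φ s z).1 = z.1 + s := by
    intro s z
    have hd : ∀ s, HasDerivAt (fun s => (φ s z).1 - s) 0 s := fun s => by
      have h1 : HasDerivAt (fun s => (φ s z).1) 1 s :=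
        (ContinuousLinearMap.fst ℝ ℝ E3).hasFDerivAt.comp_hasDerivAt s (hφ.deriv s z)
      exact (h1.sub (hasDerivAt_id s)).congr_deriv (sub_self _)
    have := is_const_of_deriv_eq_zero (fun s => (hd s).differentiableAt)
      (fun s => (hd s).deriv) s 0
    simp only [hφ.zero, sub_zero] at this
    linarith
  have htr : ∀ i s z, φ s (z + (0, (2 * Real.pi) • stdVec i))
      = φ s z + (0, (2 * Real.pi) • stdVec i) := by
    intro i s z
    refine (hφ.unique hL (α := fun s => φ s z + (0, (2 * Real.pi) • stdVec i))
      (by simp [hφ.zero]) (fun s => ?_) s).symm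
    rw [spaceTimeField_translate]
    exact (hφ.deriv s z).add_const _
  set Φ : ℝ × E3 → E3 := fun z => (φ (-z.1) z).2 with hΦ
  set X : ℝ × E3 → E3 := fun z => (φ z.1 (0, z.2)).2 with hX
  have hΦs : ContDiff ℝ ∞ Φ := contDiff_snd.comp (hs.comp (contDiff_fst.neg.prodMk contDiff_id))
  have hXs : ContDiff ℝ ∞ X :=
    contDiff_snd.comp (hs.comp (contDiff_fst.prodMk (contDiff_const.prodMk contDiff_snd)))
  have hΦt : ∀ i z, Φ (z + (0, (2 * Real.pi) • stdVec i)) = Φ z + (2 * Real.pi) • stdVec i := by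
    intro i z
    simp only [hΦ, htr, Prod.fst_add, add_zero, Prod.snd_add]
  have hXt : ∀ i z, X (z + (0, (2 * Real.pi) • stdVec i)) = X z + (2 * Real.pi) • stdVec i := by
    intro i z
    have h := htr i z.1 (0, z.2)
    simp only [Prod.mk_add_mk, add_zero] at h
    simp only [hX, Prod.fst_add, add_zero, Prod.snd_add, h]
  have hΦd := hΦs.differentiable (by simp)
  have hXd := hXs.differentiable (by simp)
  -- The coordinates are constant along trajectories; differentiating this at `s = 0` is the
  -- transport equation.
  have htransport : ∀ z, fderiv ℝ Φ z (spaceTimeField v z) = 0 := by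
    intro z
    have h1 : HasDerivAt (fun s => Φ (φ s z)) (fderiv ℝ Φ (φ 0 z) (spaceTimeField v (φ 0 z))) 0 :=
      HasFDerivAt.comp_hasDerivAt (l := Φ) (f := fun s => φ s z) 0 (hΦd (φ 0 z)).hasFDerivAt
        (hφ.deriv 0 z)
    have h2 : (fun s => Φ (φ s z)) = fun _ => Φ z := by
      funext s
      simp only [hΦ]
      rw [← hφ.add hL, hfst]
      ring_nf
    rw [h2, hφ.zero] at h1
    exact h1.unique (hasDerivAt_const _ _)
  have hXΦ : ∀ t x, X (t, Φ (t, x)) = x := by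
    intro t x
    have h1 : ((0 : ℝ), Φ (t, x)) = φ (-t) (t, x) := by
      ext1
      · rw [hfst]; simp
      · rfl
    simp only [hX]
    rw [h1, ← hφ.add hL]
    simp [hφ.zero]
  set G : Fin 3 → Fin 3 → Sm := fun l i => torusMapDeriv Φ hΦs hΦt (0, stdVec i) l with hG
  set I : Fin 3 → Fin 3 → Sm :=
    fun m q => compTorusMap Φ hΦs hΦt 1 (torusMapDeriv X hXs hXt (0, stdVec q) m) with hI
  have hbas : ∀ b : E3, b = ∑ i, b i • stdVec i := by
    intro b
    ext j
    fin_cases j <;> simp [Fin.sum_univ_three, stdVec]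
  have hlin : ∀ (F : ℝ × E3 → E3) (z : ℝ × E3) (b : E3) (l : Fin 3), fderiv ℝ F z (0, b) l
      = ∑ i, b i * fderiv ℝ F z (0, stdVec i) l := by
    intro F z b l
    have h : ((0 : ℝ), b) = ∑ i, b i • ((0 : ℝ), stdVec i) := by
      ext1
      · simp [Prod.fst_sum]
      · simpa [Prod.snd_sum] using hbas b
    rw [h, map_sum]
    simp only [map_smul, WithLp.ofLp_sum, Finset.sum_apply, PiLp.smul_apply, smul_eq_mul]
  refine ⟨⟨Φ, G, I, hΦd, hΦs, hΦt, fun z a l => ?_, ?_⟩⟩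
  · have h1 : a = a.1 • spaceTimeField v z + (0, a.2 - a.1 • (spaceTimeField v z).2) := by
      ext1
      · simp [spaceTimeField]
      · simp [spaceTimeField]
    have h2 : fderiv ℝ Φ z a = fderiv ℝ Φ z (0, a.2 - a.1 • (spaceTimeField v z).2) := by
      conv_lhs => rw [h1, map_add, map_smul, htransport, smul_zero, zero_add]
    rw [h2, hlin]
    rfl
  · have hIG : ∀ m q, ∑ l, I m l * G l q = if m = q then 1 else 0 := by
      intro m q
      ext t x
      have h1 : HasFDerivAt (fun y => X (t, Φ (t, y)))
          ((fderiv ℝ X (t, Φ (t, x))).comp ((ContinuousLinearMap.inr ℝ ℝ E3).comp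
            ((fderiv ℝ Φ (t, x)).comp (ContinuousLinearMap.inr ℝ ℝ E3)))) x := by
        have ha : HasFDerivAt (fun y : E3 => Φ (t, y))
            ((fderiv ℝ Φ (t, x)).comp (ContinuousLinearMap.inr ℝ ℝ E3)) x :=
          (hΦd (t, x)).hasFDerivAt.comp x (hasFDerivAt_prodMk_right t x)
        have hb : HasFDerivAt (fun y : E3 => (t, Φ (t, y))) ((ContinuousLinearMap.inr ℝ ℝ E3).comp
            ((fderiv ℝ Φ (t, x)).comp (ContinuousLinearMap.inr ℝ ℝ E3))) x :=
          (hasFDerivAt_prodMk_right t (Φ (t, x))).comp x ha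
        exact HasFDerivAt.comp (g := X) (f := fun y => (t, Φ (t, y))) x
          (hXd (t, Φ (t, x))).hasFDerivAt hb
      rw [show (fun y => X (t, Φ (t, y))) = id from funext fun y => hXΦ t y] at h1
      have h2 := congrArg (fun L : E3 →L[ℝ] E3 => L (stdVec q) m) (h1.unique (hasFDerivAt_id x))
      simp only [ContinuousLinearMap.comp_apply, ContinuousLinearMap.inr_apply,
        ContinuousLinearMap.id_apply] at h2
      rw [hlin] at h2
      simp only [Sm.sum_apply, Sm.mul_apply, hI, hG, compTorusMap_apply, torusMapDeriv_apply,
        Nat.cast_one, one_smul]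
      rw [show (if m = q then (1 : Sm) else 0) t x = stdVec q m by
        by_cases h : m = q <;> simp [h, stdVec]]
      rw [← h2]
      exact Finset.sum_congr rfl fun l _ => mul_comm _ _
    -- The chain rule gives a left inverse; over the commutative ring `Sm` it is also a right
    -- inverse.
    have hm : (Matrix.of I) * (Matrix.of G) = 1 := by
      ext m q : 1
      rw [Matrix.mul_apply, Matrix.one_apply]
      exact hIG m q
    have hm' := mul_eq_one_comm.1 hm
    intro l q
    have := congrFun (congrFun hm' l) q
    rw [Matrix.mul_apply, Matrix.one_apply] at this
    exact this

/-! ### Smooth functions with a prescribed jet in time -/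

theorem iteratedFDeriv_succ_apply_eq_fderiv {E F : Type*} [NormedAddCommGroup E] [NormedSpace ℝ E]
    [NormedAddCommGroup F] [NormedSpace ℝ F] {f : E → F} (hf : ContDiff ℝ ∞ f) (n : ℕ) (x : E)
    (m : Fin (n + 1) → E) : iteratedFDeriv ℝ (n + 1) f x m
      = fderiv ℝ (fun y => iteratedFDeriv ℝ n f y (Fin.tail m)) x (m 0) := by
  rw [iteratedFDeriv_succ_apply_left]
  have hd : DifferentiableAt ℝ (iteratedFDeriv ℝ n f) x :=
    (hf.differentiable_iteratedFDeriv (m := n) (by exact_mod_cast ENat.natCast_lt_top n)) x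
  have h := (ContinuousMultilinearMap.apply ℝ (fun _ : Fin n => E) F
    (Fin.tail m)).hasFDerivAt.comp x hd.hasFDerivAt
  exact (congrArg (fun L : E →L[ℝ] F => L (m 0)) h.fderiv).symm

namespace Sm

theorem dt_iterate_eq_iteratedFDeriv (f : Sm) (n : ℕ) (t : ℝ) (x : E3) :
    (dt^[n] f) t x = iteratedFDeriv ℝ n f.unc (t, x) (fun _ => (1, 0)) := by
  induction n generalizing t x with
  | zero => simp [unc]
  | succ n ih =>
    rw [iteratedFDeriv_succ_apply_eq_fderiv f.smooth, Function.iterate_succ_apply', dt, D_apply]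
    congr 2
    funext z
    exact ih z.1 z.2

theorem dt_iterate_eq_iteratedDeriv (f : Sm) (n : ℕ) (t : ℝ) (x : E3) :
    (dt^[n] f) t x = iteratedDeriv n (fun s => f s x) t := by
  induction n generalizing t with
  | zero => simp
  | succ n ih =>
    rw [Function.iterate_succ_apply', iteratedDeriv_succ,
      ← funext (fun s => ih s), ((dt^[n] f).hasDerivAt_time t x).deriv]

end Sm

theorem exists_bound_iteratedFDeriv {U : ℝ × E3 → ℝ} (hU : ContDiff ℝ ∞ U)
    (hp : ∀ i z, U (z + (0, (2 * Real.pi) • stdVec i)) = U z) {B : ℝ}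
    (h0 : ∀ z, B < |z.1| → U z = 0) (k : ℕ) :
    ∃ C, 0 < C ∧ ∀ z, ‖iteratedFDeriv ℝ k U z‖ ≤ C := by
  obtain ⟨C, hC0, hC⟩ := exists_bound_of_periodic (g := iteratedFDeriv ℝ k U)
    (hU.continuous_iteratedFDeriv (by exact_mod_cast le_top))
    (fun t i x => by
      have h := iteratedFDeriv_comp_add_right (𝕜 := ℝ) (f := U) k
        ((0, (2 * Real.pi) • stdVec i) : ℝ × E3) (t, x)
      rw [funext (hp i)] at h
      beta_reduce
      rw [h]
      simp) (isCompact_Icc (a := -B) (b := B))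
  refine ⟨C, hC0, fun z => ?_⟩
  by_cases h : B < |z.1|
  · have ho : ∀ᶠ w : ℝ × E3 in 𝓝 z, B < |w.1| :=
      ((continuous_abs.comp continuous_fst).tendsto z).eventually_const_lt h
    have : U =ᶠ[𝓝 z] fun _ => 0 := by
      filter_upwards [ho] with w hw
      exact h0 w hw
    rw [(this.iteratedFDeriv ℝ k).eq_of_nhds]
    simp [hC0.le]
  · exact hC z.1 (abs_le.1 (not_lt.1 h)) z.2

/-- The dilation of time by the factor `ε⁻¹`. -/
def timeDilation (ε : ℝ) : (ℝ × E3) →L[ℝ] (ℝ × E3) :=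
  (ε⁻¹ • ContinuousLinearMap.fst ℝ ℝ E3).prod (ContinuousLinearMap.snd ℝ ℝ E3)

theorem timeDilation_apply (ε : ℝ) (z : ℝ × E3) : timeDilation ε z = (ε⁻¹ * z.1, z.2) := rfl

theorem norm_timeDilation_le {ε : ℝ} (h0 : 0 < ε) (h1 : ε ≤ 1) : ‖timeDilation ε‖ ≤ ε⁻¹ := by
  have h1 : 1 ≤ ε⁻¹ := (one_le_inv₀ h0).2 h1
  refine ContinuousLinearMap.opNorm_le_bound _ (by linarith) fun z => ?_
  rw [timeDilation_apply, Prod.norm_mk, norm_mul, Real.norm_of_nonneg (by linarith : 0 ≤ ε⁻¹)]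
  exact max_le (mul_le_mul_of_nonneg_left (norm_fst_le z) (by linarith))
    ((norm_snd_le z).trans (le_mul_of_one_le_left (norm_nonneg _) h1))

theorem norm_iteratedFDeriv_timeDilation_le {U : ℝ × E3 → ℝ} (hU : ContDiff ℝ ∞ U) {ε : ℝ}
    (h0 : 0 < ε) (h1 : ε ≤ 1) (k m : ℕ) {C : ℝ} (hC : ∀ z, ‖iteratedFDeriv ℝ k U z‖ ≤ C)
    (z : ℝ × E3) : ‖iteratedFDeriv ℝ k (ε ^ m • (U ∘ timeDilation ε)) z‖
      ≤ ε ^ m * (C * ε⁻¹ ^ k) := by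
  have h3 : ContDiff ℝ ∞ (U ∘ timeDilation ε) := hU.comp (timeDilation ε).contDiff
  rw [iteratedFDeriv_const_smul_apply (h3.contDiffAt.of_le (by exact_mod_cast le_top)), norm_smul,
    Real.norm_of_nonneg (by positivity),
    (timeDilation ε).iteratedFDeriv_comp_right hU z (by exact_mod_cast le_top)]
  refine mul_le_mul_of_nonneg_left ?_ (by positivity)
  refine (ContinuousMultilinearMap.norm_compContinuousLinearMap_le _ _).trans ?_
  refine mul_le_mul (hC _) ?_ (by positivity) ((norm_nonneg _).trans (hC z))
  simp only [Finset.prod_const, Finset.card_univ, Fintype.card_fin]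
  exact pow_le_pow_left₀ (norm_nonneg _) (norm_timeDilation_le h0 h1) k

theorem exists_sm_unc_eq {F : ℝ × E3 → ℝ} (hF : ContDiff ℝ ∞ F)
    (hp : ∀ i z, F (z + (0, (2 * Real.pi) • stdVec i)) = F z) : ∃ u : Sm, u.unc = F :=
  ⟨⟨fun t x => F (t, x), hF, fun t i x => by simpa using hp i (t, x)⟩, rfl⟩

/-- The building block of Borel's lemma is `s^m/m! χ(s/ε) f(x)`. Its derivatives of order `k < m`
carry the factor `ε^{m-k}`, so a small `ε` makes them geometrically small without changing the jet
at zero. -/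
theorem exists_sm_of_monomial_jet {f : E3 → ℝ} (hf : ContDiff ℝ ∞ f) (hp : Periodic3 f) (m : ℕ) :
    ∃ u : Sm, (∀ k < m, ∀ z, ‖iteratedFDeriv ℝ k u.unc z‖ ≤ (1 / 2) ^ m) ∧
      (∀ k, ∃ B, ∀ z, ‖iteratedFDeriv ℝ k u.unc z‖ ≤ B) ∧
      ∀ n x, (Sm.dt^[n] u) 0 x = if n = m then f x else 0 := by
  let χ : ContDiffBump (0 : ℝ) := ⟨1, 2, one_pos, one_lt_two⟩
  obtain ⟨U, hU⟩ : ∃ U : ℝ × E3 → ℝ, ∀ z, U z = ((m.factorial : ℝ)⁻¹ * z.1 ^ m * χ z.1) * f z.2 :=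
    ⟨_, fun _ => rfl⟩
  have hUs : ContDiff ℝ ∞ U := by
    rw [funext hU]
    exact ((contDiff_const.mul (contDiff_fst.pow m)).mul (χ.contDiff.comp contDiff_fst)).mul
      (hf.comp contDiff_snd)
  have hUp : ∀ i z, U (z + (0, (2 * Real.pi) • stdVec i)) = U z := by
    intro i z
    simp [hU, hp i z.2]
  have hU0 : ∀ z, 2 < |z.1| → U z = 0 := fun z hz => by
    rw [hU, χ.zero_of_le_dist (by simpa [Real.dist_eq] using hz.le)]; simp
  choose C hC0 hC using exists_bound_iteratedFDeriv hUs hUp hU0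
  have hS : 0 ≤ ∑ k ∈ Finset.range m, C k := Finset.sum_nonneg fun k _ => (hC0 k).le
  -- Only the finitely many orders below `m` have to be controlled, so the sum of their bounds
  -- determines `ε`.
  obtain ⟨ε, hε0, hε1, hεC⟩ : ∃ ε : ℝ, 0 < ε ∧ ε ≤ 1 ∧ ∀ k < m, ε * C k ≤ (1 / 2) ^ m := by
    refine ⟨(2 ^ m * (1 + ∑ k ∈ Finset.range m, C k))⁻¹, by positivity, ?_, fun k hk => ?_⟩
    · refine inv_le_one_of_one_le₀ ?_
      exact one_le_mul_of_one_le_of_one_le (one_le_pow₀ one_le_two) (by linarith)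
    · have h1 : C k ≤ 1 + ∑ k ∈ Finset.range m, C k := by
        have := Finset.single_le_sum (f := C) (fun k _ => (hC0 k).le) (Finset.mem_range.2 hk)
        linarith
      have h2 : 0 < 1 + ∑ k ∈ Finset.range m, C k := by linarith
      rw [mul_inv, mul_assoc, one_div, inv_pow]
      refine mul_le_of_le_one_right (by positivity) ?_
      rw [inv_mul_le_iff₀ h2]; linarith
  have hb := fun k z => norm_iteratedFDeriv_timeDilation_le hUs hε0 hε1 k m (hC k) z
  have hus : ContDiff ℝ ∞ (ε ^ m • (U ∘ timeDilation ε)) :=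
    (hUs.comp (timeDilation ε).contDiff).const_smul (ε ^ m)
  obtain ⟨u, hu⟩ := exists_sm_unc_eq hus (fun i z => by
    simp [timeDilation_apply, hU, hp i z.2])
  refine ⟨u, fun k hk z => ?_, fun k => ⟨_, by rw [hu]; exact hb k⟩, fun n x => ?_⟩
  · rw [hu]
    refine (hb k z).trans (le_trans ?_ (hεC k hk))
    have h3 : ε ^ m * (C k * ε⁻¹ ^ k) = ε ^ (m - k) * C k := by
      have : ε ^ m = ε ^ (m - k) * ε ^ k := by rw [← pow_add]; congr 1; omega
      rw [this, inv_pow, mul_comm (C k), mul_assoc, ← mul_assoc (ε ^ k),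
        mul_inv_cancel₀ (pow_ne_zero k hε0.ne'), one_mul]
    rw [h3]
    exact mul_le_mul_of_nonneg_right (pow_le_of_le_one hε0.le hε1 (by omega)) (hC0 k).le
  · rw [Sm.dt_iterate_eq_iteratedDeriv]
    have hu' : ∀ s, u s x = (ε ^ m • (U ∘ timeDilation ε)) (s, x) := fun s => by rw [← hu]; rfl
    have h4 : (fun s => u s x)
        =ᶠ[𝓝 0] fun s => ((m.factorial : ℝ)⁻¹ * f x) * s ^ m := by
      have ho : ∀ᶠ s : ℝ in 𝓝 0, |s| < ε :=
        (continuous_abs.tendsto 0).eventually_lt_const (by simpa using hε0)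
      filter_upwards [ho] with s hs
      have : χ (ε⁻¹ * s) = 1 := χ.one_of_mem_closedBall (by
        change _ ∈ Metric.closedBall (0 : ℝ) 1
        rw [mem_closedBall_zero_iff, Real.norm_eq_abs, abs_mul, abs_inv, abs_of_pos hε0,
          inv_mul_le_iff₀ hε0]
        linarith)
      simp only [hu', Pi.smul_apply, Function.comp_apply, timeDilation_apply, hU, this, smul_eq_mul]
      rw [mul_pow, inv_pow]
      field_simp
    refine (h4.iteratedDeriv_eq n).trans ?_
    rw [iteratedDeriv_const_mul_field, iteratedDeriv_fun_pow_zero]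
    split_ifs with h
    · subst h
      have := Nat.factorial_ne_zero n
      field_simp
    · simp

/-- Borel's lemma with parameters: the building blocks are summed, and all termwise derivatives
converge. -/
theorem exists_sm_of_jet (f : ℕ → E3 → ℝ) (hf : ∀ n, ContDiff ℝ ∞ (f n))
    (hp : ∀ n, Periodic3 (f n)) : ∃ g : Sm, ∀ n x, (Sm.dt^[n] g) 0 x = f n x := by
  choose u hu1 hu2 hu3 using fun m => exists_sm_of_monomial_jet (hf m) (hp m) m
  choose B hB using hu2
  -- For fixed order `k` the terms with `m > k` are geometrically small; the finitely many others
  -- are bounded by constants.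
  obtain ⟨w, hw⟩ : ∃ w : ℕ → ℕ → ℝ, ∀ k m, w k m = (1 / 2) ^ m +
      if m ∈ Finset.range (k + 1) then |B m k| else 0 := ⟨_, fun _ _ => rfl⟩
  have hws : ∀ k, Summable (w k) := fun k => by
    rw [funext (hw k)]
    exact summable_geometric_two.add (summable_of_ne_finset_zero (s := Finset.range (k + 1))
      fun m hm => if_neg hm)
  have huw : ∀ k m z, ‖iteratedFDeriv ℝ k (u m).unc z‖ ≤ w k m := by
    intro k m z
    rw [hw]
    split_ifs with h
    · exact ((hB m k z).trans (le_abs_self _)).trans (le_add_of_nonneg_left (by positivity))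
    · rw [add_zero]
      exact hu1 m k (by simpa using h) z
  obtain ⟨g, hg⟩ : ∃ g : Sm, g.unc = fun z => ∑' m, (u m).unc z :=
    exists_sm_unc_eq
      (contDiff_tsum (N := ⊤) (fun m => (u m).smooth) (fun k _ => hws k) (fun k m z _ => huw k m z))
      (fun i z => tsum_congr fun m => congrFun ((u m).unc_translate i) z)
  refine ⟨g, fun n x => ?_⟩
  have h1 : iteratedFDeriv ℝ n (fun z => ∑' m, (u m).unc z) (0, x)
      = ∑' m, iteratedFDeriv ℝ n (u m).unc (0, x) :=
    iteratedFDeriv_tsum_apply (N := ⊤) (fun m => (u m).smooth) (fun k _ => hws k)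
      (fun k m z _ => huw k m z) le_top (0, x)
  have h2 : Summable fun m => iteratedFDeriv ℝ n (u m).unc (0, x) :=
    Summable.of_norm_bounded (hws n) fun m => huw n m (0, x)
  have h3 : ∀ m, iteratedFDeriv ℝ n (u m).unc (0, x) (fun _ => (1, 0)) = if n = m then f m x else 0 :=
    fun m => ((u m).dt_iterate_eq_iteratedFDeriv n 0 x).symm.trans (hu3 m n x)
  rw [g.dt_iterate_eq_iteratedFDeriv, hg, h1, ContinuousMultilinearMap.tsum_eval h2,
    tsum_congr h3, tsum_eq_single n (fun m hm => if_neg (Ne.symm hm)), if_pos rfl]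

/-! ### Extension of smooth functions beyond the time interval -/

/-- The half space of nonnegative times. -/
def futureSet : Set (ℝ × E3) := Ici 0 ×ˢ univ

theorem uniqueDiffOn_futureSet : UniqueDiffOn ℝ futureSet :=
  (uniqueDiffOn_Ici 0).prod uniqueDiffOn_univ

theorem mem_futureSet {z : ℝ × E3} : z ∈ futureSet ↔ 0 ≤ z.1 := by simp [futureSet]

theorem futureSet_subset_closure_interior : futureSet ⊆ closure (interior futureSet) := by
  rw [futureSet, interior_prod_eq, closure_prod_eq, interior_Ici, closure_Ioi]
  simp

/-- Directional derivatives on the half space of nonnegative times. -/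
def futureDeriv (a : ℝ × E3) (k : ℝ × E3 → ℝ) (z : ℝ × E3) : ℝ := fderivWithin ℝ k futureSet z a

theorem contDiffOn_futureDeriv {k : ℝ × E3 → ℝ} (hk : ContDiffOn ℝ ∞ k futureSet) (a : ℝ × E3) :
    ContDiffOn ℝ ∞ (futureDeriv a k) futureSet :=
  (hk.fderivWithin uniqueDiffOn_futureSet (m := ∞) (by simp)).clm_apply contDiffOn_const

theorem contDiffOn_futureDeriv_iterate {k : ℝ × E3 → ℝ} (hk : ContDiffOn ℝ ∞ k futureSet)
    (a : ℝ × E3) (n : ℕ) : ContDiffOn ℝ ∞ ((futureDeriv a)^[n] k) futureSet := by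
  induction n with
  | zero => exact hk
  | succ n ih => rw [Function.iterate_succ_apply']; exact contDiffOn_futureDeriv ih a

theorem futureDeriv_congr {k k' : ℝ × E3 → ℝ} (h : EqOn k k' futureSet) (a : ℝ × E3) :
    EqOn (futureDeriv a k) (futureDeriv a k') futureSet := fun z hz => by
  rw [futureDeriv, futureDeriv, fderivWithin_congr h (h hz)]

theorem futureDeriv_comm {k : ℝ × E3 → ℝ} (hk : ContDiffOn ℝ ∞ k futureSet) (a b : ℝ × E3) :
    EqOn (futureDeriv a (futureDeriv b k)) (futureDeriv b (futureDeriv a k)) futureSet := by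
  intro z hz
  have hd : DifferentiableWithinAt ℝ (fderivWithin ℝ k futureSet) futureSet z :=
    ((hk.fderivWithin uniqueDiffOn_futureSet (m := ∞) (by simp)).differentiableOn (by simp)) z hz
  have key : ∀ a b : ℝ × E3, futureDeriv a (futureDeriv b k) z
      = fderivWithin ℝ (fderivWithin ℝ k futureSet) futureSet z a b := by
    intro a b
    have h1 : HasFDerivWithinAt (futureDeriv b k)
        ((ContinuousLinearMap.apply ℝ ℝ b).comp
          (fderivWithin ℝ (fderivWithin ℝ k futureSet) futureSet z)) futureSet z :=
      (ContinuousLinearMap.apply ℝ ℝ b).hasFDerivAt.comp_hasFDerivWithinAt z hd.hasFDerivWithinAt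
    rw [futureDeriv, h1.fderivWithin (uniqueDiffOn_futureSet z hz)]
    rfl
  rw [key, key]
  exact ((hk z hz).isSymmSndFDerivWithinAt
    (by rw [minSmoothness_of_isRCLikeNormedField]
        exact WithTop.coe_le_coe.2 (le_top (a := (2 : ℕ∞))))
    uniqueDiffOn_futureSet (futureSet_subset_closure_interior hz) hz) a b

theorem futureDeriv_iterate_comm {k : ℝ × E3 → ℝ} (hk : ContDiffOn ℝ ∞ k futureSet)
    (a b : ℝ × E3) (n : ℕ) :
    EqOn ((futureDeriv a)^[n] (futureDeriv b k)) (futureDeriv b ((futureDeriv a)^[n] k))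
      futureSet := by
  induction n with
  | zero => exact fun _ _ => rfl
  | succ n ih =>
    rw [Function.iterate_succ_apply', Function.iterate_succ_apply']
    exact (futureDeriv_congr ih a).trans
      (futureDeriv_comm (contDiffOn_futureDeriv_iterate hk a n) a b)

/-- Tangential derivatives vanish because `q` vanishes on the boundary, the normal one by
assumption. -/
theorem fderivWithin_eq_zero_of_flat {q : ℝ × E3 → ℝ} (hq : ContDiffOn ℝ ∞ q futureSet)
    (h0 : ∀ x, q (0, x) = 0) (h1 : ∀ x, futureDeriv (1, 0) q (0, x) = 0) (x : E3) :
    fderivWithin ℝ q futureSet (0, x) = 0 := by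
  have hz : ((0 : ℝ), x) ∈ futureSet := mem_futureSet.2 le_rfl
  have hd : HasFDerivWithinAt q (fderivWithin ℝ q futureSet (0, x)) futureSet (0, x) :=
    ((hq.differentiableOn (by simp)) _ hz).hasFDerivWithinAt
  have h2 : HasFDerivWithinAt (fun y : E3 => q (0, y))
      ((fderivWithin ℝ q futureSet (0, x)).comp (ContinuousLinearMap.inr ℝ ℝ E3)) univ x :=
    HasFDerivWithinAt.comp (g := q) (t := futureSet) x hd
      (hasFDerivAt_prodMk_right (0 : ℝ) x).hasFDerivWithinAt (fun y _ => mem_futureSet.2 le_rfl)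
  rw [show (fun y : E3 => q (0, y)) = fun _ => 0 from funext h0, hasFDerivWithinAt_univ] at h2
  have h3 := h2.unique (hasFDerivAt_const (0 : ℝ) x)
  refine ContinuousLinearMap.ext fun a => ?_
  have h4 : a = a.1 • ((1, 0) : ℝ × E3) + ContinuousLinearMap.inr ℝ ℝ E3 a.2 := by
    ext1 <;> simp
  have h5 := congrArg (fun L : E3 →L[ℝ] ℝ => L a.2) h3
  have h6 := h1 x
  simp only [ContinuousLinearMap.comp_apply] at h5
  rw [futureDeriv] at h6
  rw [h4, map_add, map_smul, h6, h5]
  simp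

/-- Extension by zero across a boundary on which all normal derivatives vanish is differentiable,
and its directional derivatives are extensions by zero of functions that are again flat. -/
theorem contDiff_indicator_of_flat {k : ℝ × E3 → ℝ} (hk : ContDiffOn ℝ ∞ k futureSet)
    (h0 : ∀ n x, ((futureDeriv (1, 0))^[n] k) (0, x) = 0) :
    ContDiff ℝ ∞ (futureSet.indicator k) := by
  rw [contDiff_infty]
  intro m
  have hderiv : ∀ (k : ℝ × E3 → ℝ), ContDiffOn ℝ ∞ k futureSet →
      (∀ n x, ((futureDeriv (1, 0))^[n] k) (0, x) = 0) → ∀ z,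
      HasFDerivAt (futureSet.indicator k) (futureSet.indicator (fderivWithin ℝ k futureSet) z) z := by
    intro k hk h0 z
    rcases lt_trichotomy z.1 0 with h | h | h
    · have hz : z ∉ futureSet := fun h' => absurd (mem_futureSet.1 h') (not_le.2 h)
      rw [indicator_of_notMem hz]
      have ho : ∀ᶠ w : ℝ × E3 in 𝓝 z, w.1 < 0 := (continuous_fst.tendsto z).eventually_lt_const h
      refine (hasFDerivAt_const (0 : ℝ) z).congr_of_eventuallyEq ?_
      filter_upwards [ho] with w hw
      exact indicator_of_notMem (fun h' => absurd (mem_futureSet.1 h') (not_le.2 hw)) _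
    · obtain ⟨t, x⟩ := z
      obtain rfl : t = 0 := h
      have hz : ((0 : ℝ), x) ∈ futureSet := mem_futureSet.2 le_rfl
      have hL := fderivWithin_eq_zero_of_flat hk (h0 0) (h0 1) x
      rw [indicator_of_mem hz, hL]
      have h1 : HasFDerivWithinAt (futureSet.indicator k) (0 : (ℝ × E3) →L[ℝ] ℝ) futureSet (0, x) := by
        have := ((hk.differentiableOn (by simp)) _ hz).hasFDerivWithinAt
        rw [hL] at this
        exact this.congr (fun w hw => indicator_of_mem hw _) (indicator_of_mem hz _)
      have h2 : HasFDerivWithinAt (futureSet.indicator k) (0 : (ℝ × E3) →L[ℝ] ℝ)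
          (Iic 0 ×ˢ univ) (0, x) := by
        have h3 : ∀ w ∈ (Iic 0 ×ˢ univ : Set (ℝ × E3)), futureSet.indicator k w = 0 := by
          rintro ⟨s, y⟩ hw
          by_cases hs : (s, y) ∈ futureSet
          · obtain rfl : s = 0 := le_antisymm hw.1 (mem_futureSet.1 hs)
            rw [indicator_of_mem hs]; exact h0 0 y
          · exact indicator_of_notMem hs _
        exact (hasFDerivWithinAt_const (0 : ℝ) (0, x) _).congr h3 (h3 _ ⟨mem_Iic.2 le_rfl, mem_univ _⟩)
      have h4 := h1.union h2
      rw [futureSet, ← union_prod, union_comm, Iic_union_Ici, univ_prod_univ,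
        hasFDerivWithinAt_univ] at h4
      exact h4
    · have hz : futureSet ∈ 𝓝 z := by
        filter_upwards [(continuous_fst.tendsto z).eventually_const_lt h] with w hw
        exact mem_futureSet.2 (le_of_lt hw)
      rw [indicator_of_mem (mem_of_mem_nhds hz)]
      have := (((hk.differentiableOn (by simp)) _ (mem_of_mem_nhds hz)).hasFDerivWithinAt).hasFDerivAt hz
      refine this.congr_of_eventuallyEq ?_
      filter_upwards [hz] with w hw
      exact indicator_of_mem hw _
  induction m generalizing k with
  | zero =>
    exact contDiff_zero.2 (continuous_iff_continuousAt.2 fun z => (hderiv k hk h0 z).continuousAt)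
  | succ m ih =>
    push_cast
    rw [contDiff_succ_iff_fderiv_apply]
    refine ⟨fun z => (hderiv k hk h0 z).differentiableAt, by simp, fun a => ?_⟩
    have : (fun z => fderiv ℝ (futureSet.indicator k) z a)
        = futureSet.indicator (futureDeriv a k) := by
      funext z
      rw [(hderiv k hk h0 z).fderiv]
      by_cases hz : z ∈ futureSet
      · rw [indicator_of_mem hz, indicator_of_mem hz]; rfl
      · rw [indicator_of_notMem hz, indicator_of_notMem hz]; rfl
    rw [this]
    refine ih (contDiffOn_futureDeriv hk a) fun n x => ?_
    rw [futureDeriv_iterate_comm hk _ _ n (mem_futureSet.2 le_rfl), futureDeriv,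
      fderivWithin_eq_zero_of_flat (contDiffOn_futureDeriv_iterate hk _ n) (h0 n) (fun x => ?_)]
    · rfl
    · rw [← Function.iterate_succ_apply' (futureDeriv (1, 0))]; exact h0 (n + 1) x

theorem futureDeriv_translate {q : ℝ × E3 → ℝ} (hq : ContDiffOn ℝ ∞ q futureSet) {c : E3}
    (hc : ∀ z ∈ futureSet, q (z + (0, c)) = q z) (a : ℝ × E3) :
    ∀ z ∈ futureSet, futureDeriv a q (z + (0, c)) = futureDeriv a q z := by
  intro z hz
  have hz' : z + (0, c) ∈ futureSet := by simpa [mem_futureSet] using hz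
  have h1 := ((hq.differentiableOn (by simp)) _ hz').hasFDerivWithinAt
  have h2 : HasFDerivWithinAt (fun w => q (w + (0, c)))
      ((fderivWithin ℝ q futureSet (z + (0, c))).comp (ContinuousLinearMap.id ℝ (ℝ × E3)))
      futureSet z :=
    HasFDerivWithinAt.comp (g := q) (t := futureSet) z h1
      ((hasFDerivAt_id z).add_const _).hasFDerivWithinAt
      (fun w hw => by simpa [mem_futureSet] using hw)
  have h3 := (h2.congr (f₁ := q) (fun w hw => (hc w hw).symm) (hc z hz).symm).fderivWithin
    (uniqueDiffOn_futureSet z hz)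
  rw [futureDeriv, futureDeriv, h3]
  rfl

/-- Borel's lemma provides a smooth function with the same time jet at zero; the difference is flat
there and is extended by zero. -/
theorem exists_sm_eq_on_future {f : ℝ × E3 → ℝ} (hf : ContDiffOn ℝ ∞ f futureSet)
    (hp : ∀ i, ∀ z ∈ futureSet, f (z + (0, (2 * Real.pi) • stdVec i)) = f z) :
    ∃ G : Sm, ∀ t x, 0 ≤ t → G t x = f (t, x) := by
  have hF := contDiffOn_futureDeriv_iterate hf (1, 0)
  have hFp : ∀ n i, ∀ z ∈ futureSet, ((futureDeriv (1, 0))^[n] f) (z + (0, (2 * Real.pi) • stdVec i))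
      = ((futureDeriv (1, 0))^[n] f) z := by
    intro n i
    induction n with
    | zero => exact hp i
    | succ n ih =>
      rw [Function.iterate_succ_apply']
      exact futureDeriv_translate (hF n) ih _
  obtain ⟨g, hg⟩ := exists_sm_of_jet (fun n x => ((futureDeriv (1, 0))^[n] f) (0, x))
    (fun n => by
      rw [← contDiffOn_univ]
      exact ContDiffOn.comp (g := (futureDeriv (1, 0))^[n] f) (hF n)
        (contDiff_prodMk_right (0 : ℝ)).contDiffOn (fun y _ => mem_futureSet.2 le_rfl))
    (fun n i x => by simpa using hFp n i (0, x) (mem_futureSet.2 le_rfl))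
  have hk : ContDiffOn ℝ ∞ (f - g.unc) futureSet := hf.sub g.smooth.contDiffOn
  have hjet : ∀ n, EqOn ((futureDeriv (1, 0))^[n] (f - g.unc))
      ((futureDeriv (1, 0))^[n] f - (Sm.dt^[n] g).unc) futureSet := by
    intro n
    induction n with
    | zero => exact fun _ _ => rfl
    | succ n ih =>
      intro z hz
      rw [Function.iterate_succ_apply', futureDeriv_congr ih _ hz, futureDeriv,
        fderivWithin_sub (uniqueDiffOn_futureSet z hz) (((hF n).differentiableOn (by simp)) z hz)
          ((Sm.dt^[n] g).differentiable z).differentiableWithinAt,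
        fderivWithin_eq_fderiv (uniqueDiffOn_futureSet z hz) ((Sm.dt^[n] g).differentiable z),
        Pi.sub_apply, Function.iterate_succ_apply', Function.iterate_succ_apply']
      rfl
  have hflat := contDiff_indicator_of_flat hk (fun n x => by
    rw [hjet n (mem_futureSet.2 le_rfl)]
    have := hg n x
    simp only [Pi.sub_apply, Sm.unc, this, sub_self])
  obtain ⟨h, hh⟩ := exists_sm_unc_eq hflat (fun i z => by
    by_cases hz : z ∈ futureSet
    · have h2 : z + (0, (2 * Real.pi) • stdVec i) ∈ futureSet := by simpa [mem_futureSet] using hz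
      rw [indicator_of_mem hz, indicator_of_mem h2, Pi.sub_apply, Pi.sub_apply, hp i z hz]
      exact congrArg _ (congrFun (g.unc_translate i) z)
    · have h2 : z + (0, (2 * Real.pi) • stdVec i) ∉ futureSet := by simpa [mem_futureSet] using hz
      rw [indicator_of_notMem hz, indicator_of_notMem h2])
  refine ⟨g + h, fun t x ht => ?_⟩
  have h1 : ((t, x) : ℝ × E3) ∈ futureSet := mem_futureSet.2 ht
  have h2 : h t x = futureSet.indicator (f - g.unc) (t, x) := by rw [← hh]; rfl
  rw [Sm.add_apply, h2, indicator_of_mem h1]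
  simp [Sm.unc]

/-- The cutoff vanishes before `T`, so only the end point `0` needs an extension across the
boundary. -/
theorem exists_sm_eq_mul_cutoff {T : ℝ} (hT : 0 < T) {f : ℝ → E3 → ℝ} (hf : SmoothField T f)
    {ψ : ℝ → ℝ} (hψ : ContDiff ℝ ∞ ψ) (hψ0 : ∀ t, 2 * T / 3 ≤ t → ψ t = 0) :
    ∃ G : Sm, ∀ t ∈ Icc 0 T, ∀ x, G t x = ψ t * f t x := by
  suffices h : ContDiffOn ℝ ∞ (fun z : ℝ × E3 => if z.1 ≤ T then ψ z.1 * f z.1 z.2 else 0)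
      futureSet by
    obtain ⟨G, hG⟩ := exists_sm_eq_on_future h (fun i z hz => by
      simp only [Prod.fst_add, add_zero, Prod.snd_add]
      split_ifs with h
      · rw [hf.2 z.1 ⟨mem_futureSet.1 hz, h⟩ i z.2]
      · rfl)
    refine ⟨G, fun t ht x => ?_⟩
    rw [hG t x ht.1, if_pos ht.2]
  · intro z hz
    by_cases h : z.1 < T
    · have h1 : ContDiffWithinAt ℝ ∞ (fun z : ℝ × E3 => ψ z.1 * f z.1 z.2) (Icc 0 T ×ˢ univ) z :=
        ((hψ.comp contDiff_fst).contDiffAt.contDiffWithinAt).mul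
          (hf.1 z ⟨⟨mem_futureSet.1 hz, h.le⟩, mem_univ _⟩)
      have ho : ∀ᶠ w : ℝ × E3 in 𝓝 z, w.1 < T := (continuous_fst.tendsto z).eventually_lt_const h
      have h2 : Icc 0 T ×ˢ univ ∈ 𝓝[futureSet] z := by
        filter_upwards [mem_nhdsWithin_of_mem_nhds ho, self_mem_nhdsWithin] with w hw hw'
        exact ⟨⟨mem_futureSet.1 hw', le_of_lt hw⟩, mem_univ _⟩
      refine (h1.mono_of_mem_nhdsWithin h2).congr_of_eventuallyEq ?_ (if_pos h.le)
      filter_upwards [mem_nhdsWithin_of_mem_nhds ho] with w hw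
      exact if_pos (le_of_lt hw)
    · have h1 : 2 * T / 3 < z.1 := by linarith [not_lt.1 h]
      have hzero : ∀ w : ℝ × E3, 2 * T / 3 < w.1 →
          (if w.1 ≤ T then ψ w.1 * f w.1 w.2 else 0) = 0 := by
        intro w hw
        rw [hψ0 w.1 hw.le]; simp
      refine (contDiffWithinAt_const (c := (0 : ℝ))).congr_of_eventuallyEq ?_ (hzero z h1)
      filter_upwards [mem_nhdsWithin_of_mem_nhds
        ((continuous_fst.tendsto z).eventually_const_lt h1)] with w hw
      exact hzero w hw

/-- A partition of unity in time separates the two end points, and time reversal carries the end `T`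
to the end `0`. -/
theorem SmoothField.exists_sm {T : ℝ} (hT : 0 < T) {f : ℝ → E3 → ℝ} (hf : SmoothField T f) :
    ∃ G : Sm, ∀ t ∈ Icc 0 T, ∀ x, G t x = f t x := by
  set χ : ℝ → ℝ := fun t => Real.smoothTransition (3 * t / T - 1) with hχ
  have hχs : ContDiff ℝ ∞ χ := Real.smoothTransition.contDiff.comp
    (((contDiff_const.mul contDiff_id).div_const T).sub contDiff_const)
  have hχ1 : ∀ t, 2 * T / 3 ≤ t → χ t = 1 := fun t ht => by
    refine Real.smoothTransition.one_of_one_le ?_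
    rw [le_sub_iff_add_le, le_div_iff₀ hT]; linarith
  have hχ0 : ∀ t, t ≤ T / 3 → χ t = 0 := fun t ht => by
    refine Real.smoothTransition.zero_of_nonpos ?_
    rw [sub_nonpos, div_le_one hT]; linarith
  obtain ⟨G₁, h₁⟩ := exists_sm_eq_mul_cutoff hT hf (ψ := fun t => 1 - χ t) (contDiff_const.sub hχs)
    (fun t ht => by rw [hχ1 t ht, sub_self])
  have hr : SmoothField T fun t => f (T - t) := by
    refine ⟨?_, fun t ht => hf.2 _ ⟨by linarith [ht.2], by linarith [ht.1]⟩⟩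
    exact ContDiffOn.comp (g := fun z : ℝ × E3 => f z.1 z.2)
      (f := fun z : ℝ × E3 => (T - z.1, z.2)) hf.1
      ((contDiff_const.sub contDiff_fst).prodMk contDiff_snd).contDiffOn
      (fun z hz => ⟨⟨by linarith [hz.1.2], by linarith [hz.1.1]⟩, mem_univ _⟩)
  obtain ⟨G₂, h₂⟩ := exists_sm_eq_mul_cutoff hT hr (ψ := fun t => χ (T - t))
    (hχs.comp (contDiff_const.sub contDiff_id)) (fun t ht => hχ0 _ (by linarith))
  let G₃ : Sm := ⟨fun t => G₂ (T - t),
    G₂.smooth.comp ((contDiff_const.sub contDiff_fst).prodMk contDiff_snd :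
      ContDiff ℝ ∞ fun z : ℝ × E3 => (T - z.1, z.2)), fun t => G₂.periodic _⟩
  refine ⟨G₁ + G₃, fun t ht x => ?_⟩
  have h3 : G₃ t x = χ t * f t x := by
    have := h₂ (T - t) ⟨by linarith [ht.2], by linarith [ht.1]⟩ x
    rw [sub_sub_cancel] at this
    exact this
  rw [Sm.add_apply, h₁ t ht x, h3]
  ring

/-- A smooth function on a bounded time interval extends to one that vanishes for large times. -/
theorem SmoothField.exists_sm_compact {T : ℝ} (hT : 0 < T) {f : ℝ → E3 → ℝ}
    (hf : SmoothField T f) :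
    ∃ G : Sm, (∀ t ∈ Icc 0 T, ∀ x, G t x = f t x) ∧ ∀ t x, T + 1 < |t| → G t x = 0 := by
  obtain ⟨G, hG⟩ := hf.exists_sm hT
  let χ : ContDiffBump (0 : ℝ) := ⟨T, T + 1, hT, by linarith⟩
  refine ⟨⟨fun t x => χ t * G t x, (χ.contDiff.comp contDiff_fst).mul G.smooth, fun t i x => by
    beta_reduce; rw [G.periodic t i x]⟩, fun t ht x => ?_, fun t x ht => ?_⟩
  · change χ t * G t x = _
    rw [χ.one_of_mem_closedBall, one_mul, hG t ht x]
    rw [mem_closedBall_zero_iff, Real.norm_eq_abs, abs_of_nonneg ht.1]; exact ht.2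
  · change χ t * G t x = 0
    rw [χ.zero_of_le_dist, zero_mul]
    rw [dist_zero_right, Real.norm_eq_abs]; exact ht.le

/-! ### Decomposition of positive definite matrices into rank one matrices -/

/-- Six integer directions whose rank one matrices span the symmetric matrices. -/
def baseDir : Fin 6 → Fin 3 → ℤ :=
  ![![1, 0, 0], ![1, 1, 0], ![1, -1, 0], ![1, 0, 1], ![1, 0, -1], ![1, 1, 1]]

/-- The coordinates of a symmetric matrix in the basis given by `baseDir`. -/
def baseCoef (g : Fin 6) (A : Fin 3 → Fin 3 → ℝ) : ℝ :=
  ![A 0 0 - A 1 1 - A 2 2 + A 1 2, (A 1 1 + A 0 1) / 2 - A 1 2, (A 1 1 - A 0 1) / 2,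
    (A 2 2 + A 0 2) / 2 - A 1 2, (A 2 2 - A 0 2) / 2, A 1 2] g

theorem sum_baseCoef {A : Fin 3 → Fin 3 → ℝ} (hA : ∀ i j, A i j = A j i) (i j : Fin 3) :
    ∑ g, baseCoef g A * ((baseDir g i : ℝ) * baseDir g j) = A i j := by
  have h1 := hA 1 0
  have h2 := hA 2 0
  have h3 := hA 2 1
  fin_cases i <;> fin_cases j <;>
    simp [Fin.sum_univ_succ, baseCoef, baseDir] <;> linarith

theorem baseCoef_sub_smul_sum (A : Fin 3 → Fin 3 → ℝ) (δ : ℝ) (g : Fin 6) :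
    baseCoef g (fun i j => A i j - (A i j - δ * ∑ g, (baseDir g i : ℝ) * baseDir g j)) = δ := by
  fin_cases g <;> simp [Fin.sum_univ_succ, baseCoef, baseDir] <;> ring

theorem contDiff_baseCoef (g : Fin 6) : ContDiff ℝ ∞ (baseCoef g) := by
  have h : ∀ i j : Fin 3, ContDiff ℝ ∞ fun A : Fin 3 → Fin 3 → ℝ => A i j := fun i j =>
    contDiff_apply_apply ℝ ℝ i j
  change ContDiff ℝ ∞ fun A => baseCoef g A
  fin_cases g <;> simp only [baseCoef, Fin.zero_eta, Fin.mk_one, Fin.reduceFinMk,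
    Matrix.cons_val] <;> fun_prop

theorem exists_coercive {A : Matrix (Fin 3) (Fin 3) ℝ} (hA : A.PosDef) :
    ∃ c, 0 < c ∧ ∀ x : Fin 3 → ℝ, c * ∑ i, x i ^ 2 ≤ ∑ i, ∑ j, x i * A i j * x j := by
  have hcont : Continuous fun x : E3 => ∑ i, ∑ j, x i * A i j * x j := by fun_prop
  obtain ⟨y, hy, hmin⟩ := (isCompact_sphere (0 : E3) 1).exists_isMinOn
    (NormedSpace.sphere_nonempty.2 zero_le_one) hcont.continuousOn
  have hform : ∀ x : Fin 3 → ℝ, star x ⬝ᵥ A.mulVec x = ∑ i, ∑ j, x i * A i j * x j := by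
    intro x
    simp only [dotProduct, Matrix.mulVec, star_trivial, Finset.mul_sum, mul_assoc]
  have hy0 : y ≠ 0 := ne_zero_of_mem_unit_sphere (⟨y, hy⟩ : Metric.sphere (0 : E3) 1)
  refine ⟨∑ i, ∑ j, y i * A i j * y j, ?_, fun x => ?_⟩
  · rw [← hform]
    exact hA.dotProduct_mulVec_pos (fun h => hy0 (by ext i; exact congrFun h i))
  · by_cases hx : x = 0
    · subst hx; simp
    · set z : E3 := WithLp.toLp 2 x
      have hz : z ≠ 0 := fun h => hx (by ext i; exact congrArg (fun w : E3 => w i) h)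
      have hn : 0 < ‖z‖ := norm_pos_iff.2 hz
      have h1 : ‖z‖⁻¹ • z ∈ Metric.sphere (0 : E3) 1 := by
        rw [mem_sphere_zero_iff_norm, norm_smul, norm_inv, norm_norm, inv_mul_cancel₀ hn.ne']
      have h2 : (∑ i, ∑ j, y i * A i j * y j)
          ≤ ∑ i, ∑ j, (‖z‖⁻¹ • z) i * A i j * (‖z‖⁻¹ • z) j := hmin h1
      have h3 : ∑ i, ∑ j, (‖z‖⁻¹ • z) i * A i j * (‖z‖⁻¹ • z) j
          = (‖z‖ ^ 2)⁻¹ * ∑ i, ∑ j, x i * A i j * x j := by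
        simp only [Finset.mul_sum, PiLp.smul_apply, smul_eq_mul]
        refine Finset.sum_congr rfl fun i _ => Finset.sum_congr rfl fun j _ => ?_
        change ‖z‖⁻¹ * x i * A i j * (‖z‖⁻¹ * x j) = _
        ring
      have h4 : ‖z‖ ^ 2 = ∑ i, x i ^ 2 := EuclideanSpace.real_norm_sq_eq z
      rw [h3, h4, le_inv_mul_iff₀ (by rw [← h4]; positivity)] at h2
      linarith

/-- Leaves room `δ` in every base direction, so that the base coefficients stay positive when the
other rank one terms are perturbed. -/
theorem exists_posSemidef_sub {A : Matrix (Fin 3) (Fin 3) ℝ} (hA : A.PosDef) :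
    ∃ δ, 0 < δ ∧ (Matrix.of fun i j => A i j - δ * ∑ g, (baseDir g i : ℝ) * baseDir g j).PosSemidef := by
  obtain ⟨c, hc, h⟩ := exists_coercive hA
  have hs : ∀ i j, A i j = A j i := fun i j => by simpa using (hA.isHermitian.apply i j).symm
  -- There are six base directions with entries of modulus at most one, and each square is at most
  -- `3|x|²`.
  refine ⟨c / 18, by positivity, .of_dotProduct_mulVec_nonneg ?_ fun x => ?_⟩
  · refine Matrix.IsHermitian.ext fun i j => ?_
    simp only [Matrix.of_apply, star_trivial]
    rw [hs j i]
    congr 2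
    exact Finset.sum_congr rfl fun g _ => mul_comm _ _
  · have h1 := h x
    have h2 : star x ⬝ᵥ Matrix.mulVec
        (Matrix.of fun i j => A i j - c / 18 * ∑ g, (baseDir g i : ℝ) * baseDir g j) x
        = (∑ i, ∑ j, x i * A i j * x j)
          - c / 18 * ∑ g, (∑ i, (baseDir g i : ℝ) * x i) ^ 2 := by
      simp only [dotProduct, Matrix.mulVec, star_trivial, Matrix.of_apply]
      simp [Fin.sum_univ_succ, baseDir]
      ring
    have h3 : ∀ a b d : ℝ, |a| ≤ 1 → |b| ≤ 1 → |d| ≤ 1 →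
        (a * x 0 + b * x 1 + d * x 2) ^ 2 ≤ 3 * (x 0 ^ 2 + x 1 ^ 2 + x 2 ^ 2) := by
      intro a b d ha hb hd
      have ha := mul_le_mul_of_nonneg_right ((sq_le_one_iff_abs_le_one a).2 ha) (sq_nonneg (x 0))
      have hb := mul_le_mul_of_nonneg_right ((sq_le_one_iff_abs_le_one b).2 hb) (sq_nonneg (x 1))
      have hd := mul_le_mul_of_nonneg_right ((sq_le_one_iff_abs_le_one d).2 hd) (sq_nonneg (x 2))
      nlinarith [sq_nonneg (a * x 0 - b * x 1), sq_nonneg (a * x 0 - d * x 2),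
        sq_nonneg (b * x 1 - d * x 2)]
    have h4 : ∀ g, (∑ i, (baseDir g i : ℝ) * x i) ^ 2 ≤ 3 * ∑ i, x i ^ 2 := by
      intro g
      rw [Fin.sum_univ_three, Fin.sum_univ_three]
      refine h3 _ _ _ ?_ ?_ ?_ <;> fin_cases g <;> simp [baseDir]
    have h5 : ∑ g, (∑ i, (baseDir g i : ℝ) * x i) ^ 2 ≤ 18 * ∑ i, x i ^ 2 := by
      refine (Finset.sum_le_sum fun g _ => h4 g).trans ?_
      simp; linarith
    rw [h2]
    nlinarith

theorem exists_int_direction {r : Fin 3 → ℝ} (hr : ∀ i, r i ∈ range ((↑) : ℚ → ℝ) \ {0}) :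
    ∃ (f : Fin 3 → ℤ) (c : ℝ), 0 < f 0 ∧ 0 < c ∧ ∀ i j, c * ((f i : ℝ) * f j) = r i * r j := by
  choose q hq using fun i => (hr i).1
  have hq0 : q 0 ≠ 0 := fun h => (hr 0).2 (by rw [mem_singleton_iff, ← hq, h, Rat.cast_zero])
  obtain ⟨d, hd, n, hn⟩ : ∃ d : ℤ, d ≠ 0 ∧ ∃ n : Fin 3 → ℤ, ∀ i, (n i : ℝ) = d * r i := by
    refine ⟨((q 0).den * (q 1).den * (q 2).den : ℕ), by
      have := (q 0).den_ne_zero; have := (q 1).den_ne_zero; have := (q 2).den_ne_zero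
      positivity, ?_⟩
    have key : ∀ i, (r i) * (q i).den = (q i).num := fun i => by
      rw [← hq i]; exact_mod_cast Rat.mul_den_eq_num (q i)
    refine ⟨![(q 0).num * (q 1).den * (q 2).den, (q 1).num * (q 0).den * (q 2).den,
      (q 2).num * (q 0).den * (q 1).den], fun i => ?_⟩
    fin_cases i <;> simp [← key] <;> ring
  have hd' : (d : ℝ) ≠ 0 := by exact_mod_cast hd
  have hr0 : r 0 ≠ 0 := fun h => (hr 0).2 h
  have hn0 : n 0 ≠ 0 := fun h => by
    have := hn 0
    rw [h, Int.cast_zero] at this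
    exact (mul_ne_zero hd' hr0) this.symm
  -- Multiplying by `n 0` after clearing denominators makes the first entry a nonzero square, hence
  -- positive, without changing the line.
  refine ⟨fun i => n 0 * n i, ((n 0 : ℝ) ^ 2 * d ^ 2)⁻¹, ?_, ?_, fun i j => ?_⟩
  · exact mul_self_pos.2 hn0
  · have : (n 0 : ℝ) ≠ 0 := by exact_mod_cast hn0
    positivity
  · have : (n 0 : ℝ) ≠ 0 := by exact_mod_cast hn0
    push_cast
    rw [hn i, hn j]
    field_simp

/-- After subtracting a small multiple of the base matrices, `A₀` is a sum of real rank one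
matrices. Their vectors are replaced by nearby rational ones, and the six base coefficients absorb
the error as well as the variation of `A`; the remaining coefficients are constants. -/
theorem exists_local_decomposition {A₀ : Matrix (Fin 3) (Fin 3) ℝ} (hA : A₀.PosDef) :
    ∃ (m : ℕ) (f : Fin m ⊕ Fin 6 → Fin 3 → ℤ) (c : Fin m ⊕ Fin 6 → (Fin 3 → Fin 3 → ℝ) → ℝ),
      (∀ J, 0 < f J 0) ∧ (∀ J, ContDiff ℝ ∞ (c J)) ∧ (∀ J, 0 < c J A₀) ∧
      ∀ A : Fin 3 → Fin 3 → ℝ, (∀ i j, A i j = A j i) →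
        ∀ i j, ∑ J, c J A * ((f J i : ℝ) * f J j) = A i j := by
  obtain ⟨δ, hδ, hps⟩ := exists_posSemidef_sub hA
  obtain ⟨m, b, hb⟩ := Matrix.posSemidef_iff_eq_sum_vecMulVec.1 hps
  have hb' : ∀ i j, A₀ i j - δ * ∑ g, (baseDir g i : ℝ) * baseDir g j = ∑ k, b k i * b k j := by
    intro i j
    have := congrFun (congrFun hb i) j
    rw [Matrix.sum_apply] at this
    simpa [Matrix.vecMulVec_apply] using this
  have hcont : ∀ g, Continuous fun B : Fin m → Fin 3 → ℝ =>
      baseCoef g (fun i j => A₀ i j - ∑ k, B k i * B k j) := fun g =>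
    (contDiff_baseCoef g).continuous.comp (by fun_prop)
  have hopen : IsOpen {B : Fin m → Fin 3 → ℝ |
      ∀ g, 0 < baseCoef g (fun i j => A₀ i j - ∑ k, B k i * B k j)} := by
    simp only [ofPred_forall]
    exact isOpen_iInter_of_finite fun g => isOpen_lt continuous_const (hcont g)
  -- Vectors with nonzero rational entries are dense; a nonzero first entry is what
  -- `exists_int_direction` needs.
  have hdense : Dense (Set.pi univ fun _ : Fin m => Set.pi univ fun _ : Fin 3 =>
      (range ((↑) : ℚ → ℝ) \ {0})) :=
    dense_pi _ fun _ _ => dense_pi _ fun _ _ => Dense.sdiff_singleton Rat.denseRange_cast 0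
  obtain ⟨B, hB1, hB2⟩ := hdense.inter_open_nonempty _ hopen ⟨b, fun g => by
    simp only [← hb']
    exact hδ.trans_eq (baseCoef_sub_smul_sum A₀ δ g).symm⟩
  choose f c hf hc hfc using fun k => exists_int_direction fun i => hB2 k (mem_univ k) i (mem_univ i)
  refine ⟨m, Sum.elim f baseDir, Sum.elim (fun k _ => c k)
    (fun g A => baseCoef g (fun i j => A i j - ∑ k, B k i * B k j)), ?_, ?_, ?_, ?_⟩
  · rintro (k | g)
    · exact hf k
    · fin_cases g <;> simp [baseDir]
  · rintro (k | g)
    · exact contDiff_const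
    · refine (contDiff_baseCoef g).comp (contDiff_pi.2 fun i => contDiff_pi.2 fun j => ?_)
      exact (contDiff_apply_apply ℝ ℝ i j).sub contDiff_const
  · rintro (k | g)
    · exact hc k
    · exact hB1 g
  · intro A hA i j
    rw [Fintype.sum_sum_type]
    simp only [Sum.elim_inl, Sum.elim_inr]
    rw [sum_baseCoef (A := fun i j => A i j - ∑ k, B k i * B k j)
      (fun i j => by rw [hA i j]; simp only [mul_comm])]
    simp only [hfc]
    ring

/-- The square root is smooth where its argument is positive, and the bump vanishes elsewhere. -/
theorem contDiff_bump_mul_sqrt {M : Type*} [NormedAddCommGroup M] [NormedSpace ℝ M]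
    [HasContDiffBump M] [FiniteDimensional ℝ M] {A₀ : M} (β : ContDiffBump A₀) {c : M → ℝ}
    (hc : ContDiff ℝ ∞ c) (hpos : ∀ A ∈ Metric.closedBall A₀ β.rOut, 0 < c A) :
    ContDiff ℝ ∞ fun A => β A * √(c A) := by
  refine contDiff_iff_contDiffAt.2 fun A => ?_
  by_cases h : A ∈ Metric.closedBall A₀ β.rOut
  · exact β.contDiffAt.mul (hc.contDiffAt.sqrt (hpos A h).ne')
  · have ho : ∀ᶠ B in 𝓝 A, B ∉ Metric.closedBall A₀ β.rOut :=
      Metric.isClosed_closedBall.isOpen_compl.mem_nhds h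
    refine (contDiffAt_const (c := (0 : ℝ))).congr_of_eventuallyEq ?_
    filter_upwards [ho] with B hB
    rw [β.zero_of_le_dist (le_of_lt (by simpa using hB)), zero_mul]

/-- Local decompositions are glued by a partition of unity into squares of bumps, which keeps each
coefficient the square of a smooth function. -/
theorem exists_decomposition {K : Set (Fin 3 → Fin 3 → ℝ)} (hK : IsCompact K)
    (hpos : ∀ A ∈ K, (Matrix.of A).PosDef) :
    ∃ (ι : Type) (_ : Fintype ι) (f : ι → Fin 3 → ℤ) (a : ι → (Fin 3 → Fin 3 → ℝ) → ℝ),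
      (∀ J, 0 < f J 0) ∧ (∀ J, ContDiff ℝ ∞ (a J)) ∧
      ∀ A ∈ K, ∀ i j, ∑ J, a J A ^ 2 * ((f J i : ℝ) * f J j) = A i j := by
  choose m f c hf hc hc0 hsum using fun A : K => exists_local_decomposition (hpos A A.2)
  have hball : ∀ A : K, ∃ r, 0 < r ∧ ∀ B ∈ Metric.closedBall (A : Fin 3 → Fin 3 → ℝ) r,
      ∀ J, 0 < c A J B := by
    intro A
    have : ∀ᶠ B in 𝓝 (A : Fin 3 → Fin 3 → ℝ), ∀ J, 0 < c A J B :=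
      eventually_all.2 fun J => (hc A J).continuous.continuousAt.eventually_const_lt (hc0 A J)
    exact Metric.nhds_basis_closedBall.mem_iff.1 this
  choose r hr hrpos using hball
  let β : ∀ A : K, ContDiffBump (A : Fin 3 → Fin 3 → ℝ) := fun A =>
    ⟨r A / 2, r A, half_pos (hr A), half_lt_self (hr A)⟩
  obtain ⟨s, hs⟩ := hK.elim_finite_subcover (fun A : K => Metric.ball (A : Fin 3 → Fin 3 → ℝ) (r A / 2))
    (fun A => Metric.isOpen_ball)
    (fun A hA => mem_iUnion.2 ⟨⟨A, hA⟩, Metric.mem_ball_self (half_pos (hr _))⟩)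
  obtain ⟨σ, hσ⟩ : ∃ σ : (Fin 3 → Fin 3 → ℝ) → ℝ, ∀ B, σ B = ∑ A ∈ s, β A B ^ 2 :=
    ⟨_, fun _ => rfl⟩
  have hσs : ContDiff ℝ ∞ σ := by
    rw [funext hσ]
    exact ContDiff.sum fun A _ => (β A).contDiff.pow 2
  have hσ0 : ∀ B, 0 ≤ σ B := fun B => by rw [hσ]; positivity
  -- On `K` the sum of squares is at least one and `d` equals it; the correction keeps `d` positive
  -- away from `K`, so the amplitudes are smooth everywhere.
  obtain ⟨d, hd⟩ : ∃ d : (Fin 3 → Fin 3 → ℝ) → ℝ, ∀ B, d B = σ B + Real.smoothTransition (1 - σ B) :=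
    ⟨_, fun _ => rfl⟩
  have hds : ContDiff ℝ ∞ d := by
    rw [funext hd]
    exact hσs.add (Real.smoothTransition.contDiff.comp (contDiff_const.sub hσs))
  have hd0 : ∀ B, 0 < d B := fun B => by
    rw [hd]
    rcases (hσ0 B).lt_or_eq with h | h
    · exact add_pos_of_pos_of_nonneg h (Real.smoothTransition.nonneg _)
    · rw [← h, sub_zero, zero_add]; exact Real.smoothTransition.pos_of_pos one_pos
  have hd1 : ∀ B ∈ K, d B = σ B := fun B hB => by
    obtain ⟨A, hA, hBA⟩ := mem_iUnion₂.1 (hs hB)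
    have h1 : β A B = 1 := (β A).one_of_mem_closedBall (Metric.ball_subset_closedBall hBA)
    have h2 : 1 ≤ σ B := by
      rw [hσ]
      have := Finset.single_le_sum (f := fun A => β A B ^ 2) (fun A _ => sq_nonneg _) hA
      simpa [h1] using this
    rw [hd, Real.smoothTransition.zero_of_nonpos (by linarith), add_zero]
  refine ⟨Σ A : s, Fin (m A.1) ⊕ Fin 6, inferInstance, fun J => f J.1 J.2,
    fun J B => (β J.1 B * √(c J.1 J.2 B)) * (√(d B))⁻¹, fun J => hf _ _, fun J => ?_,
    fun B hB i j => ?_⟩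
  · refine (contDiff_bump_mul_sqrt (β J.1) (hc _ _) (fun B hB => hrpos J.1 B hB J.2)).mul ?_
    exact (hds.sqrt fun B => (hd0 B).ne').inv fun B => (Real.sqrt_pos.2 (hd0 B)).ne'
  · rw [Fintype.sum_sigma]
    have hsym : ∀ i j, B i j = B j i := fun i j => by
      simpa using ((hpos B hB).isHermitian.apply i j).symm
    have h1 : ∀ (A : s) (J : Fin (m A.1) ⊕ Fin 6), (β A B * √(c A J B) * (√(d B))⁻¹) ^ 2
        = (σ B)⁻¹ * β A B ^ 2 * c A J B := by
      intro A J
      rw [mul_pow, mul_pow, inv_pow, Real.sq_sqrt (hd0 B).le, hd1 B hB]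
      by_cases hBA : B ∈ Metric.closedBall (A : Fin 3 → Fin 3 → ℝ) (r A)
      · rw [Real.sq_sqrt (hrpos A B hBA J).le]; ring
      · have : β A B = 0 := (β A).zero_of_le_dist (le_of_lt (by simpa using hBA))
        rw [this]; simp
    have h2 : ∀ A : s, ∑ J, (β A B * √(c A J B) * (√(d B))⁻¹) ^ 2 * ((f A J i : ℝ) * f A J j)
        = (σ B)⁻¹ * β A B ^ 2 * B i j := by
      intro A
      simp only [h1]
      rw [← hsum A B hsym i j, Finset.mul_sum]
      exact Finset.sum_congr rfl fun J _ => by ring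
    simp only [h2]
    have h3 : ∑ A : s, β A B ^ 2 = σ B := by
      rw [hσ]; exact Finset.sum_coe_sort s fun A => β A B ^ 2
    rw [← Finset.sum_mul, ← Finset.mul_sum, h3, inv_mul_cancel₀, one_mul]
    rw [← hd1 B hB]; exact (ne_of_lt (hd0 B)).symm

/-! ### Means -/

theorem proj_zero_apply (f : Sm) (t : ℝ) (x : E3) :
    proj 0 f t x = ((2 * Real.pi) ^ 3)⁻¹ * ∫ y in cube, f t y := by
  rw [proj_apply]
  simp [phase]

theorem dx_proj_zero (i : Fin 3) (f : Sm) : Sm.dx i (proj 0 f) = 0 := by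
  ext t x
  rw [Sm.dx_apply]
  exact Sm.pd_eq_zero_of_const (fun x y => by rw [proj_zero_apply, proj_zero_apply]) i x

theorem proj_zero_dx (i : Fin 3) (f : Sm) : proj 0 (Sm.dx i f) = 0 := by
  rw [← dx_proj, dx_proj_zero]

theorem dt_proj (k : Fin 3 → ℤ) (f : Sm) : Sm.dt (proj k f) = proj k (Sm.dt f) := D_proj _ k f

theorem proj_zero_const (c : ℝ) : proj 0 (algebraMap ℝ Sm c) = algebraMap ℝ Sm c := by
  ext t x
  rw [proj_zero_apply]
  simp only [Sm.algebraMap_apply, setIntegral_const, volume_cube, smul_eq_mul]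
  have : (2 * Real.pi) ^ 3 ≠ 0 := by positivity
  field_simp

theorem proj_zero_proj_zero (f : Sm) : proj 0 (proj 0 f) = proj 0 f := by
  ext t x
  have hp : (2 * Real.pi) ^ 3 ≠ 0 := by positivity
  rw [proj_zero_apply (proj 0 f)]
  simp only [proj_zero_apply, setIntegral_const, volume_cube, smul_eq_mul]
  field_simp

theorem integral_sq_pos (f : Sm) (t : ℝ) (x : E3) (hx : f t x ≠ 0) :
    0 < ∫ y in cube, f t y ^ 2 := by
  have hper : Periodic3 fun y => f t y ^ 2 := fun i y => by
    beta_reduce; rw [f.periodic t i y]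
  exact integral_cube_pos hper ((f.continuous_slice t).pow 2) (fun y => sq_nonneg _)
    (pow_ne_zero 2 hx)

/-! ### Functions of one linear phase -/

/-- A smooth `2π`-periodic function of one variable. -/
structure CircleFn where
  /-- the function -/
  fn : ℝ → ℝ
  smooth : ContDiff ℝ ∞ fn
  periodic : Function.Periodic fn (2 * Real.pi)

namespace CircleFn

/-- The derivative. -/
def deriv (h : CircleFn) : CircleFn where
  fn := _root_.deriv h.fn
  smooth := (contDiff_infty_iff_deriv.1 h.smooth).2
  periodic := fun s => by
    rw [← deriv_comp_add_const, show (fun s => h.fn (s + 2 * Real.pi)) = h.fn from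
      funext h.periodic]

/-- The function `h (k · x - α)`. -/
def ridge (h : CircleFn) (k : Fin 3 → ℤ) (α : ℝ) : Sm :=
  ⟨fun _ x => h.fn (phase k x - α),
    h.smooth.comp (ContDiff.sub (by
      unfold phase
      refine ContDiff.sum fun i _ => contDiff_const.mul ?_
      exact (EuclideanSpace.proj (𝕜 := ℝ) i).contDiff.comp contDiff_snd) contDiff_const),
    fun _ i x => by
      beta_reduce
      rw [phase_add, phase_smul_stdVec, add_sub_right_comm, mul_comm (2 * Real.pi)]
      exact h.periodic.int_mul (k i) _⟩

theorem ridge_apply (h : CircleFn) (k : Fin 3 → ℤ) (α : ℝ) (t : ℝ) (x : E3) :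
    h.ridge k α t x = h.fn (phase k x - α) := rfl

theorem dt_ridge (h : CircleFn) (k : Fin 3 → ℤ) (α : ℝ) : Sm.dt (h.ridge k α) = 0 := by
  ext t x
  exact ((h.ridge k α).hasDerivAt_time t x).unique (hasDerivAt_const t _)

theorem dx_ridge (h : CircleFn) (k : Fin 3 → ℤ) (α : ℝ) (i : Fin 3) :
    Sm.dx i (h.ridge k α) = (k i : ℝ) • h.deriv.ridge k α := by
  ext t x
  obtain ⟨L, hL, hLi⟩ := hasFDerivAt_phase k x
  have hd : HasDerivAt h.fn (h.deriv.fn (phase k x - α)) (phase k x - α) :=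
    ((h.smooth.differentiable (by simp)) _).hasDerivAt
  have h1 := hd.comp_hasFDerivAt x (hL.sub_const α)
  rw [Sm.dx_apply, pd, Sm.smul_apply]
  change fderiv ℝ (h.fn ∘ fun x => phase k x - α) x (stdVec i) = _
  rw [h1.fderiv, ridge_apply, smul_apply, hLi, smul_eq_mul, mul_comm]

end CircleFn

/-! ### Disjoint pipes -/

/-- A family of profiles constant along integer directions, with disjoint supports. -/
structure PipeFamily {ι : Type} (f : ι → Fin 3 → ℤ) where
  /-- first conormal -/
  k : ι → Fin 3 → ℝ
  /-- second conormal -/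
  l : ι → Fin 3 → ℝ
  /-- the factor of the vector product of the conormals over the direction -/
  r : ι → ℝ
  r_pos : ∀ J, 0 < r J
  cross : ∀ J i, k J (i + 1) * l J (i + 2) - k J (i + 2) * l J (i + 1) = r J * f J i
  /-- the potentials -/
  G : ι → Sm
  /-- the profiles -/
  g : ι → Sm
  /-- the derivatives of the potentials in the second variable -/
  g₂ : ι → Sm
  dt_G : ∀ J, Sm.dt (G J) = 0
  dt_g : ∀ J, Sm.dt (g J) = 0
  mean_G : ∀ J, proj 0 (G J) = 0
  mean_g : ∀ J, proj 0 (g J) = 0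
  dx_G : ∀ J p, Sm.dx p (G J) = k J p • g J + l J p • g₂ J
  disjoint : ∀ J J', J ≠ J' → g J * g J' = 0
  dx_g : ∀ J, ∑ p, (f J p : ℝ) • Sm.dx p (g J) = 0
  /-- the mean squares -/
  ms : ι → ℝ
  ms_pos : ∀ J, 0 < ms J
  mean_sq : ∀ J, proj 0 (g J * g J) = algebraMap ℝ Sm (ms J)

/-- A Liouville number is transcendental, so its distinct positive powers and one satisfy no
nontrivial integer relation. The last two exponents may be arbitrary as long as they differ from the
first two. -/
theorem exists_transcendental_relation :
    ∃ τ : ℝ, ∀ (e₁ e₂ e₃ e₄ : ℕ) (c₁ c₂ c₃ c₄ z : ℤ), e₁ ≠ 0 → e₂ ≠ 0 → e₁ ≠ e₂ → e₁ ≠ e₃ → e₁ ≠ e₄ →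
      e₂ ≠ e₃ → e₂ ≠ e₄ →
      c₁ * τ ^ e₁ + c₂ * τ ^ e₂ + c₃ * τ ^ e₃ + c₄ * τ ^ e₄ = z → c₁ = 0 ∧ c₂ = 0 := by
  refine ⟨liouvilleNumber (2 : ℕ), fun e₁ e₂ e₃ e₄ c₁ c₂ c₃ c₄ z h1 h2 h12 h13 h14 h23 h24 h => ?_⟩
  have htr := transcendental_liouvilleNumber (m := 2) le_rfl
  have h0 := transcendental_iff.1 htr
    (.monomial e₁ c₁ + .monomial e₂ c₂ + .monomial e₃ c₃ + .monomial e₄ c₄ - .C z) (by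
      simp only [map_sub, map_add, Polynomial.aeval_monomial, Polynomial.aeval_C]
      simp only [algebraMap_int_eq, eq_intCast]
      linarith)
  have hc := fun e => congrArg (fun P => Polynomial.coeff P e) h0
  have g1 := hc e₁
  have g2 := hc e₂
  simp only [Polynomial.coeff_sub, Polynomial.coeff_add, Polynomial.coeff_monomial,
    Polynomial.coeff_C, Polynomial.coeff_zero] at g1 g2
  simp [h1, h12.symm, h13.symm, h14.symm] at g1
  simp [h2, h12, h23.symm, h24.symm] at g2
  exact ⟨g1, g2⟩

/-- The bump is itself a derivative, so that the potential built from two of them, and not only the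
profile, has mean zero. -/
theorem exists_bump_circleFn {c : ℝ} (h0 : 0 < c) (h1 : c < 1) :
    ∃ h : CircleFn, (∀ s, Real.cos s < c → h.fn s = 0 ∧ h.deriv.fn s = 0) ∧
      (∃ s, h.fn s ≠ 0) ∧ (∃ s, h.deriv.fn s ≠ 0) ∧ ∃ H : CircleFn, H.deriv = h := by
  let H : CircleFn := ⟨fun s => expNegInvGlue (Real.cos s - c),
    expNegInvGlue.contDiff.comp (Real.contDiff_cos.sub contDiff_const),
    fun s => by beta_reduce; rw [Real.cos_add_two_pi]⟩
  have hloc : ∀ s, Real.cos s < c → H.fn =ᶠ[𝓝 s] fun _ => 0 := by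
    intro s hs
    filter_upwards [Real.continuous_cos.continuousAt.eventually_lt_const hs] with r hr
    exact expNegInvGlue.zero_of_nonpos (by linarith)
  have hz : ∀ s, Real.cos s < c → H.deriv.fn =ᶠ[𝓝 s] fun _ => 0 := by
    intro s hs
    have := (hloc s hs).deriv
    simpa using! this
  have hz' : ∀ s, Real.cos s < c → H.deriv.deriv.fn s = 0 := by
    intro s hs
    have := (hz s hs).deriv_eq
    rw [deriv_const] at this
    exact this
  have hpi : Real.cos Real.pi < c := by rw [Real.cos_pi]; linarith
  have hne : ∃ s, H.deriv.fn s ≠ 0 := by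
    by_contra! hall
    have hconst := is_const_of_deriv_eq_zero (H.smooth.differentiable (by simp)) hall 0 Real.pi
    have h2 : H.fn Real.pi = 0 := (hloc _ hpi).eq_of_nhds
    have h3 : 0 < H.fn 0 := expNegInvGlue.pos_of_pos (by rw [Real.cos_zero]; linarith)
    rw [hconst, h2] at h3
    exact lt_irrefl _ h3
  refine ⟨H.deriv, fun s hs => ⟨(hz s hs).eq_of_nhds, hz' s hs⟩, hne, ?_, H, rfl⟩
  by_contra! hall
  obtain ⟨s, hs⟩ := hne
  refine hs ?_
  rw [is_const_of_deriv_eq_zero (H.deriv.smooth.differentiable (by simp)) hall s Real.pi]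
  exact (hz _ hpi).eq_of_nhds

/-- The conormals `(-f₁, f₀, 0)` and `(-f₂, 0, f₀)` have vector product `f₀ f`. Shifting the axes by
distinct powers of a transcendental number makes all axes disjoint, even for parallel directions; by
compactness thin pipes around them are disjoint too. -/
theorem exists_pipeFamily {ι : Type} [Fintype ι] (f : ι → Fin 3 → ℤ) (hf : ∀ J, 0 < f J 0) :
    Nonempty (PipeFamily f) := by
  classical
  obtain ⟨τ, hτ⟩ := exists_transcendental_relation
  obtain ⟨e⟩ : Nonempty (ι ≃ Fin (Fintype.card ι)) := ⟨Fintype.equivFin ι⟩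
  obtain ⟨k, hk⟩ : ∃ k : ι → Fin 3 → ℤ, ∀ J, k J = ![-f J 1, f J 0, 0] := ⟨_, fun _ => rfl⟩
  obtain ⟨l, hl⟩ : ∃ l : ι → Fin 3 → ℤ, ∀ J, l J = ![-f J 2, 0, f J 0] := ⟨_, fun _ => rfl⟩
  obtain ⟨α, hα⟩ : ∃ α : ι → ℝ, ∀ J, α J = 2 * Real.pi * τ ^ (2 * (e J : ℕ) + 1) := ⟨_, fun _ => rfl⟩
  obtain ⟨β, hβ⟩ : ∃ β : ι → ℝ, ∀ J, β J = 2 * Real.pi * τ ^ (2 * (e J : ℕ) + 2) := ⟨_, fun _ => rfl⟩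
  have hkx : ∀ J (x : E3), phase (k J) x = -(f J 1 : ℝ) * x 0 + f J 0 * x 1 := fun J x => by
    simp [phase, hk, Fin.sum_univ_three]
  have hlx : ∀ J (x : E3), phase (l J) x = -(f J 2 : ℝ) * x 0 + f J 0 * x 2 := fun J x => by
    simp [phase, hl, Fin.sum_univ_three]
  have hpi : (2 * Real.pi) ≠ 0 := by positivity
  have hdisj : ∀ J J', J ≠ J' → ∀ x : E3, ¬ (Real.cos (phase (k J) x - α J) = 1 ∧
      Real.cos (phase (l J) x - β J) = 1 ∧ Real.cos (phase (k J') x - α J') = 1 ∧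
      Real.cos (phase (l J') x - β J') = 1) := by
    rintro J J' hJ x ⟨h1, h2, h3, h4⟩
    obtain ⟨n₁, h1⟩ := (Real.cos_eq_one_iff _).1 h1
    obtain ⟨n₂, h2⟩ := (Real.cos_eq_one_iff _).1 h2
    obtain ⟨n₃, h3⟩ := (Real.cos_eq_one_iff _).1 h3
    obtain ⟨n₄, h4⟩ := (Real.cos_eq_one_iff _).1 h4
    have hee : (e J : ℕ) ≠ e J' := fun h => hJ (e.injective (Fin.ext h))
    rw [hα, hkx] at h1 h3
    rw [hβ, hlx] at h2 h4
    set A : ℤ := f J' 1 * f J 0 - f J 1 * f J' 0 with hA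
    set B : ℤ := f J' 2 * f J 0 - f J 2 * f J' 0 with hB
    -- Eliminating `x` from the four equations of a common point of two axes gives an integer
    -- relation between powers of `τ`; it forces the directions to be parallel.
    have key := hτ (2 * (e J : ℕ) + 1) (2 * (e J : ℕ) + 2) (2 * (e J' : ℕ) + 1) (2 * (e J' : ℕ) + 2)
      (B * f J' 0) (-(A * f J' 0)) (-(B * f J 0)) (A * f J 0)
      (B * (f J 0 * n₃ - f J' 0 * n₁) - A * (f J 0 * n₄ - f J' 0 * n₂))
      (by omega) (by omega) (by omega) (by omega) (by omega) (by omega) (by omega) (by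
        refine mul_left_cancel₀ hpi ?_
        rw [hA, hB]
        push_cast
        linear_combination -((f J' 2 * f J 0 - f J 2 * f J' 0 : ℝ) * f J 0) * h3
          + ((f J' 2 * f J 0 - f J 2 * f J' 0 : ℝ) * f J' 0) * h1
          + ((f J' 1 * f J 0 - f J 1 * f J' 0 : ℝ) * f J 0) * h4
          - ((f J' 1 * f J 0 - f J 1 * f J' 0 : ℝ) * f J' 0) * h2)
    have hB0 : B = 0 := by simpa [(hf J').ne'] using key.1
    have hA0 : A = 0 := by simpa [(hf J').ne'] using key.2
    -- For parallel directions `x` already drops out of the two equations containing `k`, and the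
    -- resulting relation is impossible.
    have key2 := hτ (2 * (e J : ℕ) + 1) (2 * (e J : ℕ) + 2) (2 * (e J' : ℕ) + 1) (2 * (e J' : ℕ) + 2)
      (f J' 0) 0 (-(f J 0)) 0 (f J 0 * n₃ - f J' 0 * n₁)
      (by omega) (by omega) (by omega) (by omega) (by omega) (by omega) (by omega) (by
        have hA1 : (f J' 1 : ℝ) * f J 0 - f J 1 * f J' 0 = 0 := by exact_mod_cast hA0
        refine mul_left_cancel₀ hpi ?_
        push_cast
        linear_combination -(f J 0 : ℝ) * h3 + (f J' 0 : ℝ) * h1 + x 0 * hA1)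
    exact (hf J').ne' key2.1
  -- The minimum of the four cosines is a periodic continuous function that never reaches one, hence
  -- stays below some `c < 1`.
  have hthr : ∀ p : ι × ι, p.1 ≠ p.2 → ∃ c : ℝ, c < 1 ∧ ∀ x : E3,
      ¬ (c < Real.cos (phase (k p.1) x - α p.1) ∧
      c < Real.cos (phase (l p.1) x - β p.1) ∧ c < Real.cos (phase (k p.2) x - α p.2) ∧
      c < Real.cos (phase (l p.2) x - β p.2)) := by
    rintro ⟨J, J'⟩ hJ
    have hcos : ∀ (q : Fin 3 → ℤ) (γ : ℝ), Continuous fun x : E3 => Real.cos (phase q x - γ) :=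
      fun q γ => Real.continuous_cos.comp ((continuous_phase q).sub continuous_const)
    have hper : ∀ (q : Fin 3 → ℤ) (γ : ℝ), Periodic3 fun x : E3 => Real.cos (phase q x - γ) := by
      intro q γ i x
      beta_reduce
      rw [phase_add, phase_smul_stdVec, add_sub_right_comm, mul_comm (2 * Real.pi),
        Real.cos_add_int_mul_two_pi]
    obtain ⟨F, hF⟩ : ∃ F : E3 → ℝ, ∀ x, F x = min (min (Real.cos (phase (k J) x - α J))
      (Real.cos (phase (l J) x - β J))) (min (Real.cos (phase (k J') x - α J'))
      (Real.cos (phase (l J') x - β J'))) := ⟨_, fun _ => rfl⟩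
    have hFc : Continuous F := by
      rw [funext hF]
      exact ((hcos _ _).min (hcos _ _)).min ((hcos _ _).min (hcos _ _))
    have hFp : Periodic3 F := fun i x => by
      have := fun q γ => hper q γ i x
      beta_reduce at this
      simp only [hF, this]
    obtain ⟨y, -, hy⟩ := isCompact_closedCube.exists_isMaxOn ⟨0, fun i => by
      simp [Real.pi_pos.le]⟩ hFc.continuousOn
    have hF1 : F y < 1 := by
      by_contra! h
      rw [hF] at h
      simp only [le_min_iff] at h
      exact hdisj J J' hJ y ⟨le_antisymm (Real.cos_le_one _) h.1.1,
        le_antisymm (Real.cos_le_one _) h.1.2, le_antisymm (Real.cos_le_one _) h.2.1,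
        le_antisymm (Real.cos_le_one _) h.2.2⟩
    refine ⟨F y, hF1, fun x h => ?_⟩
    obtain ⟨w, hw⟩ := exists_lat_mem_cube x
    have h2 : F x ≤ F y := by
      rw [← hFp.add_lat w x]
      exact hy (cube_subset_closedCube hw)
    have h3 : F y < F x := by
      rw [hF x]
      exact lt_min (lt_min h.1 h.2.1) (lt_min h.2.2.1 h.2.2.2)
    exact absurd h2 (not_le.2 h3)
  obtain ⟨c, hc0, hc1, hc⟩ : ∃ c : ℝ, 0 < c ∧ c < 1 ∧ ∀ p : ι × ι, p.1 ≠ p.2 → ∀ x : E3,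
      ¬ (c ≤ Real.cos (phase (k p.1) x - α p.1) ∧
      c ≤ Real.cos (phase (l p.1) x - β p.1) ∧ c ≤ Real.cos (phase (k p.2) x - α p.2) ∧
      c ≤ Real.cos (phase (l p.2) x - β p.2)) := by
    have h1 : ∀ᶠ c : ℝ in 𝓝[<] 1, ∀ p : ι × ι, p.1 ≠ p.2 → ∀ x : E3,
      ¬ (c ≤ Real.cos (phase (k p.1) x - α p.1) ∧
      c ≤ Real.cos (phase (l p.1) x - β p.1) ∧ c ≤ Real.cos (phase (k p.2) x - α p.2) ∧
      c ≤ Real.cos (phase (l p.2) x - β p.2)) := by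
      refine eventually_all.2 fun p => ?_
      by_cases hp : p.1 ≠ p.2
      · obtain ⟨c₀, hc₀, h⟩ := hthr p hp
        filter_upwards [Ioo_mem_nhdsLT hc₀] with c hc _ x hx
        exact h x ⟨hc.1.trans_le hx.1, hc.1.trans_le hx.2.1, hc.1.trans_le hx.2.2.1,
          hc.1.trans_le hx.2.2.2⟩
      · exact Eventually.of_forall fun c h => absurd h hp
    obtain ⟨c, h, hc⟩ := (h1.and (Ioo_mem_nhdsLT (zero_lt_one (α := ℝ)))).exists
    exact ⟨c, hc.1, hc.2, h⟩
  obtain ⟨h, hsupp, ⟨s₂, hs₂⟩, ⟨s₁, hs₁⟩, H, hH⟩ := exists_bump_circleFn hc0 hc1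
  have hdxmul : ∀ (u v : CircleFn) J p, Sm.dx p (u.ridge (k J) (α J) * v.ridge (l J) (β J))
      = (k J p : ℝ) • (u.deriv.ridge (k J) (α J) * v.ridge (l J) (β J))
        + (l J p : ℝ) • (u.ridge (k J) (α J) * v.deriv.ridge (l J) (β J)) := by
    intro u v J p
    rw [Sm.dx_mul, CircleFn.dx_ridge, CircleFn.dx_ridge, smul_mul_assoc, mul_smul_comm]
  have hdt : ∀ (u v : CircleFn) J, Sm.dt (u.ridge (k J) (α J) * v.ridge (l J) (β J)) = 0 := by
    intro u v J
    rw [Sm.dt_mul, CircleFn.dt_ridge, CircleFn.dt_ridge, zero_mul, mul_zero, add_zero]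
  -- The second conormal has zero entry in direction `1`, so the product is a multiple of a pure
  -- derivative in that direction.
  have hmean : ∀ (u v : CircleFn) J, proj 0 (u.deriv.ridge (k J) (α J) * v.ridge (l J) (β J)) = 0 := by
    intro u v J
    have h1 := hdxmul u v J 1
    have h2 : (l J 1 : ℝ) = 0 := by rw [hl]; simp
    have h3 : (k J 1 : ℝ) ≠ 0 := by rw [hk]; simpa using (hf J).ne'
    rw [h2, zero_smul, add_zero] at h1
    have h4 := proj_zero_dx 1 (u.ridge (k J) (α J) * v.ridge (l J) (β J))
    rw [h1, proj_smul] at h4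
    exact (smul_eq_zero_iff_right h3).1 h4
  refine ⟨{
    k := fun J p => k J p
    l := fun J p => l J p
    r := fun J => f J 0
    r_pos := fun J => by exact_mod_cast hf J
    cross := fun J i => ?_
    G := fun J => h.ridge (k J) (α J) * h.ridge (l J) (β J)
    g := fun J => h.deriv.ridge (k J) (α J) * h.ridge (l J) (β J)
    g₂ := fun J => h.ridge (k J) (α J) * h.deriv.ridge (l J) (β J)
    dt_G := hdt h h
    dt_g := hdt h.deriv h
    mean_G := fun J => by rw [← hH]; exact hmean H H.deriv J
    mean_g := hmean h h
    dx_G := hdxmul h h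
    disjoint := fun J J' hJ => ?_
    dx_g := fun J => ?_
    ms := fun J => ((2 * Real.pi) ^ 3)⁻¹ *
      ∫ y in cube, (h.deriv.ridge (k J) (α J) * h.ridge (l J) (β J)) 0 y ^ 2
    ms_pos := fun J => ?_
    mean_sq := fun J => ?_ }⟩
  · rw [hk, hl]
    fin_cases i <;> simp <;> ring
  · ext t x
    simp only [Sm.mul_apply, Sm.zero_apply, CircleFn.ridge_apply]
    by_contra hne
    have h1 := left_ne_zero_of_mul hne
    have h2 := right_ne_zero_of_mul hne
    refine hc (J, J') hJ x ⟨?_, ?_, ?_, ?_⟩ <;> by_contra! hlt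
    · exact left_ne_zero_of_mul h1 (hsupp _ hlt).2
    · exact right_ne_zero_of_mul h1 (hsupp _ hlt).1
    · exact left_ne_zero_of_mul h2 (hsupp _ hlt).2
    · exact right_ne_zero_of_mul h2 (hsupp _ hlt).1
  · simp only [hdxmul, smul_add, Finset.sum_add_distrib, smul_smul, ← Finset.sum_smul]
    have h1 : ∑ p, (f J p : ℝ) * (k J p : ℝ) = 0 := by
      rw [hk, Fin.sum_univ_three]; simp; ring
    have h2 : ∑ p, (f J p : ℝ) * (l J p : ℝ) = 0 := by
      rw [hl, Fin.sum_univ_three]; simp; ring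
    rw [h1, h2, zero_smul, zero_smul, add_zero]
  · have hf0 : (f J 0 : ℝ) ≠ 0 := by exact_mod_cast (hf J).ne'
    refine mul_pos (by positivity) (integral_sq_pos _ 0
      (WithLp.toLp 2 ![0, (s₁ + α J) / f J 0, (s₂ + β J) / f J 0]) ?_)
    rw [Sm.mul_apply, CircleFn.ridge_apply, CircleFn.ridge_apply, hkx, hlx]
    simp only [Matrix.cons_val_zero, Matrix.cons_val_one, Matrix.cons_val, mul_zero, zero_add]
    rw [mul_div_cancel₀ _ hf0, mul_div_cancel₀ _ hf0, add_sub_cancel_right, add_sub_cancel_right]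
    exact mul_ne_zero hs₁ hs₂
  · ext t x
    rw [proj_zero_apply, Sm.algebraMap_apply]
    congr 1
    refine integral_congr_ae (Eventually.of_forall fun y => ?_)
    simp only [Sm.mul_apply, CircleFn.ridge_apply]
    ring

section Oscillation

/-! ### Oscillating functions in Lagrangian coordinates -/

/-- The material derivative along the vector field `v`. -/
def matD (v : Fin 3 → Sm) : Derivation ℝ Sm Sm := Sm.dt + ∑ j, v j • Sm.dx j

theorem matD_apply (v : Fin 3 → Sm) (f : Sm) : matD v f = Sm.dt f + ∑ j, v j * Sm.dx j f := by
  simp [matD, Fin.sum_univ_three]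

theorem matD_mul (v : Fin 3 → Sm) (f g : Sm) : matD v (f * g) = matD v f * g + f * matD v g := by
  rw [Derivation.leibniz]; simp only [smul_eq_mul]; ring

/-! ### Calculus of functions with transported phase. -/

section Osc

variable {v : Fin 3 → Sm} (Φ : TransportMap v)

/-- The function `q (t, n Φ(t, x))`. -/
def osc (n : ℕ) (q : Sm) : Sm := compTorusMap Φ.map Φ.contDiff Φ.translate n q

theorem osc_apply (n : ℕ) (q : Sm) (t : ℝ) (x : E3) :
    osc Φ n q t x = q t ((n : ℝ) • Φ.map (t, x)) := rfl

theorem osc_add (n : ℕ) (p q : Sm) : osc Φ n (p + q) = osc Φ n p + osc Φ n q := rfl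
theorem osc_sub (n : ℕ) (p q : Sm) : osc Φ n (p - q) = osc Φ n p - osc Φ n q := rfl
theorem osc_mul (n : ℕ) (p q : Sm) : osc Φ n (p * q) = osc Φ n p * osc Φ n q := rfl
theorem osc_smul (n : ℕ) (r : ℝ) (q : Sm) : osc Φ n (r • q) = r • osc Φ n q := rfl
theorem osc_zero (n : ℕ) : osc Φ n 0 = 0 := rfl
theorem osc_const (n : ℕ) (r : ℝ) : osc Φ n (algebraMap ℝ Sm r) = algebraMap ℝ Sm r := rfl

theorem osc_sum {ι : Type*} (s : Finset ι) (n : ℕ) (q : ι → Sm) :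
    osc Φ n (∑ i ∈ s, q i) = ∑ i ∈ s, osc Φ n (q i) := by
  ext t x
  simp [osc_apply]

theorem D_osc (n : ℕ) (q : Sm) (a : ℝ × E3) (t : ℝ) (x : E3) :
    Sm.D a (osc Φ n q) t x = a.1 * osc Φ n (Sm.dt q) t x
      + ∑ l, (n * ∑ i, (a.2 i - a.1 * v i t x) * Φ.grad l i t x) * osc Φ n (Sm.dx l q) t x := by
  have h1 : HasFDerivAt (fun z : ℝ × E3 => (z.1, (n : ℝ) • Φ.map z))
      ((ContinuousLinearMap.fst ℝ ℝ E3).prod ((n : ℝ) • fderiv ℝ Φ.map (t, x))) (t, x) :=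
    hasFDerivAt_fst.prodMk ((Φ.differentiable (t, x)).hasFDerivAt.const_smul (n : ℝ))
  have h2 : HasFDerivAt (osc Φ n q).unc ((fderiv ℝ q.unc (t, (n : ℝ) • Φ.map (t, x))).comp
      ((ContinuousLinearMap.fst ℝ ℝ E3).prod ((n : ℝ) • fderiv ℝ Φ.map (t, x)))) (t, x) :=
    HasFDerivAt.comp (g := q.unc) (t, x) (q.differentiable _).hasFDerivAt h1
  rw [Sm.D_apply, h2.fderiv, ContinuousLinearMap.comp_apply, Sm.fderiv_eq]
  simp only [ContinuousLinearMap.prod_apply, ContinuousLinearMap.coe_fst', smul_apply,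
    PiLp.smul_apply, smul_eq_mul, Φ.fderiv_eq, osc_apply]

theorem dx_osc (n : ℕ) (q : Sm) (i : Fin 3) :
    Sm.dx i (osc Φ n q) = (n : ℝ) • ∑ l, Φ.grad l i * osc Φ n (Sm.dx l q) := by
  ext t x
  rw [Sm.dx, D_osc]
  have h : ∀ l, ∑ j, ((stdVec i) j - 0 * v j t x) * Φ.grad l j t x = Φ.grad l i t x := by
    intro l
    fin_cases i <;> simp [stdVec]
  simp only [h]
  simp only [zero_mul, zero_add, Sm.smul_apply, Sm.sum_apply, Sm.mul_apply, Finset.mul_sum,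
    mul_assoc]

/-- The phase is transported by `v`, so the material derivative produces no factor `n`. -/
theorem matD_osc (n : ℕ) (q : Sm) : matD v (osc Φ n q) = osc Φ n (Sm.dt q) := by
  rw [matD_apply]
  simp only [dx_osc]
  ext t x
  rw [Sm.add_apply, Sm.dt, D_osc]
  simp only [Fin.sum_univ_three, Sm.add_apply, Sm.mul_apply, Sm.smul_apply, PiLp.zero_apply]
  rw [Sm.dt]
  ring

/-- The chain rule solved for the fast derivative by means of the inverse gradient: a fast
derivative is a divergence of size `n⁻¹` up to a term of size `n⁻¹`. -/
theorem mul_osc_dx (c Q : Sm) (p : Fin 3) (n : ℕ) (hn : 1 ≤ n) :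
    c * osc Φ n (Sm.dx p Q) = (n : ℝ)⁻¹ • ∑ l, Sm.dx l (c * Φ.inv l p * osc Φ n Q)
      - (n : ℝ)⁻¹ • ∑ l, Sm.dx l (c * Φ.inv l p) * osc Φ n Q := by
  have hn' : (n : ℝ) ≠ 0 := by positivity
  have h1 : ∑ l, Sm.dx l (c * Φ.inv l p * osc Φ n Q)
      = ∑ l, Sm.dx l (c * Φ.inv l p) * osc Φ n Q
        + (n : ℝ) • (c * osc Φ n (Sm.dx p Q)) := by
    simp only [fun l => Sm.dx_mul l (c * Φ.inv l p) (osc Φ n Q)]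
    rw [Finset.sum_add_distrib]
    congr 1
    have h2 : ∀ r, ∑ l, c * Φ.inv l p * (Φ.grad r l * osc Φ n (Sm.dx r Q))
        = if r = p then c * osc Φ n (Sm.dx r Q) else 0 := by
      intro r
      have h3 : ∑ l, c * Φ.inv l p * (Φ.grad r l * osc Φ n (Sm.dx r Q))
          = c * (∑ l, Φ.grad r l * Φ.inv l p) * osc Φ n (Sm.dx r Q) := by
        rw [Finset.mul_sum, Finset.sum_mul]
        exact Finset.sum_congr rfl fun l _ => by ring
      rw [h3, Φ.grad_mul_inv]
      split_ifs <;> simp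
    simp only [dx_osc, mul_smul_comm, Finset.mul_sum, ← Finset.smul_sum]
    rw [Finset.sum_comm]
    simp only [h2]
    simp
  rw [← smul_sub, h1, add_sub_cancel_left, smul_smul, inv_mul_cancel₀ hn', one_smul]

end Osc

/-! ### Families of functions bounded by powers of the frequency -/

/-- The functions are of order `n ^ r`, uniformly on the time interval. -/
def SupBound (T r : ℝ) (f : ℕ → Sm) : Prop :=
  ∃ C : ℝ, ∀ n : ℕ, 1 ≤ n → ∀ t ∈ Icc 0 T, ∀ x, |f n t x| ≤ C * (n : ℝ) ^ r

/-- The functions are of order `n ^ r`, each of the first `N` space derivatives costing a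
factor `n`. -/
def OrderN (T : ℝ) : ℕ → ℝ → (ℕ → Sm) → Prop
  | 0, r, f => SupBound T r f
  | N + 1, r, f => SupBound T r f ∧ ∀ i, OrderN T N (r + 1) fun n => Sm.dx i (f n)

/-- The functions are of order `n ^ r`, each space derivative costing a factor `n`. -/
def Order (T r : ℝ) (f : ℕ → Sm) : Prop := ∀ N, OrderN T N r f

variable {T : ℝ}

theorem SupBound.add {r : ℝ} {f g : ℕ → Sm} (hf : SupBound T r f) (hg : SupBound T r g) :
    SupBound T r fun n => f n + g n := by
  obtain ⟨C, hC⟩ := hf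
  obtain ⟨C', hC'⟩ := hg
  refine ⟨C + C', fun n hn t ht x => ?_⟩
  rw [add_mul]
  exact (abs_add_le _ _).trans (add_le_add (hC n hn t ht x) (hC' n hn t ht x))

theorem SupBound.mul {r s : ℝ} {f g : ℕ → Sm} (hf : SupBound T r f) (hg : SupBound T s g) :
    SupBound T (r + s) fun n => f n * g n := by
  obtain ⟨C, hC⟩ := hf
  obtain ⟨C', hC'⟩ := hg
  refine ⟨C * C', fun n hn t ht x => ?_⟩
  have hn' : (0 : ℝ) < n := by positivity
  rw [Sm.mul_apply, abs_mul, Real.rpow_add hn', mul_mul_mul_comm]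
  exact mul_le_mul (hC n hn t ht x) (hC' n hn t ht x) (abs_nonneg _)
    ((abs_nonneg _).trans (hC n hn t ht x))

theorem SupBound.mono {r s : ℝ} {f : ℕ → Sm} (hf : SupBound T r f) (h : r ≤ s) :
    SupBound T s f := by
  obtain ⟨C, hC⟩ := hf
  refine ⟨|C|, fun n hn t ht x => (hC n hn t ht x).trans ?_⟩
  exact mul_le_mul (le_abs_self C) (Real.rpow_le_rpow_of_exponent_le (by exact_mod_cast hn) h)
    (by positivity) (abs_nonneg C)

theorem SupBound.rpow_smul {r : ℝ} {f : ℕ → Sm} (hf : SupBound T r f) (s : ℝ) :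
    SupBound T (r + s) fun n => ((n : ℝ) ^ s) • f n := by
  obtain ⟨C, hC⟩ := hf
  refine ⟨C, fun n hn t ht x => ?_⟩
  have hn' : (0 : ℝ) < n := by positivity
  rw [Sm.smul_apply, abs_mul, abs_of_nonneg (by positivity), Real.rpow_add hn', mul_comm,
    ← mul_assoc]
  exact mul_le_mul_of_nonneg_right (hC n hn t ht x) (by positivity)

theorem supBound_const (c : Sm) : SupBound T 0 fun _ => c := by
  obtain ⟨C, -, hC⟩ := c.exists_bound_of_isCompact (isCompact_Icc (a := 0) (b := T))
  exact ⟨C, fun n _ t ht x => by simpa using hC t ht x⟩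

theorem OrderN.of_succ {N : ℕ} {r : ℝ} {f : ℕ → Sm} (hf : OrderN T (N + 1) r f) :
    OrderN T N r f := by
  induction N generalizing r f with
  | zero => exact hf.1
  | succ N ih => exact ⟨hf.1, fun i => ih (hf.2 i)⟩

theorem OrderN.add {N : ℕ} {r : ℝ} {f g : ℕ → Sm} (hf : OrderN T N r f) (hg : OrderN T N r g) :
    OrderN T N r fun n => f n + g n := by
  induction N generalizing r f g with
  | zero => exact SupBound.add hf hg
  | succ N ih =>
    refine ⟨hf.1.add hg.1, fun i => ?_⟩
    simp only [map_add]
    exact ih (hf.2 i) (hg.2 i)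

theorem OrderN.mono {N : ℕ} {r s : ℝ} {f : ℕ → Sm} (hf : OrderN T N r f) (h : r ≤ s) :
    OrderN T N s f := by
  induction N generalizing r s f with
  | zero => exact SupBound.mono hf h
  | succ N ih => exact ⟨hf.1.mono h, fun i => ih (hf.2 i) (by linarith)⟩

theorem OrderN.mul {N : ℕ} {r s : ℝ} {f g : ℕ → Sm} (hf : OrderN T N r f) (hg : OrderN T N s g) :
    OrderN T N (r + s) fun n => f n * g n := by
  induction N generalizing r s f g with
  | zero => exact SupBound.mul hf hg
  | succ N ih =>
    refine ⟨hf.1.mul hg.1, fun i => ?_⟩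
    simp only [Sm.dx_mul]
    exact ((ih (hf.2 i) hg.of_succ).mono (by linarith)).add
      ((ih hf.of_succ (hg.2 i)).mono (by linarith))

theorem OrderN.rpow_smul {N : ℕ} {r : ℝ} {f : ℕ → Sm} (hf : OrderN T N r f) (s : ℝ) :
    OrderN T N (r + s) fun n => ((n : ℝ) ^ s) • f n := by
  induction N generalizing r f with
  | zero => exact SupBound.rpow_smul hf s
  | succ N ih =>
    refine ⟨hf.1.rpow_smul s, fun i => ?_⟩
    simp only [Derivation.map_smul]
    exact (ih (hf.2 i)).mono (by linarith)

namespace Order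

variable {r s : ℝ} {f g : ℕ → Sm}

theorem supBound (hf : Order T r f) : SupBound T r f := hf 0

theorem dx (hf : Order T r f) (i : Fin 3) : Order T (r + 1) fun n => Sm.dx i (f n) :=
  fun N => (hf (N + 1)).2 i

theorem add (hf : Order T r f) (hg : Order T r g) : Order T r fun n => f n + g n :=
  fun N => (hf N).add (hg N)

theorem mul (hf : Order T r f) (hg : Order T s g) : Order T (r + s) fun n => f n * g n :=
  fun N => (hf N).mul (hg N)

theorem mono (hf : Order T r f) (h : r ≤ s) : Order T s f := fun N => (hf N).mono h

theorem rpow_smul (hf : Order T r f) (s : ℝ) : Order T (r + s) fun n => ((n : ℝ) ^ s) • f n :=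
  fun N => (hf N).rpow_smul s

theorem const (c : Sm) : Order T 0 fun _ => c := by
  intro N
  induction N generalizing c with
  | zero => exact supBound_const c
  | succ N ih => exact ⟨supBound_const c, fun i => (ih (Sm.dx i c)).mono (by norm_num)⟩

theorem const_mul (c : Sm) (hf : Order T r f) : Order T r fun n => c * f n :=
  ((const c).mul hf).mono (by simp)

theorem smul (c : ℝ) (hf : Order T r f) : Order T r fun n => c • f n := by
  have := const_mul (algebraMap ℝ Sm c) hf
  simpa only [← Algebra.smul_def] using this

theorem neg (hf : Order T r f) : Order T r fun n => -f n := by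
  simpa using hf.smul (-1)

theorem sub (hf : Order T r f) (hg : Order T r g) : Order T r fun n => f n - g n := by
  simpa [sub_eq_add_neg] using hf.add hg.neg

theorem zero : Order T r fun _ => 0 := by
  intro N
  induction N generalizing r with
  | zero => exact ⟨0, fun n _ t _ x => by simp⟩
  | succ N ih => exact ⟨⟨0, fun n _ t _ x => by simp⟩, fun i => by simpa using ih⟩

theorem sum {ι : Type*} (A : Finset ι) {f : ι → ℕ → Sm} (h : ∀ i ∈ A, Order T r (f i)) :
    Order T r fun n => ∑ i ∈ A, f i n := by
  classical
  induction A using Finset.induction_on with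
  | empty => simpa using zero
  | insert a A ha ih =>
    simp only [Finset.sum_insert ha]
    exact (h a (Finset.mem_insert_self a A)).add (ih fun i hi => h i (Finset.mem_insert_of_mem hi))

theorem inv_pow_smul (hf : Order T r f) (e : ℕ) : Order T (r - e) fun n => ((n : ℝ) ^ e)⁻¹ • f n := by
  have := hf.rpow_smul (-(e : ℝ))
  simp only [Real.rpow_neg (Nat.cast_nonneg _), Real.rpow_natCast] at this
  exact this.mono (by linarith)

/-- Operators commuting with derivatives preserve orders if they do so for the suprema. -/
theorem map_of_commute {L : Sm → Sm} {ρ : ℝ} (hL : ∀ i f, Sm.dx i (L f) = L (Sm.dx i f))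
    (hb : ∀ (r : ℝ) (f : ℕ → Sm), Order T r f → SupBound T (r + ρ) fun n => L (f n))
    (hf : Order T r f) : Order T (r + ρ) fun n => L (f n) := by
  intro N
  induction N generalizing r f with
  | zero => exact hb r f hf
  | succ N ih =>
    refine ⟨hb r f hf, fun i => ?_⟩
    simp only [hL]
    have := ih (hf.dx i)
    rwa [add_right_comm] at this

theorem osc {v : Fin 3 → Sm} (Φ : TransportMap v) (q : Sm) : Order T 0 fun n => osc Φ n q := by
  have hs : ∀ q : Sm, SupBound T 0 fun n => HypoNS.osc Φ n q := by
    intro q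
    obtain ⟨C, -, hC⟩ := q.exists_bound_of_isCompact (isCompact_Icc (a := 0) (b := T))
    exact ⟨C, fun n _ t ht x => by rw [Real.rpow_zero, mul_one]; exact hC t ht _⟩
  intro N
  induction N generalizing q with
  | zero => exact hs q
  | succ N ih =>
    refine ⟨hs q, fun i => ?_⟩
    simp only [dx_osc, Fin.sum_univ_three]
    have h1 : ∀ l, OrderN T N 0 fun n => Φ.grad l i * HypoNS.osc Φ n (Sm.dx l q) := fun l => by
      simpa using (const (T := T) (Φ.grad l i) N).mul (ih (Sm.dx l q))
    have h2 := (((h1 0).add (h1 1)).add (h1 2)).rpow_smul 1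
    simpa only [Real.rpow_one] using h2

end Order

/-! ### The class of oscillating functions of mean zero -/

/-- Finite sums of terms `n ^ (-e) c osc n q` with `e ≥ s` and `q` of mean zero. -/
inductive OscClass {v : Fin 3 → Sm} (Φ : TransportMap v) (s : ℕ) : (ℕ → Sm) → Prop
  | zero : OscClass Φ s fun _ => 0
  | add {f g : ℕ → Sm} : OscClass Φ s f → OscClass Φ s g → OscClass Φ s fun n => f n + g n
  | term (e : ℕ) (c q : Sm) : s ≤ e → proj 0 q = 0 →
      OscClass Φ s fun n => ((n : ℝ) ^ e)⁻¹ • (c * osc Φ n q)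

namespace OscClass

variable {v : Fin 3 → Sm} {Φ : TransportMap v} {s : ℕ} {f g : ℕ → Sm}

theorem sum {ι : Type*} (A : Finset ι) {f : ι → ℕ → Sm} (h : ∀ i ∈ A, OscClass Φ s (f i)) :
    OscClass Φ s fun n => ∑ i ∈ A, f i n := by
  classical
  induction A using Finset.induction_on with
  | empty => simpa using zero
  | insert a A ha ih =>
    simp only [Finset.sum_insert ha]
    exact (h a (Finset.mem_insert_self a A)).add (ih fun i hi => h i (Finset.mem_insert_of_mem hi))

theorem const_mul (hf : OscClass Φ s f) (b : Sm) : OscClass Φ s fun n => b * f n := by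
  induction hf with
  | zero => simpa using zero
  | add _ _ h1 h2 => simpa only [mul_add] using h1.add h2
  | term e c q he hq =>
    have := OscClass.term (Φ := Φ) e (b * c) q he hq
    simpa only [mul_smul_comm, mul_assoc] using this

theorem neg (hf : OscClass Φ s f) : OscClass Φ s fun n => -f n := by
  simpa using hf.const_mul (-1)

theorem order (hf : OscClass Φ s f) : Order T (-(s : ℝ)) f := by
  induction hf with
  | zero => exact Order.zero
  | add _ _ h1 h2 => exact h1.add h2
  | term e c q he hq =>
    refine (((Order.osc Φ q).const_mul c).inv_pow_smul e).mono ?_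
    have : (s : ℝ) ≤ e := by exact_mod_cast he
    linarith

end OscClass

theorem exists_lap_eq {q : Sm} (hq : proj 0 q = 0) : ∃ P : Sm, lap P = q ∧ proj 0 P = 0 := by
  refine ⟨invLap q - proj 0 (invLap q), ?_, ?_⟩
  · have h : lap (invLap q - proj 0 (invLap q)) = lap (invLap q) := by
      simp only [lap, map_sub, dx_proj_zero, sub_zero]
    rw [h, lap_invLap, hq, sub_zero]
  · have h : proj 0 (invLap q - proj 0 (invLap q)) = proj 0 (invLap q) - proj 0 (proj 0 (invLap q)) :=
      map_sub (projL 0) _ _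
    rw [h, proj_zero_proj_zero, sub_self]

/-- Write the profile as `q = ΔP` and apply `mul_osc_dx` twice. Two derivatives are extracted,
rather than one, because a symmetric antidivergence can be assembled from second potentials by
differentiation alone, without a nonlocal operator. -/
theorem exists_double_divergence {v : Fin 3 → Sm} {Φ : TransportMap v} {s : ℕ} {f : ℕ → Sm}
    (hf : OscClass Φ s f) :
    ∃ (H : Fin 3 → Fin 3 → ℕ → Sm) (f' : ℕ → Sm), (∀ l m, H l m = H m l) ∧
      (∀ l m, Order T (-(s : ℝ) - 2) (H l m)) ∧ OscClass Φ (s + 1) f' ∧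
      ∀ n, 1 ≤ n → f n = ∑ l, ∑ m, Sm.dx l (Sm.dx m (H l m n)) + f' n := by
  induction hf with
  | zero => exact ⟨fun _ _ _ => 0, fun _ => 0, fun _ _ => rfl, fun _ _ => Order.zero, .zero,
      fun n _ => by simp⟩
  | add _ _ h1 h2 =>
    obtain ⟨H, f', hs, hb, hc, he⟩ := h1
    obtain ⟨K, g', ks, kb, kc, ke⟩ := h2
    refine ⟨fun l m n => H l m n + K l m n, fun n => f' n + g' n, fun l m => by simp only [hs l m, ks l m],
      fun l m => (hb l m).add (kb l m), hc.add kc, fun n hn => ?_⟩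
    beta_reduce
    rw [he n hn, ke n hn]
    simp only [map_add, Finset.sum_add_distrib]
    ring
  | term e c q he hq =>
    obtain ⟨P, hP, hP0⟩ := exists_lap_eq hq
    set X : Fin 3 → Sm := fun l => ∑ p, ∑ m, Sm.dx m (c * Φ.inv l p * Φ.inv m p) with hX
    set Y : Fin 3 → Sm := fun p => ∑ l, Sm.dx l (c * Φ.inv l p) with hY
    refine ⟨fun l m n => ((n : ℝ) ^ (e + 2))⁻¹ • ((∑ p, c * Φ.inv l p * Φ.inv m p) * osc Φ n P),
      fun n => -(((n : ℝ) ^ (e + 2))⁻¹ • ((∑ l, Sm.dx l (X l)) * osc Φ n P)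
        + ∑ r, ((n : ℝ) ^ (e + 1))⁻¹ • ((∑ l, X l * Φ.grad r l) * osc Φ n (Sm.dx r P))
        + ∑ p, ((n : ℝ) ^ (e + 1))⁻¹ • (Y p * osc Φ n (Sm.dx p P))), fun l m => ?_, fun l m => ?_,
      ?_, fun n hn => ?_⟩
    · funext n
      simp only [mul_right_comm c]
    · refine (((Order.osc Φ P).const_mul _).inv_pow_smul (e + 2)).mono ?_
      have : (s : ℝ) ≤ e := by exact_mod_cast he
      push_cast
      linarith
    · refine OscClass.neg (.add (.add (.term _ _ _ (by omega) hP0) ?_) ?_)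
      · exact OscClass.sum _ fun r _ => .term _ _ _ (by omega) (proj_zero_dx r P)
      · exact OscClass.sum _ fun r _ => .term _ _ _ (by omega) (proj_zero_dx r P)
    · have hn' : (n : ℝ) ≠ 0 := by positivity
      have h1 : ∀ l p, c * Φ.inv l p * osc Φ n (Sm.dx p P)
          = (n : ℝ)⁻¹ • ∑ m, Sm.dx m (c * Φ.inv l p * Φ.inv m p * osc Φ n P)
            - (n : ℝ)⁻¹ • ∑ m, Sm.dx m (c * Φ.inv l p * Φ.inv m p) * osc Φ n P :=
        fun l p => mul_osc_dx Φ (c * Φ.inv l p) P p n hn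
      have h2 : ∀ p, c * osc Φ n (Sm.dx p (Sm.dx p P))
          = (n : ℝ)⁻¹ • ∑ l, Sm.dx l (c * Φ.inv l p * osc Φ n (Sm.dx p P))
            - (n : ℝ)⁻¹ • ∑ l, Sm.dx l (c * Φ.inv l p) * osc Φ n (Sm.dx p P) :=
        fun p => mul_osc_dx Φ c (Sm.dx p P) p n hn
      have h3 : ∀ l, Sm.dx l (X l * osc Φ n P) = Sm.dx l (X l) * osc Φ n P
          + (n : ℝ) • ∑ r, X l * Φ.grad r l * osc Φ n (Sm.dx r P) := by
        intro l
        rw [Sm.dx_mul, dx_osc, mul_smul_comm, Finset.mul_sum]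
        simp only [mul_assoc]
      have h4 : c * osc Φ n q = ((n : ℝ) ^ 2)⁻¹ • ∑ l, ∑ m,
            Sm.dx l (Sm.dx m ((∑ p, c * Φ.inv l p * Φ.inv m p) * osc Φ n P))
          - ((n : ℝ) ^ 2)⁻¹ • ∑ l, Sm.dx l (X l * osc Φ n P)
          - (n : ℝ)⁻¹ • ∑ p, Y p * osc Φ n (Sm.dx p P) := by
        rw [← hP, lap, osc_sum, Finset.mul_sum]
        simp only [h2, h1]
        simp only [hX, hY, Fin.sum_univ_three, map_add, map_sub, Derivation.map_smul, add_mul]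
        module
      beta_reduce
      rw [h4]
      simp only [h3]
      have e2 : ((n : ℝ) ^ (e + 2))⁻¹ = ((n : ℝ) ^ e)⁻¹ * ((n : ℝ) ^ 2)⁻¹ := by
        rw [pow_add, mul_inv]
      have e1 : ((n : ℝ) ^ (e + 1))⁻¹ = ((n : ℝ) ^ e)⁻¹ * (n : ℝ)⁻¹ := by
        rw [pow_succ, mul_inv]
      have e0 : ((n : ℝ) ^ 2)⁻¹ * n = (n : ℝ)⁻¹ := by field_simp
      simp only [e2, e1, Derivation.map_smul, ← Finset.smul_sum, smul_sub, Finset.sum_add_distrib,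
        smul_add, smul_smul, mul_assoc, e0, Finset.sum_mul]
      rw [Finset.sum_comm (f := fun l r => X l * (Φ.grad r l * osc Φ n (Sm.dx r P)))]
      abel

/-- Oscillating vector fields are, up to an oscillating field of lower order, divergences of
small symmetric matrices. -/
theorem exists_antidivergence {v : Fin 3 → Sm} {Φ : TransportMap v} {s : ℕ} (m : ℕ)
    {F : Fin 3 → ℕ → Sm} (hF : ∀ i, OscClass Φ s (F i)) :
    ∃ (M : Fin 3 → Fin 3 → ℕ → Sm) (G : Fin 3 → ℕ → Sm), (∀ i j, M i j = M j i) ∧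
      (∀ i j, Order T (-(s : ℝ) - 1) (M i j)) ∧ (∀ i, OscClass Φ (s + m) (G i)) ∧
      ∀ i n, 1 ≤ n → F i n = ∑ j, Sm.dx j (M i j n) + G i n := by
  induction m generalizing s F with
  | zero => exact ⟨fun _ _ _ => 0, F, fun _ _ => rfl, fun _ _ => Order.zero, hF, fun i n _ => by simp⟩
  | succ m ih =>
    choose H F' hs hb hc he using fun i => exists_double_divergence (T := T) (hF i)
    obtain ⟨M, G, hM, hMb, hG, hMG⟩ := ih hc
    -- The matrix is symmetric because each `H i` is. In its divergence the last two terms cancel by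
    -- exchanging the summation indices, leaving the double divergence of `H i`.
    refine ⟨fun i j n => ∑ l, Sm.dx l (H i l j n + H j l i n - H l i j n) + M i j n, G,
      fun i j => ?_, fun i j => ?_, fun i => ?_, fun i n hn => ?_⟩
    · funext n
      beta_reduce
      rw [hM i j]
      congr 1
      refine Finset.sum_congr rfl fun l _ => ?_
      rw [hs l i j, add_comm (H i l j n)]
    · refine (Order.sum _ fun l _ => ?_).add ((hMb i j).mono (by push_cast; linarith))
      exact ((((hb i l j).add (hb j l i)).sub (hb l i j)).dx l).mono (by linarith)
    · have := hG i
      rwa [show s + 1 + m = s + (m + 1) by ring] at this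
    · rw [he i n hn, hMG i n hn]
      have e1 : ∀ i j l, H i j l n = H i l j n := fun i j l => congrFun (hs i j l) n
      simp only [map_add, map_sub, map_sum, Finset.sum_add_distrib, Finset.sum_sub_distrib]
      have e2 : ∑ j, ∑ l, Sm.dx j (Sm.dx l (H i l j n))
          = ∑ l, ∑ m, Sm.dx l (Sm.dx m (H i l m n)) :=
        Finset.sum_congr rfl fun j _ => Finset.sum_congr rfl fun l _ => by rw [e1]
      have e3 : ∑ j, ∑ l, Sm.dx j (Sm.dx l (H j l i n))
          = ∑ j, ∑ l, Sm.dx j (Sm.dx l (H l i j n)) := by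
        rw [Finset.sum_comm]
        refine Finset.sum_congr rfl fun j _ => Finset.sum_congr rfl fun l _ => ?_
        rw [Sm.dx_comm, e1]
      rw [e2, e3]
      abel

end Oscillation

/-! ### Multipliers and orders -/

section Orders

variable {T r : ℝ} {f : ℕ → Sm}

theorem Order.oneSubLap (hf : Order T r f) : Order T (r + 2) fun n => oneSubLap (f n) := by
  refine (hf.mono (by linarith)).sub (Order.sum _ fun i _ => ?_)
  exact ((hf.dx i).dx i).mono (by linarith)

theorem Order.mult (σ : Symb) (hf : Order T r f) : Order T (r + 8) fun n => mult σ (f n) := by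
  refine hf.map_of_commute (L := HypoNS.mult σ) (fun i f => dx_mult σ i f) fun r f hf => ?_
  obtain ⟨A, -, hA⟩ := exists_mult_bound σ
  obtain ⟨C, hC⟩ := (hf.oneSubLap.oneSubLap.oneSubLap.oneSubLap).supBound
  refine ⟨A * C, fun n hn t ht x => (hA (f n) t _ (fun y => hC n hn t ht y) x).trans (le_of_eq ?_)⟩
  rw [mul_assoc, show r + 2 + 2 + 2 + 2 = r + 8 by ring]

/-- The bounds on the function and its second derivatives have the ratio `n²` required by
`exists_fracMult_bound`. -/
theorem Order.fracMult {s : ℝ} (h0 : 0 < s) (h1 : s < 1) (hf : Order T r f) :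
    Order T (r + 2 * s) fun n => HypoNS.mult (fracSymb s h0.le h1.le) (f n) := by
  refine hf.map_of_commute (L := HypoNS.mult (fracSymb s h0.le h1.le)) (fun i f => dx_mult _ i f)
    fun r f hf => ?_
  obtain ⟨A, -, hA⟩ := exists_fracMult_bound h0 h1
  obtain ⟨C, hC⟩ := hf.supBound
  choose C₂ hC₂ using fun i j => ((hf.dx j).dx i).supBound
  have hle : ∀ i j, C₂ i j ≤ |C| + ∑ i, ∑ j, |C₂ i j| := fun i j =>
    (le_abs_self _).trans (((Finset.single_le_sum (f := fun j => |C₂ i j|)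
      (fun j _ => abs_nonneg _) (Finset.mem_univ j)).trans (Finset.single_le_sum
        (f := fun i => ∑ j, |C₂ i j|) (fun i _ => Finset.sum_nonneg fun j _ => abs_nonneg _)
        (Finset.mem_univ i))).trans (le_add_of_nonneg_left (abs_nonneg C)))
  have hle' : C ≤ |C| + ∑ i, ∑ j, |C₂ i j| := (le_abs_self C).trans
    (le_add_of_nonneg_right (Finset.sum_nonneg fun i _ => Finset.sum_nonneg fun j _ => abs_nonneg _))
  set B := |C| + ∑ i, ∑ j, |C₂ i j|
  refine ⟨A * B, fun n hn t ht x => ?_⟩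
  have hn' : (0 : ℝ) < n := by positivity
  have key := hA (f n) t (B * (n : ℝ) ^ r) n hn'
    (fun y => (hC n hn t ht y).trans (mul_le_mul_of_nonneg_right hle' (by positivity)))
    (fun i j y => (hC₂ i j n hn t ht y).trans ?_) x
  · refine key.trans (le_of_eq ?_)
    rw [Real.rpow_add hn']
    ring
  · rw [mul_assoc, ← Real.rpow_natCast, ← Real.rpow_add hn',
      show r + 1 + 1 = r + ((2 : ℕ) : ℝ) by push_cast; ring]
    exact mul_le_mul_of_nonneg_right (hle i j) (by positivity)

theorem SupBound.proj_zero (hf : SupBound T r f) : SupBound T r fun n => proj 0 (f n) := by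
  obtain ⟨C, hC⟩ := hf
  exact ⟨C, fun n hn t ht x => abs_proj_le 0 (f n) t _ (fun y => hC n hn t ht y) x⟩

theorem proj_zero_sum {κ : Type*} (s : Finset κ) (f : κ → Sm) :
    proj 0 (∑ i ∈ s, f i) = ∑ i ∈ s, proj 0 (f i) := map_sum (projL 0) f s

/-- Divergences have mean zero, so one extraction of a double divergence gains a power of `n` for
the mean. -/
theorem OscClass.proj_zero {v : Fin 3 → Sm} {Φ : TransportMap v} {s : ℕ}
    (hf : OscClass Φ s f) : SupBound T (-(s : ℝ) - 1) fun n => proj 0 (f n) := by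
  obtain ⟨H, f', -, -, hc, he⟩ := exists_double_divergence (T := T) hf
  obtain ⟨C, hC⟩ := (hc.order (T := T)).supBound.proj_zero
  refine ⟨C, fun n hn t ht x => ?_⟩
  have h : proj 0 (f n) = proj 0 (f' n) := by
    rw [he n hn, proj_add]
    simp [proj_zero_sum, proj_zero_dx]
  beta_reduce
  rw [h]
  refine (hC n hn t ht x).trans (le_of_eq ?_)
  push_cast
  ring_nf

end Orders

/-! ### The perturbation -/

section Perturbation

variable {v : Fin 3 → Sm} (Φ : TransportMap v)

/-- The gradient of the linear function `k · Φ`. -/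
def conormal (k : Fin 3 → ℝ) (i : Fin 3) : Sm := ∑ p, k p • Φ.grad p i

/-- The determinant of the gradient of the transported coordinates. -/
def gradDet : Sm := (Matrix.of Φ.grad).det

variable {ι : Type} {f : ι → Fin 3 → ℤ} (P : PipeFamily f)

/-- The direction of the pipe in Eulerian coordinates. -/
def tangent (J : ι) (i : Fin 3) : Sm :=
  conormal Φ (P.k J) (i + 1) * conormal Φ (P.l J) (i + 2)
    - conormal Φ (P.k J) (i + 2) * conormal Φ (P.l J) (i + 1)

/-- The cofactor identity: a vector product of pulled-back covectors is, up to the determinant, the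
pull-back of their vector product. The pipes are therefore images of straight lines under the
inverse of `Φ`. -/
theorem grad_mul_tangent (J : ι) (q : Fin 3) :
    ∑ j, Φ.grad q j * tangent Φ P J j = (P.r J * f J q) • gradDet Φ := by
  ext t x
  have h := P.cross J q
  have hd : gradDet Φ t x = Φ.grad 0 0 t x * Φ.grad 1 1 t x * Φ.grad 2 2 t x
      - Φ.grad 0 0 t x * Φ.grad 1 2 t x * Φ.grad 2 1 t x
      - Φ.grad 0 1 t x * Φ.grad 1 0 t x * Φ.grad 2 2 t x
      + Φ.grad 0 1 t x * Φ.grad 1 2 t x * Φ.grad 2 0 t x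
      + Φ.grad 0 2 t x * Φ.grad 1 0 t x * Φ.grad 2 1 t x
      - Φ.grad 0 2 t x * Φ.grad 1 1 t x * Φ.grad 2 0 t x := by
    simp [gradDet, Matrix.det_fin_three]
  rw [Sm.smul_apply, ← h, hd]
  fin_cases q <;>
  · simp [tangent, conormal, Fin.sum_univ_three]
    ring

theorem dx_osc_potential (J : ι) (n : ℕ) (p : Fin 3) :
    Sm.dx p (osc Φ n (P.G J)) = (n : ℝ) • (conormal Φ (P.k J) p * osc Φ n (P.g J)
      + conormal Φ (P.l J) p * osc Φ n (P.g₂ J)) := by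
  rw [dx_osc]
  simp only [P.dx_G, osc_add, osc_smul, conormal, Fin.sum_univ_three]
  congr 1
  simp only [Algebra.smul_def]
  ring

/-- In Lagrangian coordinates the tangent is a multiple of the direction along which the profile is
constant. -/
theorem tangent_transport (J : ι) (n : ℕ) :
    ∑ j, tangent Φ P J j * Sm.dx j (osc Φ n (P.g J * P.g J)) = 0 := by
  have h1 : ∑ j, tangent Φ P J j * Sm.dx j (osc Φ n (P.g J * P.g J))
      = (n : ℝ) • ∑ q, (∑ j, Φ.grad q j * tangent Φ P J j)
        * osc Φ n (Sm.dx q (P.g J * P.g J)) := by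
    simp only [dx_osc, Fin.sum_univ_three, Algebra.smul_def]
    ring
  have h2 : ∑ q, (f J q : ℝ) • osc Φ n (Sm.dx q (P.g J * P.g J)) = 0 := by
    have h3 : ∑ q, (f J q : ℝ) • Sm.dx q (P.g J * P.g J) = 0 := by
      have : ∑ q, (f J q : ℝ) • Sm.dx q (P.g J * P.g J)
          = (2 * P.g J) * ∑ q, (f J q : ℝ) • Sm.dx q (P.g J) := by
        simp only [Sm.dx_mul, Fin.sum_univ_three, Algebra.smul_def]
        ring
      rw [this, P.dx_g, mul_zero]
    have := congrArg (osc Φ n) h3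
    simpa only [osc_sum, osc_smul, osc_zero] using this
  rw [h1]
  simp only [grad_mul_tangent]
  have h4 : ∑ q, (P.r J * f J q) • gradDet Φ * osc Φ n (Sm.dx q (P.g J * P.g J))
      = P.r J • (gradDet Φ * ∑ q, (f J q : ℝ) • osc Φ n (Sm.dx q (P.g J * P.g J))) := by
    simp only [Fin.sum_univ_three, Algebra.smul_def, map_mul]
    ring
  rw [h4, h2, mul_zero, smul_zero, smul_zero]

theorem proj_zero_pipe_sq (J : ι) : proj 0 (P.g J * P.g J - algebraMap ℝ Sm (P.ms J)) = 0 := by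
  have h : proj 0 (P.g J * P.g J - algebraMap ℝ Sm (P.ms J))
      = proj 0 (P.g J * P.g J) - proj 0 (algebraMap ℝ Sm (P.ms J)) := map_sub (projL 0) _ _
  rw [h, P.mean_sq, proj_zero_const, sub_self]

variable [Fintype ι] (a : ι → Sm)

/-- The vector potential of the perturbation. -/
def potential (i : Fin 3) (n : ℕ) : Sm :=
  ∑ J, a J * conormal Φ (P.l J) i * osc Φ n (P.G J)

/-- The principal part of the perturbation. -/
def principal (i : Fin 3) (n : ℕ) : Sm := ∑ J, a J * tangent Φ P J i * osc Φ n (P.g J)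

/-- The amplitude of the corrector. -/
def curlAmp (J : ι) (i : Fin 3) : Sm :=
  Sm.dx (i + 1) (a J * conormal Φ (P.l J) (i + 2))
    - Sm.dx (i + 2) (a J * conormal Φ (P.l J) (i + 1))

/-- The corrector which makes the perturbation divergence free. -/
def corrector (i : Fin 3) (n : ℕ) : Sm := ∑ J, curlAmp Φ P a J i * osc Φ n (P.G J)

/-- The velocity perturbation. -/
def perturb (i : Fin 3) (n : ℕ) : Sm := principal Φ P a i n + (n : ℝ)⁻¹ • corrector Φ P a i n

/-- The mean of the principal part of the stress of the perturbation. -/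
def meanStress (i j : Fin 3) : Sm :=
  ∑ J, P.ms J • (a J * a J * (tangent Φ P J i * tangent Φ P J j))

/-- The oscillation of the principal part of the stress of the perturbation. -/
def oscStress (i j : Fin 3) (n : ℕ) : Sm :=
  ∑ J, a J * a J * (tangent Φ P J i * tangent Φ P J j)
    * osc Φ n (P.g J * P.g J - algebraMap ℝ Sm (P.ms J))

/-- The part of the stress of the perturbation due to the corrector. -/
def correctorStress (i j : Fin 3) (n : ℕ) : Sm :=
  (n : ℝ)⁻¹ • (principal Φ P a i n * corrector Φ P a j n
    + corrector Φ P a i n * principal Φ P a j n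
    + (n : ℝ)⁻¹ • (corrector Φ P a i n * corrector Φ P a j n))

/-- The `g₂` part of the gradient of the potential is parallel to the conormal multiplying it and
disappears in the vector product. -/
theorem perturb_eq_curl (i : Fin 3) (n : ℕ) (hn : 1 ≤ n) :
    perturb Φ P a i n = (n : ℝ)⁻¹ • (Sm.dx (i + 1) (potential Φ P a (i + 2) n)
      - Sm.dx (i + 2) (potential Φ P a (i + 1) n)) := by
  have hn' : (n : ℝ) ≠ 0 := by positivity
  have h : Sm.dx (i + 1) (potential Φ P a (i + 2) n) - Sm.dx (i + 2) (potential Φ P a (i + 1) n)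
      = (n : ℝ) • principal Φ P a i n + corrector Φ P a i n := by
    simp only [potential, principal, corrector, map_sum, Finset.smul_sum,
      ← Finset.sum_sub_distrib, ← Finset.sum_add_distrib]
    refine Finset.sum_congr rfl fun J _ => ?_
    rw [Sm.dx_mul (i + 1) (a J * conormal Φ (P.l J) (i + 2)),
      Sm.dx_mul (i + 2) (a J * conormal Φ (P.l J) (i + 1)), dx_osc_potential, dx_osc_potential,
      curlAmp, tangent]
    simp only [Algebra.smul_def]
    ring
  rw [h, smul_add, smul_smul, inv_mul_cancel₀ hn', one_smul, perturb]

theorem div_perturb (n : ℕ) (hn : 1 ≤ n) : ∑ i, Sm.dx i (perturb Φ P a i n) = 0 := by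
  simp only [perturb_eq_curl Φ P a _ n hn, Derivation.map_smul, map_sub, Fin.sum_univ_three]
  rw [show (0 : Fin 3) + 1 = 1 by rfl, show (0 : Fin 3) + 2 = 2 by rfl, show (1 : Fin 3) + 1 = 2 by rfl,
    show (1 : Fin 3) + 2 = 0 by rfl, show (2 : Fin 3) + 1 = 0 by rfl, show (2 : Fin 3) + 2 = 1 by rfl,
    Sm.dx_comm 1 0, Sm.dx_comm 2 0, Sm.dx_comm 2 1]
  module

/-- Off-diagonal products vanish by disjointness of the pipes; on the diagonal the profile squared
is split into its mean and a part of mean zero. -/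
theorem principal_mul (i j : Fin 3) (n : ℕ) :
    principal Φ P a i n * principal Φ P a j n
      = oscStress Φ P a i j n + meanStress Φ P a i j := by
  classical
  rw [principal, principal, Finset.sum_mul_sum, oscStress, meanStress, ← Finset.sum_add_distrib]
  refine Finset.sum_congr rfl fun J _ => ?_
  rw [Finset.sum_eq_single J]
  · rw [osc_sub, osc_mul, osc_const, Algebra.smul_def]
    ring
  · intro J' _ hJ
    have h : osc Φ n (P.g J) * osc Φ n (P.g J') = 0 := by
      rw [← osc_mul, P.disjoint J J' hJ.symm, osc_zero]
    linear_combination (a J * tangent Φ P J i * (a J' * tangent Φ P J' j)) * h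
  · intro h
    exact absurd (Finset.mem_univ J) h

theorem perturb_mul (i j : Fin 3) (n : ℕ) :
    perturb Φ P a i n * perturb Φ P a j n
      = oscStress Φ P a i j n + meanStress Φ P a i j + correctorStress Φ P a i j n := by
  rw [← principal_mul, perturb, perturb, correctorStress]
  simp only [Algebra.smul_def]
  ring

theorem oscClass_principal (i : Fin 3) : OscClass Φ 0 (principal Φ P a i) := by
  refine OscClass.sum _ fun J _ => ?_
  simpa using OscClass.term (Φ := Φ) 0 (a J * tangent Φ P J i) (P.g J) le_rfl (P.mean_g J)

theorem oscClass_corrector (i : Fin 3) : OscClass Φ 1 fun n => (n : ℝ)⁻¹ • corrector Φ P a i n := by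
  simp only [corrector, Finset.smul_sum]
  refine OscClass.sum _ fun J _ => ?_
  simpa using OscClass.term (Φ := Φ) 1 (curlAmp Φ P a J i) (P.G J) le_rfl (P.mean_G J)

theorem OscClass.mono {s s' : ℕ} {g : ℕ → Sm} (h : OscClass Φ s g) (hs : s' ≤ s) :
    OscClass Φ s' g := by
  induction h with
  | zero => exact .zero
  | add _ _ h1 h2 => exact h1.add h2
  | term e c q he hq => exact .term e c q (hs.trans he) hq

theorem oscClass_perturb (i : Fin 3) : OscClass Φ 0 (perturb Φ P a i) :=
  (oscClass_principal Φ P a i).add ((oscClass_corrector Φ P a i).mono Φ (Nat.zero_le 1))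

theorem oscClass_oscStress (i j : Fin 3) : OscClass Φ 0 (oscStress Φ P a i j) := by
  refine OscClass.sum _ fun J _ => ?_
  simpa using OscClass.term (Φ := Φ) 0 (a J * a J * (tangent Φ P J i * tangent Φ P J j)) _ le_rfl
    (proj_zero_pipe_sq P J)

/-- Only the amplitudes are differentiated, so the divergence of the quadratic oscillation does not
grow with `n`. -/
theorem div_oscStress (i : Fin 3) (n : ℕ) :
    ∑ j, Sm.dx j (oscStress Φ P a i j n)
      = ∑ J, (∑ j, Sm.dx j (a J * a J * (tangent Φ P J i * tangent Φ P J j)))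
        * osc Φ n (P.g J * P.g J - algebraMap ℝ Sm (P.ms J)) := by
  simp only [oscStress, map_sum]
  rw [Finset.sum_comm]
  refine Finset.sum_congr rfl fun J _ => ?_
  have h1 : ∀ j, Sm.dx j (osc Φ n (P.g J * P.g J - algebraMap ℝ Sm (P.ms J)))
      = Sm.dx j (osc Φ n (P.g J * P.g J)) := fun j => by
    rw [osc_sub, osc_const, map_sub, Derivation.map_algebraMap, sub_zero]
  simp only [fun j => Sm.dx_mul j (a J * a J * (tangent Φ P J i * tangent Φ P J j)), h1]
  rw [Finset.sum_add_distrib, ← Finset.sum_mul]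
  have h2 : ∑ j, a J * a J * (tangent Φ P J i * tangent Φ P J j)
        * Sm.dx j (osc Φ n (P.g J * P.g J))
      = a J * a J * tangent Φ P J i
        * ∑ j, tangent Φ P J j * Sm.dx j (osc Φ n (P.g J * P.g J)) := by
    simp only [Fin.sum_univ_three]
    ring
  rw [h2, tangent_transport, mul_zero, add_zero]

theorem matD_perturb (i : Fin 3) (n : ℕ) :
    matD v (perturb Φ P a i n) = ∑ J, matD v (a J * tangent Φ P J i) * osc Φ n (P.g J)
      + (n : ℝ)⁻¹ • ∑ J, matD v (curlAmp Φ P a J i) * osc Φ n (P.G J) := by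
  simp only [perturb, principal, corrector, map_add, Derivation.map_smul, map_sum]
  simp only [fun J => matD_mul v (a J * tangent Φ P J i), fun J => matD_mul v (curlAmp Φ P a J i),
    matD_osc, P.dt_g, P.dt_G, osc_zero, mul_zero, add_zero]

theorem oscClass_matD_perturb (i : Fin 3) :
    OscClass Φ 0 fun n => matD v (perturb Φ P a i n) := by
  simp only [matD_perturb, Finset.smul_sum]
  refine (OscClass.sum _ fun J _ => ?_).add (OscClass.sum _ fun J _ => ?_)
  · simpa using OscClass.term (Φ := Φ) 0 (matD v (a J * tangent Φ P J i)) (P.g J) le_rfl (P.mean_g J)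
  · simpa using OscClass.term (Φ := Φ) 1 (matD v (curlAmp Φ P a J i)) (P.G J) (Nat.zero_le 1)
      (P.mean_G J)

/-- The fast part of the force exerted by the perturbation. -/
def force (i : Fin 3) (n : ℕ) : Sm :=
  Sm.dt (perturb Φ P a i n) + ∑ j, Sm.dx j (v i * perturb Φ P a j n + perturb Φ P a i n * v j)
    + ∑ j, Sm.dx j (oscStress Φ P a i j n)

theorem exists_oscClass_force (i : Fin 3) :
    ∃ F : ℕ → Sm, OscClass Φ 0 F ∧ ∀ n, 1 ≤ n → force Φ P a i n = F n := by
  refine ⟨fun n => matD v (perturb Φ P a i n)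
    + ((∑ j, Sm.dx j (v j)) * perturb Φ P a i n + ∑ j, Sm.dx j (v i) * perturb Φ P a j n)
    + ∑ j, Sm.dx j (oscStress Φ P a i j n), ?_, fun n hn => ?_⟩
  · refine ((oscClass_matD_perturb Φ P a i).add (((oscClass_perturb Φ P a i).const_mul _).add
      (OscClass.sum _ fun j _ => (oscClass_perturb Φ P a j).const_mul _))).add ?_
    simp only [div_oscStress]
    refine OscClass.sum _ fun J _ => ?_
    simpa using OscClass.term (Φ := Φ) 0
      (∑ j, Sm.dx j (a J * a J * (tangent Φ P J i * tangent Φ P J j))) _ le_rfl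
      (proj_zero_pipe_sq P J)
  · have h := div_perturb Φ P a n hn
    simp only [Fin.sum_univ_three] at h
    simp only [force, matD_apply, map_add, Sm.dx_mul, Fin.sum_univ_three]
    linear_combination (v i) * h

/-- A curl has mean zero; the remainders left by the antidivergence inherit this, as is needed to
invert the Laplacian. -/
theorem proj_zero_perturb (i : Fin 3) (n : ℕ) (hn : 1 ≤ n) : proj 0 (perturb Φ P a i n) = 0 := by
  have h : ∀ f g : Sm, proj 0 (f - g) = proj 0 f - proj 0 g := map_sub (projL 0)
  rw [perturb_eq_curl Φ P a i n hn, proj_smul, h, proj_zero_dx, proj_zero_dx, sub_zero, smul_zero]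

theorem proj_zero_force (i : Fin 3) (n : ℕ) (hn : 1 ≤ n) : proj 0 (force Φ P a i n) = 0 := by
  rw [force, proj_add, proj_add, ← dt_proj, proj_zero_perturb Φ P a i n hn]
  simp only [proj_zero_sum, proj_zero_dx, map_zero, Finset.sum_const_zero, add_zero]

variable {T : ℝ}

theorem order_perturb (i : Fin 3) : Order T 0 (perturb Φ P a i) := by
  simpa using (oscClass_perturb Φ P a i).order (T := T)

theorem order_potential (i : Fin 3) : Order T 0 (potential Φ P a i) :=
  Order.sum _ fun J _ => (Order.osc Φ (P.G J)).const_mul _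

theorem order_correctorStress (i j : Fin 3) : Order T (-1) (correctorStress Φ P a i j) := by
  have hp : ∀ i, Order T 0 (principal Φ P a i) := fun i => by
    simpa using (oscClass_principal Φ P a i).order (T := T)
  have hc : ∀ i, Order T 0 (corrector Φ P a i) := fun i =>
    Order.sum _ fun J _ => (Order.osc Φ (P.G J)).const_mul _
  have h1 : Order T 0 fun n => (n : ℝ)⁻¹ • (corrector Φ P a i n * corrector Φ P a j n) := by
    simpa using (((hc i).mul (hc j)).inv_pow_smul 1).mono (s := 0) (by norm_num)
  have h2 := (((((hp i).mul (hc j)).mono (s := 0) (by simp)).add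
    (((hc i).mul (hp j)).mono (s := 0) (by simp))).add h1).inv_pow_smul 1
  simp only [pow_one] at h2
  exact h2.mono (by norm_num)

theorem correctorStress_symm (i j : Fin 3) (n : ℕ) :
    correctorStress Φ P a i j n = correctorStress Φ P a j i n := by
  rw [correctorStress, correctorStress]
  simp only [Algebra.smul_def]
  ring

end Perturbation

/-! ### The stress and the energy balance of the perturbation. -/

section Stress

variable {v : Fin 3 → Sm} (Φ : TransportMap v) {ι : Type} [Fintype ι] {f : ι → Fin 3 → ℤ}
  (P : PipeFamily f) (a : ι → Sm) {T : ℝ}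

theorem proj_zero_remainder {F G : Sm} {M : Fin 3 → Sm} (hF : proj 0 F = 0)
    (h : F = ∑ j, Sm.dx j (M j) + G) : proj 0 G = 0 := by
  rw [h, proj_add, proj_zero_sum] at hF
  simpa only [proj_zero_dx, Finset.sum_const_zero, zero_add] using hF

/-- The force exerted by the perturbation is, up to the divergence of the mean stress and a
gradient, the divergence of a small symmetric stress. -/
theorem exists_small_stress {θ : ℝ} (h0 : 0 < θ) (h1 : θ < 1) :
    ∃ (M : Fin 3 → Fin 3 → ℕ → Sm) (π : ℕ → Sm), (∀ i j n, M i j n = M j i n) ∧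
      (∀ i j, Order T (2 * θ - 1) (M i j)) ∧
      ∀ i n, 1 ≤ n → Sm.dt (perturb Φ P a i n)
        + ∑ j, Sm.dx j (v i * perturb Φ P a j n + perturb Φ P a i n * v j
          + perturb Φ P a i n * perturb Φ P a j n)
        + mult (fracSymb θ h0.le h1.le) (perturb Φ P a i n)
        = ∑ j, Sm.dx j (meanStress Φ P a i j + M i j n) - Sm.dx i (π n) := by
  choose F hF hFe using exists_oscClass_force Φ P a
  -- Ten steps give remainders of order `-10`; the crude multiplier bound loses `8`, and one more
  -- derivative is spent in the symmetric gradient, leaving order `-1`.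
  obtain ⟨M₁, G₁, s₁, o₁, c₁, e₁⟩ := exists_antidivergence (T := T) 10 hF
  obtain ⟨M₂, G₂, s₂, o₂, c₂, e₂⟩ := exists_antidivergence (T := T) 10 (oscClass_perturb Φ P a)
  set L := mult (fracSymb θ h0.le h1.le) with hL
  set u : Fin 3 → ℕ → Sm := fun i n => invLap (G₁ i n) + L (invLap (G₂ i n)) with hu
  have hlap : ∀ i n, 1 ≤ n → lap (u i n) = G₁ i n + L (G₂ i n) := by
    intro i n hn
    have hadd : ∀ f g : Sm, lap (f + g) = lap f + lap g := fun f g => by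
      simp only [lap, map_add, Finset.sum_add_distrib]
    have p₁ : proj 0 (G₁ i n) = 0 := proj_zero_remainder (M := fun j => M₁ i j n)
      (by rw [← hFe i n hn]; exact proj_zero_force Φ P a i n hn) (e₁ i n hn)
    have p₂ : proj 0 (G₂ i n) = 0 := proj_zero_remainder (M := fun j => M₂ i j n)
      (proj_zero_perturb Φ P a i n hn) (e₂ i n hn)
    rw [hu]
    beta_reduce
    rw [hadd, hL, lap_mult, lap_invLap, lap_invLap, p₁, p₂, sub_zero, sub_zero]
  have hordu : ∀ i, Order T (-2 + 2 * θ) (u i) := by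
    intro i
    refine Order.add ?_ ?_
    · exact ((c₁ i).order.mult invLapSymb).mono (by push_cast; linarith)
    · exact (((c₂ i).order.mult invLapSymb).fracMult h0 h1).mono (by push_cast; linarith)
  -- The divergence of the symmetric gradient of `u` is `Δu + ∇ div u`: the first term restores the
  -- remainders, the second goes into the pressure.
  refine ⟨fun i j n => M₁ i j n + L (M₂ i j n) + correctorStress Φ P a i j n
      + (Sm.dx j (u i n) + Sm.dx i (u j n)), fun n => ∑ k, Sm.dx k (u k n), fun i j n => ?_,
      fun i j => ?_, fun i n hn => ?_⟩
  · beta_reduce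
    rw [s₁ i j, s₂ i j, correctorStress_symm, add_comm (Sm.dx j (u i n))]
  · refine ((Order.add ?_ ?_).add ?_).add (Order.add ?_ ?_)
    · exact (o₁ i j).mono (by push_cast; linarith)
    · exact ((o₂ i j).fracMult h0 h1).mono (by push_cast; linarith)
    · exact (order_correctorStress Φ P a i j).mono (by linarith)
    · exact ((hordu i).dx j).mono (by linarith)
    · exact ((hordu j).dx i).mono (by linarith)
  · have hforce := (hFe i n hn).trans (e₁ i n hn)
    have hw : L (perturb Φ P a i n) = ∑ j, Sm.dx j (L (M₂ i j n)) + L (G₂ i n) := by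
      rw [e₂ i n hn, map_add, map_sum]
      simp only [hL, dx_mult]
    have hl := hlap i n hn
    rw [hw]
    simp only [perturb_mul]
    simp only [force, lap, Fin.sum_univ_three, map_add] at hforce hl ⊢
    simp only [Sm.dx_comm i]
    linear_combination hforce - hl

/-- The difference of the energy densities, corrected by the mean stress. -/
def energyDefect (n : ℕ) : Sm :=
  ∑ i, ((2 * v i) * perturb Φ P a i n + (perturb Φ P a i n * perturb Φ P a i n
    - meanStress Φ P a i i))

/-- The linear term and the quadratic oscillation lie in the oscillating class, so their means are
of size `n⁻¹`; the corrector contributes the same size pointwise. -/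
theorem supBound_energyDefect : SupBound T (-1) fun n => proj 0 (energyDefect Φ P a n) := by
  have h : ∀ n, proj 0 (energyDefect Φ P a n) = proj 0 (∑ i, ((2 * v i) * perturb Φ P a i n
      + oscStress Φ P a i i n)) + proj 0 (∑ i, correctorStress Φ P a i i n) := by
    intro n
    rw [← proj_add, ← Finset.sum_add_distrib, energyDefect]
    congr 1
    refine Finset.sum_congr rfl fun i _ => ?_
    rw [perturb_mul]
    ring
  simp only [h]
  refine SupBound.add ?_ ?_
  · have := OscClass.proj_zero (T := T) (OscClass.sum Finset.univ fun i _ =>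
      ((oscClass_perturb Φ P a i).const_mul (2 * v i)).add (oscClass_oscStress Φ P a i i))
    simpa using this
  · exact (Order.sum Finset.univ fun i _ => order_correctorStress Φ P a i i).supBound.proj_zero

/-- Integration by parts in the transport term. The divergence of `v` is kept because the extension
of the velocity is divergence free only on the given time interval. -/
theorem proj_zero_dt (h : Sm) :
    proj 0 (Sm.dt h) = proj 0 (matD v h + (∑ j, Sm.dx j (v j)) * h) := by
  have h1 : matD v h + (∑ j, Sm.dx j (v j)) * h = Sm.dt h + ∑ j, Sm.dx j (v j * h) := by
    simp only [matD_apply, Sm.dx_mul, Fin.sum_univ_three]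
    ring
  rw [h1, proj_add, proj_zero_sum]
  simp only [proj_zero_dx, Finset.sum_const_zero, add_zero]

/-- The time derivative of `w` is of size `n`, but under the mean it may be replaced by the material
derivative, which is bounded. -/
theorem supBound_dt_energyDefect :
    SupBound T 0 fun n => Sm.dt (proj 0 (energyDefect Φ P a n)) := by
  simp only [dt_proj, proj_zero_dt (v := v)]
  refine SupBound.proj_zero ?_
  have hw := order_perturb Φ P a (T := T)
  have hd : ∀ i, Order T 0 fun n => matD v (perturb Φ P a i n) := fun i => by
    simpa using (oscClass_matD_perturb Φ P a i).order (T := T)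
  refine SupBound.add ?_ ?_
  · simp only [energyDefect, map_sum, map_add, map_sub, matD_mul v (2 * v _),
      matD_mul v (perturb Φ P a _ _)]
    refine (Order.sum _ fun i _ => ?_).supBound
    refine (((hw i).const_mul _).add ((hd i).const_mul _)).add ((Order.add ?_ ?_).sub ?_)
    · exact ((hd i).mul (hw i)).mono (by simp)
    · exact ((hw i).mul (hd i)).mono (by simp)
    · exact Order.const _
  · refine (Order.const_mul _ (Order.sum _ fun i _ => ?_)).supBound
    exact ((hw i).const_mul _).add ((((hw i).mul (hw i)).mono (by simp)).sub (Order.const _))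

end Stress

/-! ### The amplitudes -/

section Amplitude

variable {v : Fin 3 → Sm} (Φ : TransportMap v) {T : ℝ}

/-- Composition with a smooth function of nine variables. -/
def compMatrix (α : (Fin 3 → Fin 3 → ℝ) → ℝ) (hα : ContDiff ℝ ∞ α) (A : Fin 3 → Fin 3 → Sm) : Sm :=
  ⟨fun t x => α fun i j => A i j t x,
    hα.comp (contDiff_pi.2 fun i => contDiff_pi.2 fun j => (A i j).smooth),
    fun t i x => by beta_reduce; simp only [(A _ _).periodic t i x]⟩

/-- The gradient matrix at a point. -/
def gradMat (t : ℝ) (x : E3) : Matrix (Fin 3) (Fin 3) ℝ := Matrix.of fun i j => Φ.grad i j t x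

/-- The inverse gradient matrix at a point. -/
def invMat (t : ℝ) (x : E3) : Matrix (Fin 3) (Fin 3) ℝ := Matrix.of fun i j => Φ.inv i j t x

theorem gradMat_mul_invMat (t : ℝ) (x : E3) : gradMat Φ t x * invMat Φ t x = 1 := by
  ext i j
  have h := congrArg (fun g : Sm => g t x) (Φ.grad_mul_inv i j)
  simp only [Sm.sum_apply, Sm.mul_apply] at h
  rw [Matrix.mul_apply, Matrix.one_apply]
  simp only [gradMat, invMat, Matrix.of_apply, h]
  split_ifs <;> rfl

theorem gradDet_apply (t : ℝ) (x : E3) : gradDet Φ t x = (gradMat Φ t x).det := by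
  simp [gradDet, gradMat, Matrix.det_fin_three]

/-- The determinant of the inverse gradient. -/
def invDet : Sm := (Matrix.of Φ.inv).det

theorem invDet_apply (t : ℝ) (x : E3) : invDet Φ t x = (invMat Φ t x).det := by
  simp [invDet, invMat, Matrix.det_fin_three]

/-- The stress in Lagrangian coordinates. -/
def lagrangeStress (S : Fin 3 → Fin 3 → Sm) (i j : Fin 3) : Sm :=
  invDet Φ ^ 2 * ∑ q, (∑ p, Φ.grad i p * S p q) * Φ.grad j q

theorem lagrangeStress_apply (S : Fin 3 → Fin 3 → Sm) (t : ℝ) (x : E3) :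
    (Matrix.of fun i j => lagrangeStress Φ S i j t x)
      = (invMat Φ t x).det ^ 2 • (gradMat Φ t x * (Matrix.of fun i j => S i j t x)
        * (gradMat Φ t x).transpose) := by
  ext i j
  simp [lagrangeStress, invDet_apply, Matrix.mul_apply, gradMat]

theorem posDef_lagrangeStress {S : Fin 3 → Fin 3 → Sm} {t : ℝ} {x : E3}
    (hS : (Matrix.of fun i j => S i j t x).PosDef) :
    (Matrix.of fun i j => lagrangeStress Φ S i j t x).PosDef := by
  rw [lagrangeStress_apply]
  have hDE := gradMat_mul_invMat Φ t x
  have hdet : (gradMat Φ t x).det * (invMat Φ t x).det = 1 := by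
    rw [← Matrix.det_mul, hDE, Matrix.det_one]
  have hu : IsUnit (gradMat Φ t x) := by
    rw [Matrix.isUnit_iff_isUnit_det]
    exact IsUnit.of_mul_eq_one _ hdet
  have h1 := hS.mul_mul_conjTranspose_same (Matrix.vecMul_injective_iff_isUnit.2 hu)
  rw [Matrix.conjTranspose_eq_transpose_of_trivial] at h1
  refine h1.smul ?_
  have : (invMat Φ t x).det ≠ 0 := right_ne_zero_of_mul_eq_one hdet
  positivity

/-- Solves `grad_mul_tangent` for the tangent; through it a rank one matrix of an integer direction
becomes that of a tangent by congruence with the inverse gradient. -/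
theorem tangent_apply {ι : Type} {f : ι → Fin 3 → ℤ} (P : PipeFamily f) (J : ι) (i : Fin 3)
    (t : ℝ) (x : E3) :
    tangent Φ P J i t x
      = P.r J * (gradMat Φ t x).det * ∑ q, invMat Φ t x i q * f J q := by
  have h : (gradMat Φ t x).mulVec (fun j => tangent Φ P J j t x)
      = fun q => P.r J * f J q * (gradMat Φ t x).det := by
    funext q
    have := congrArg (fun g : Sm => g t x) (grad_mul_tangent Φ P J q)
    simpa [Matrix.mulVec, dotProduct, gradMat, gradDet_apply] using this
  have h2 := congrArg (fun y => (invMat Φ t x).mulVec y i) h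
  simp only [Matrix.mulVec_mulVec] at h2
  rw [_root_.mul_eq_one_comm.1 (gradMat_mul_invMat Φ t x), Matrix.one_mulVec] at h2
  rw [h2, Matrix.mulVec, dotProduct, Finset.mul_sum]
  exact Finset.sum_congr rfl fun q _ => by ring

/-- The stress is pulled back to Lagrangian coordinates, decomposed there, and pushed forward by the
tangents. By periodicity its values over `[0,T]` and one closed cube form the compact set required
by the decomposition. -/
theorem exists_amplitude {S : Fin 3 → Fin 3 → Sm}
    (hS : ∀ t ∈ Icc 0 T, ∀ x, (Matrix.of fun i j => S i j t x).PosDef) :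
    ∃ (ι : Type) (_ : Fintype ι) (f : ι → Fin 3 → ℤ) (P : PipeFamily f) (a : ι → Sm),
      ∀ t ∈ Icc 0 T, ∀ x i j, meanStress Φ P a i j t x = S i j t x := by
  set A := lagrangeStress Φ S with hA
  have hcont : Continuous fun z : ℝ × E3 => fun i j => A i j z.1 z.2 :=
    continuous_pi fun i => continuous_pi fun j => (A i j).smooth.continuous
  obtain ⟨ι, hι, f, α, hf, hα, hdec⟩ := exists_decomposition
    (K := Set.image (fun z : ℝ × E3 => fun i j => A i j z.1 z.2)
      (Icc 0 T ×ˢ {x : E3 | ∀ i, x i ∈ Icc (0 : ℝ) (2 * Real.pi)}))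
    ((isCompact_Icc.prod isCompact_closedCube).image hcont) (by
      rintro _ ⟨⟨t, x⟩, ⟨ht, -⟩, rfl⟩
      exact posDef_lagrangeStress Φ (hS t ht x))
  obtain ⟨P⟩ := exists_pipeFamily f hf
  -- The normalization cancels the mean square of the profile and the factor `r` of the tangent.
  refine ⟨ι, hι, f, P, fun J => (Real.sqrt (P.ms J * P.r J ^ 2))⁻¹ • compMatrix (α J) (hα J) A,
    fun t ht x i j => ?_⟩
  have hdec' : ∀ p q, ∑ J, compMatrix (α J) (hα J) A t x ^ 2 * ((f J p : ℝ) * f J q)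
      = A p q t x := by
    intro p q
    obtain ⟨k, hk⟩ := exists_lat_mem_cube x
    have hper : ∀ g : Sm, g t x = g t (x + latVec k) := fun g => ((g.periodic t).add_lat k x).symm
    simp only [hper]
    exact hdec _ ⟨(t, x + latVec k), ⟨ht, cube_subset_closedCube hk⟩, rfl⟩ p q
  have hDE := gradMat_mul_invMat Φ t x
  have hED := _root_.mul_eq_one_comm.1 hDE
  have hdet : (gradMat Φ t x).det * (invMat Φ t x).det = 1 := by
    rw [← Matrix.det_mul, hDE, Matrix.det_one]
  have hterm : ∀ J, P.ms J * ((Real.sqrt (P.ms J * P.r J ^ 2))⁻¹ * compMatrix (α J) (hα J) A t x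
        * ((Real.sqrt (P.ms J * P.r J ^ 2))⁻¹ * compMatrix (α J) (hα J) A t x)
        * (tangent Φ P J i t x * tangent Φ P J j t x))
      = ∑ p, ∑ q, (gradMat Φ t x).det ^ 2 * (invMat Φ t x i p * invMat Φ t x j q)
        * (compMatrix (α J) (hα J) A t x ^ 2 * ((f J p : ℝ) * f J q)) := by
    intro J
    have hm := P.ms_pos J
    have hr := P.r_pos J
    have hs : (Real.sqrt (P.ms J * P.r J ^ 2))⁻¹ * (Real.sqrt (P.ms J * P.r J ^ 2))⁻¹
        = (P.ms J * P.r J ^ 2)⁻¹ := by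
      rw [← mul_inv, Real.mul_self_sqrt (by positivity)]
    have hone : P.ms J * P.r J ^ 2 * (P.ms J * P.r J ^ 2)⁻¹ = 1 := mul_inv_cancel₀ (by positivity)
    rw [tangent_apply, tangent_apply]
    simp only [Fin.sum_univ_three]
    generalize (Real.sqrt (P.ms J * P.r J ^ 2))⁻¹ = s at hs ⊢
    rw [← hs] at hone
    linear_combination (compMatrix (α J) (hα J) A t x ^ 2 * (gradMat Φ t x).det ^ 2
      * (invMat Φ t x i 0 * f J 0 + invMat Φ t x i 1 * f J 1 + invMat Φ t x i 2 * f J 2)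
      * (invMat Φ t x j 0 * f J 0 + invMat Φ t x j 1 * f J 1 + invMat Φ t x j 2 * f J 2)) * hone
  simp only [meanStress, Sm.sum_apply, Sm.smul_apply, Sm.mul_apply, hterm]
  rw [Finset.sum_comm]
  have hswap : ∀ p, ∑ J, ∑ q, (gradMat Φ t x).det ^ 2 * (invMat Φ t x i p * invMat Φ t x j q)
        * (compMatrix (α J) (hα J) A t x ^ 2 * ((f J p : ℝ) * f J q))
      = ∑ q, (gradMat Φ t x).det ^ 2 * (invMat Φ t x i p * invMat Φ t x j q) * A p q t x := by
    intro p
    rw [Finset.sum_comm]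
    refine Finset.sum_congr rfl fun q _ => ?_
    rw [← Finset.mul_sum, hdec']
  simp only [hswap]
  have hmat : (gradMat Φ t x).det ^ 2 • (invMat Φ t x * (Matrix.of fun i j => A i j t x)
      * (invMat Φ t x).transpose) = Matrix.of fun i j => S i j t x := by
    rw [hA, lagrangeStress_apply, Matrix.mul_smul, Matrix.smul_mul, smul_smul, ← mul_pow, hdet,
      one_pow, one_smul]
    have : (gradMat Φ t x).transpose * (invMat Φ t x).transpose = 1 := by
      rw [← Matrix.transpose_mul, hED, Matrix.transpose_one]
    rw [← Matrix.mul_assoc, ← Matrix.mul_assoc, hED, Matrix.one_mul, Matrix.mul_assoc, this,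
      Matrix.mul_one]
  have := congrFun (congrFun hmat i) j
  simp only [Matrix.smul_apply, Matrix.mul_apply, Matrix.of_apply, Matrix.transpose_apply,
    smul_eq_mul, Fin.sum_univ_three] at this
  rw [← this]
  simp only [Fin.sum_univ_three]
  ring

end Amplitude

/-! ### Norms -/

/-- Since `l ≤ ⌈l⌉ ≤ 2l` for `l > 1`, the integer frequency may be replaced by the real parameter in
powers of either sign. -/
theorem rpow_ceil_le {l : ℝ} (hl : 1 < l) (e : ℝ) : (⌈l⌉₊ : ℝ) ^ e ≤ 2 ^ |e| * l ^ e := by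
  have hl0 : 0 < l := by linarith
  have h1 : l ≤ ⌈l⌉₊ := Nat.le_ceil l
  have h2 : (⌈l⌉₊ : ℝ) ≤ 2 * l := by
    have := Nat.ceil_lt_add_one hl0.le
    linarith
  rcases le_total 0 e with he | he
  · rw [abs_of_nonneg he, ← Real.mul_rpow (by norm_num) hl0.le]
    exact Real.rpow_le_rpow (by positivity) h2 he
  · calc (⌈l⌉₊ : ℝ) ^ e ≤ l ^ e := Real.rpow_le_rpow_of_nonpos hl0 h1 he
      _ = 1 * l ^ e := (one_mul _).symm
      _ ≤ 2 ^ |e| * l ^ e := mul_le_mul_of_nonneg_right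
        (Real.one_le_rpow (by norm_num) (abs_nonneg e)) (by positivity)

theorem one_le_ceil {l : ℝ} (hl : 1 < l) : 1 ≤ ⌈l⌉₊ := Nat.one_le_ceil_iff.2 (by linarith)

section Norms

variable {T r : ℝ}

theorem SupBound.exists_ceil_le {f : ℕ → Sm} (hf : SupBound T r f) :
    ∃ C, 0 ≤ C ∧ ∀ l : ℝ, 1 < l → ∀ t ∈ Icc 0 T, ∀ x, |f ⌈l⌉₊ t x| ≤ C * l ^ r := by
  obtain ⟨C, hC⟩ := hf
  refine ⟨|C| * 2 ^ |r|, by positivity, fun l hl t ht x => (hC _ (one_le_ceil hl) t ht x).trans ?_⟩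
  rw [mul_assoc]
  exact mul_le_mul (le_abs_self C) (rpow_ceil_le hl r) (by positivity) (abs_nonneg C)

theorem SupBound.order_proj_zero {f : ℕ → Sm} (hf : SupBound T r fun n => proj 0 (f n)) :
    Order T r fun n => proj 0 (f n) := by
  intro N
  cases N with
  | zero => exact hf
  | succ N =>
    refine ⟨hf, fun i => ?_⟩
    simp only [dx_proj_zero]
    exact Order.zero N

/-- Iterated space derivatives. -/
def iterDx : (k : ℕ) → (Fin k → Fin 3) → Sm → Sm
  | 0, _, g => g
  | k + 1, σ, g => Sm.dx (σ 0) (iterDx k (Fin.tail σ) g)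

theorem iteratedFDeriv_slice (g : Sm) (t : ℝ) (k : ℕ) (σ : Fin k → Fin 3) (x : E3) :
    iteratedFDeriv ℝ k (g t) x (fun j => stdVec (σ j)) = iterDx k σ g t x := by
  induction k generalizing x with
  | zero => simp [iterDx]
  | succ k ih =>
    rw [iteratedFDeriv_succ_apply_eq_fderiv (g.contDiff_slice t), iterDx, Sm.dx_apply, pd]
    congr 2
    funext y
    exact ih (Fin.tail σ) y

theorem Order.iterDx {f : ℕ → Sm} (hf : Order T r f) (k : ℕ) (σ : Fin k → Fin 3) :
    Order T (r + k) fun n => iterDx k σ (f n) := by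
  induction k with
  | zero => simpa [HypoNS.iterDx] using hf
  | succ k ih => exact ((ih (Fin.tail σ)).dx (σ 0)).mono (by push_cast; linarith)

theorem contDiff_toLp_slice {κ : Type*} [Fintype κ] (G : κ → Sm) (t : ℝ) :
    ContDiff ℝ ∞ fun x : E3 => (WithLp.toLp 2 fun c => G c t x : EuclideanSpace ℝ κ) :=
  contDiff_euclidean.2 fun c => (G c).contDiff_slice t

theorem iteratedFDeriv_toLp {κ : Type*} [Fintype κ] (G : κ → Sm) (t : ℝ) (k : ℕ)
    (σ : Fin k → Fin 3) (x : E3) (c : κ) :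
    iteratedFDeriv ℝ k (fun x : E3 => (WithLp.toLp 2 fun c => G c t x : EuclideanSpace ℝ κ)) x
      (fun j => stdVec (σ j)) c = HypoNS.iterDx k σ (G c) t x := by
  rw [← iteratedFDeriv_slice]
  have h := (EuclideanSpace.proj c : EuclideanSpace ℝ κ →L[ℝ] ℝ).iteratedFDeriv_comp_left
    (f := fun x : E3 => (WithLp.toLp 2 fun c => G c t x : EuclideanSpace ℝ κ)) (x := x)
    (contDiff_toLp_slice G t).contDiffAt (i := k) (by exact_mod_cast le_top)
  have h2 := congrArg (fun L => L fun j => stdVec (σ j)) h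
  exact h2.symm

theorem norm_le_sum_abs {κ : Type*} [Fintype κ] (y : EuclideanSpace ℝ κ) : ‖y‖ ≤ ∑ c, |y c| := by
  classical
  have h : y = ∑ c, EuclideanSpace.single c (y c) := by
    ext j
    simp [Finset.sum_apply]
  calc ‖y‖ = ‖∑ c, EuclideanSpace.single c (y c)‖ := by rw [← h]
    _ ≤ ∑ c, ‖EuclideanSpace.single c (y c)‖ := norm_sum_le _ _
    _ = ∑ c, |y c| := by simp

theorem exists_cNorm_le {κ : Type*} [Fintype κ] {G : κ → ℕ → Sm} (hG : ∀ c, Order T r (G c))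
    (N : ℕ) : ∃ C, 0 ≤ C ∧ ∀ l : ℝ, 1 < l → ∀ t ∈ Icc 0 T,
      cNorm N (fun x => (WithLp.toLp 2 fun c => G c ⌈l⌉₊ t x : EuclideanSpace ℝ κ))
        ≤ ENNReal.ofReal (C * l ^ (r + N)) := by
  choose C hC0 hC using fun (k : ℕ) (σ : Fin k → Fin 3) (c : κ) =>
    ((hG c).iterDx k σ).supBound.exists_ceil_le
  have hB0 : ∀ k, 0 ≤ ∑ σ, ∑ c, C k σ c := fun k =>
    Finset.sum_nonneg fun σ _ => Finset.sum_nonneg fun c _ => hC0 k σ c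
  refine ⟨∑ k ∈ Finset.range (N + 1), ∑ σ, ∑ c, C k σ c, Finset.sum_nonneg fun k _ => hB0 k,
    fun l hl t ht => ?_⟩
  have hl0 : 0 < l := by linarith
  rw [Finset.sum_mul, ENNReal.ofReal_sum_of_nonneg fun k _ => mul_nonneg (hB0 k) (by positivity),
    cNorm]
  refine Finset.sum_le_sum fun k hk => iSup_le fun σ => iSup_le fun x => ?_
  rw [← ofReal_norm]
  refine ENNReal.ofReal_le_ofReal ((norm_le_sum_abs _).trans ?_)
  simp only [iteratedFDeriv_toLp]
  have hkN : (k : ℝ) ≤ N := by exact_mod_cast Nat.lt_succ_iff.1 (Finset.mem_range.1 hk)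
  calc ∑ c, |HypoNS.iterDx k σ (G c ⌈l⌉₊) t x| ≤ ∑ c, C k σ c * l ^ (r + k) :=
        Finset.sum_le_sum fun c _ => hC k σ c l hl t ht x
    _ = (∑ c, C k σ c) * l ^ (r + k) := by rw [Finset.sum_mul]
    _ ≤ _ := mul_le_mul (Finset.single_le_sum (f := fun σ => ∑ c, C k σ c)
        (fun σ _ => Finset.sum_nonneg fun c _ => hC0 k σ c) (Finset.mem_univ σ))
        (Real.rpow_le_rpow_of_exponent_le hl.le (by linarith)) (by positivity) (hB0 k)

theorem abs_dx_proj_le (p : Fin 3) (k : Fin 3 → ℤ) (f : Sm) (t : ℝ) (x : E3) :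
    |Sm.dx p (proj k f) t x| ≤ |(k p : ℝ)| * ‖fourierCoef (f t) k‖ := by
  have h : proj k f t = fun y => Real.cos (phase k y) * cosCoef k f t
      + Real.sin (phase k y) * sinCoef k f t := funext fun y => proj_eq_cos_sin k f t y
  have hn : ‖fourierCoef (f t) k‖ = Real.sqrt (cosCoef k f t ^ 2 + sinCoef k f t ^ 2) := by
    rw [fourierCoef_eq, Complex.norm_def, Complex.normSq_apply]
    congr 1
    simp
    ring
  rw [Sm.dx_apply, h, pd_cos_sin_phase, hn]
  have e : Real.cos (phase k x) * (k p * sinCoef k f t) + Real.sin (phase k x) * (-(k p * cosCoef k f t))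
      = k p * (Real.cos (phase k x) * sinCoef k f t - Real.sin (phase k x) * cosCoef k f t) := by ring
  rw [e, abs_mul]
  refine mul_le_mul_of_nonneg_left (Real.abs_le_sqrt ?_) (abs_nonneg _)
  nlinarith [Real.sin_sq_add_cos_sq (phase k x),
    sq_nonneg (Real.cos (phase k x) * cosCoef k f t + Real.sin (phase k x) * sinCoef k f t)]

/-- The negative Sobolev norm of a curl. -/
theorem hNegOneNorm_curl_le (z : Fin 3 → Sm) (t B s : ℝ) (hs : 0 ≤ s) (hB : 0 ≤ B)
    (hz : ∀ i x, |z i t x| ≤ B) {w : Fin 3 → Sm}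
    (hw : ∀ i, w i = s • (Sm.dx (i + 1) (z (i + 2)) - Sm.dx (i + 2) (z (i + 1)))) :
    hNegOneNorm (fun x => WithLp.toLp 2 fun i => w i t x) ≤ ENNReal.ofReal (3 * B * s) := by
  have hcoef : ∀ k i, ‖fourierCoef (w i t) k‖ ^ 2
      ≤ s ^ 2 * (freqSq k * ∑ j, ‖fourierCoef (z j t) k‖ ^ 2) := by
    intro k i
    obtain ⟨x, hx⟩ := exists_norm_fourierCoef_eq k (w i) t
    have h1 : proj k (w i) = s • (Sm.dx (i + 1) (proj k (z (i + 2)))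
        - Sm.dx (i + 2) (proj k (z (i + 1)))) := by
      have hsub : ∀ f g : Sm, proj k (f - g) = proj k f - proj k g := map_sub (projL k)
      rw [hw, proj_smul, hsub, dx_proj, dx_proj]
    have h2 : |proj k (w i) t x| ≤ s * (|(k (i + 1) : ℝ)| * ‖fourierCoef (z (i + 2) t) k‖
        + |(k (i + 2) : ℝ)| * ‖fourierCoef (z (i + 1) t) k‖) := by
      rw [h1, Sm.smul_apply, abs_mul, abs_of_nonneg hs, Sm.sub_apply]
      exact mul_le_mul_of_nonneg_left ((abs_sub _ _).trans (add_le_add (abs_dx_proj_le _ k _ t x)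
        (abs_dx_proj_le _ k _ t x))) hs
    rw [hx]
    refine (pow_le_pow_left₀ (abs_nonneg _) h2 2).trans ?_
    rw [mul_pow]
    refine mul_le_mul_of_nonneg_left ?_ (sq_nonneg s)
    have hcs : ∀ a b c d : ℝ, (a * b + c * d) ^ 2 ≤ (a ^ 2 + c ^ 2) * (b ^ 2 + d ^ 2) :=
      fun a b c d => by nlinarith [sq_nonneg (a * d - b * c)]
    refine (hcs _ _ _ _).trans ?_
    rw [sq_abs, sq_abs]
    have hf : ∀ c : Fin 3 → ℝ, c (i + 1) ^ 2 + c (i + 2) ^ 2 ≤ ∑ j, c j ^ 2 := fun c => by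
      rw [Fin.sum_univ_three]
      fin_cases i
      · simp; positivity
      · simp; nlinarith [sq_nonneg (c 1)]
      · simp; positivity
    refine mul_le_mul (hf fun j => (k j : ℝ)) ?_ (by positivity) (freqSq_nonneg k)
    rw [add_comm]
    exact hf fun j => ‖fourierCoef (z j t) k‖
  -- The weight of the negative Sobolev norm absorbs the factor `|k|²` produced by the curl.
  have hterm : ∀ k : Fin 3 → ℤ, ENNReal.ofReal ((1 + freqSq k)⁻¹ * ∑ i, ‖fourierCoef (w i t) k‖ ^ 2)
      ≤ ENNReal.ofReal (3 * s ^ 2) * ∑ j, ENNReal.ofReal (‖fourierCoef (z j t) k‖ ^ 2) := by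
    intro k
    rw [← ENNReal.ofReal_sum_of_nonneg fun j _ => by positivity,
      ← ENNReal.ofReal_mul (by positivity)]
    refine ENNReal.ofReal_le_ofReal ?_
    have hk := freqSq_nonneg k
    set Z := ∑ j, ‖fourierCoef (z j t) k‖ ^ 2 with hZ
    have hZ0 : 0 ≤ Z := Finset.sum_nonneg fun j _ => by positivity
    have h3 : ∑ i, ‖fourierCoef (w i t) k‖ ^ 2 ≤ 3 * (s ^ 2 * (freqSq k * Z)) := by
      rw [Fin.sum_univ_three]
      linarith [hcoef k 0, hcoef k 1, hcoef k 2]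
    rw [inv_mul_le_iff₀ (by linarith)]
    refine h3.trans ?_
    nlinarith [mul_nonneg (sq_nonneg s) hZ0]
  have hsum : ∑' k : Fin 3 → ℤ, ENNReal.ofReal ((1 + freqSq k)⁻¹ * ∑ i, ‖fourierCoef (w i t) k‖ ^ 2)
      ≤ ENNReal.ofReal ((3 * B * s) ^ 2) := by
    refine (ENNReal.tsum_le_tsum hterm).trans ?_
    rw [ENNReal.tsum_mul_left]
    have h4 : ∑' k, ∑ j, ENNReal.ofReal (‖fourierCoef (z j t) k‖ ^ 2)
        ≤ ENNReal.ofReal (3 * B ^ 2) := by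
      rw [Summable.tsum_finsetSum fun _ _ => ENNReal.summable]
      refine (Finset.sum_le_sum fun j _ => tsum_sq_fourierCoef_le (z j) t B (hz j)).trans ?_
      rw [← ENNReal.ofReal_sum_of_nonneg fun j _ => by positivity]
      simp
    refine (mul_le_mul_right h4 _).trans ?_
    rw [← ENNReal.ofReal_mul (by positivity)]
    exact ENNReal.ofReal_le_ofReal (le_of_eq (by ring))
  rw [hNegOneNorm]
  refine (ENNReal.rpow_le_rpow hsum (by norm_num)).trans ?_
  rw [ENNReal.ofReal_rpow_of_nonneg (by positivity) (by norm_num), ← Real.sqrt_eq_rpow,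
    Real.sqrt_sq (by positivity)]

end Norms

/-! ### Solutions with smooth extensions in time -/

section Solutions

variable {T θ : ℝ}

/-- The vector field with the given components. -/
def vecField (V : Fin 3 → Sm) (t : ℝ) (x : E3) : E3 := WithLp.toLp 2 fun i => V i t x

theorem Sm.smoothField (f : Sm) : SmoothField T (fun t x => f t x) :=
  ⟨f.smooth.contDiffOn, fun t _ => f.periodic t⟩

theorem smoothField_vecField (V : Fin 3 → Sm) : SmoothField T (vecField V) := by
  refine ⟨ContDiff.contDiffOn (contDiff_euclidean.2 fun i => (V i).smooth), fun t _ i x => ?_⟩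
  simp only [vecField, (V _).periodic t i x]

theorem SmoothField.coord {v : ℝ → E3 → E3} (hv : SmoothField T v) (i : Fin 3) :
    SmoothField T fun t x => v t x i :=
  ⟨(EuclideanSpace.proj i : E3 →L[ℝ] ℝ).contDiff.comp_contDiffOn hv.1,
    fun t ht j x => by beta_reduce; rw [hv.2 t ht j x]⟩

/-- The left side minus the right side of the momentum equation. -/
def momentumDefect (h0 : 0 ≤ θ) (h1 : θ ≤ 1) (V : Fin 3 → Sm) (p : Sm) (R : Fin 3 → Fin 3 → Sm)
    (i : Fin 3) : Sm :=
  Sm.dt (V i) + ∑ j, Sm.dx j (V i * V j) + Sm.dx i p + mult (fracSymb θ h0 h1) (V i)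
    + ∑ j, Sm.dx j (R i j)

theorem momentumDefect_apply (hT : 0 < T) (h0 : 0 ≤ θ) (h1 : θ ≤ 1) {V : Fin 3 → Sm} {p : Sm}
    {R : Fin 3 → Fin 3 → Sm} {v : ℝ → E3 → E3} {q : ℝ → E3 → ℝ}
    {Q : ℝ → E3 → Matrix (Fin 3) (Fin 3) ℝ}
    (hv : ∀ i, ∀ t ∈ Icc 0 T, ∀ x, V i t x = v t x i) (hp : ∀ t ∈ Icc 0 T, ∀ x, p t x = q t x)
    (hR : ∀ i j, ∀ t ∈ Icc 0 T, ∀ x, R i j t x = Q t x i j)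
    {t : ℝ} (ht : t ∈ Icc 0 T) (x : E3) (i : Fin 3) :
    momentumDefect h0 h1 V p R i t x = derivWithin (fun s => v s x i) (Icc 0 T) t
      + ∑ j, pd j (fun y => v t y i * v t y j) x + pd i (q t) x + fracLap θ (fun y => v t y i) x
      + ∑ j, pd j (fun y => Q t y i j) x := by
  have e1 : derivWithin (fun s => v s x i) (Icc 0 T) t = Sm.dt (V i) t x := by
    rw [derivWithin_congr (f := fun s => V i s x) (fun s hs => (hv i s hs x).symm)
      (hv i t ht x).symm]
    exact ((V i).hasDerivAt_time t x).hasDerivWithinAt.derivWithin (uniqueDiffOn_Icc hT t ht)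
  have e2 : ∀ i, (fun y => v t y i) = V i t := fun i => funext fun y => (hv i t ht y).symm
  have e3 : q t = p t := funext fun y => (hp t ht y).symm
  have e4 : ∀ j, (fun y => Q t y i j) = R i j t := fun j => funext fun y => (hR i j t ht y).symm
  have e5 : ∀ j, (fun y => v t y i * v t y j) = (V i * V j) t := fun j => funext fun y => by
    rw [Sm.mul_apply, hv i t ht, hv j t ht]
  rw [e1, e2, e3, fracLap_eq_mult h0 h1]
  simp only [e4, e5, ← Sm.dx_apply, momentumDefect, Sm.add_apply, Sm.sum_apply]

theorem isSmoothSolution_of_momentumDefect (hT : 0 < T) (h0 : 0 ≤ θ) (h1 : θ ≤ 1)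
    {V : Fin 3 → Sm} {p : Sm} {R : Fin 3 → Fin 3 → Sm}
    (hm : ∀ t ∈ Icc 0 T, ∀ x i, momentumDefect h0 h1 V p R i t x = 0)
    (hs : ∀ t ∈ Icc 0 T, ∀ x i j, R i j t x = R j i t x)
    (hd : ∀ t ∈ Icc 0 T, ∀ x, ∑ i, Sm.dx i (V i) t x = 0) :
    IsSmoothSolution θ T (vecField V) (fun t x => p t x)
      (fun t x => Matrix.of fun i j => R i j t x) where
  smooth_v := smoothField_vecField V
  smooth_p := p.smoothField
  smooth_R i j := (R i j).smoothField
  symm_R t ht x := Matrix.IsSymm.ext fun i j => hs t ht x j i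
  momentum t ht x i := by
    have h := hm t ht x i
    rw [momentumDefect_apply (v := vecField V) (q := fun t x => p t x)
      (Q := fun t x => Matrix.of fun i j => R i j t x) hT h0 h1 (fun _ _ _ _ => rfl)
      (fun _ _ _ => rfl) (fun _ _ _ _ _ => rfl) ht x i] at h
    linarith
  div_free t ht x := by
    have h := hd t ht x
    simp only [Sm.dx_apply] at h
    exact h

/-- The difference of the dissipation densities. -/
def dissipationDefect (h0 : 0 ≤ θ / 2) (h1 : θ / 2 ≤ 1) (V' V : Fin 3 → Sm) : Sm :=
  ∑ i, mult (fracSymb (θ / 2) h0 h1) (V' i) ^ 2 - ∑ i, mult (fracSymb (θ / 2) h0 h1) (V i) ^ 2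

theorem integral_cube_eq_proj_zero (f : Sm) (t : ℝ) (x : E3) :
    ∫ y in cube, f t y = (2 * Real.pi) ^ 3 * proj 0 f t x := by
  have : (2 * Real.pi) ^ 3 ≠ 0 := by positivity
  rw [proj_zero_apply]
  field_simp

/-- On `[0,T]` the inner integral is a multiple of the mean of a smooth function on `ℝ × 𝕋³`, so it
is continuous in time and the fundamental theorem of calculus applies. -/
theorem hasDerivWithinAt_dissipationGap (h0 : 0 ≤ θ / 2) (h1 : θ / 2 ≤ 1) {V' V : Fin 3 → Sm}
    {v : ℝ → E3 → E3} (hv : ∀ i, ∀ t ∈ Icc 0 T, ∀ x, V i t x = v t x i) {t : ℝ}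
    (ht : t ∈ Icc 0 T) :
    HasDerivWithinAt (dissipationGap θ (vecField V') v)
      ((2 * Real.pi) ^ 3 * proj 0 (dissipationDefect h0 h1 V' V) t 0) (Icc 0 T) t := by
  set D := dissipationDefect h0 h1 V' V with hD
  have hcont : Continuous fun s => (2 * Real.pi) ^ 3 * proj 0 D s 0 :=
    continuous_const.mul (continuous_iff_continuousAt.2 fun s =>
      ((proj 0 D).hasDerivAt_time s 0).continuousAt)
  have heq : ∀ t ∈ Icc 0 T, dissipationGap θ (vecField V') v t
      = ∫ s in (0 : ℝ)..t, (2 * Real.pi) ^ 3 * proj 0 D s 0 := by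
    intro t ht
    refine intervalIntegral.integral_congr fun s hs => ?_
    rw [uIcc_of_le ht.1] at hs
    have hsT : s ∈ Icc 0 T := ⟨hs.1, hs.2.trans ht.2⟩
    beta_reduce
    rw [← integral_cube_eq_proj_zero]
    congr 1
    funext x
    have e : ∀ i, (fun y => v s y i) = V i s := fun i => funext fun y => (hv i s hsT y).symm
    have e' : ∀ i, (fun y => vecField V' s y i) = V' i s := fun i => rfl
    simp only [dissipation, e, e', fracLap_eq_mult h0 h1, hD, dissipationDefect, Sm.sub_apply,
      Sm.sum_apply, Sm.pow_apply]
  exact ((hcont.integral_hasStrictDerivAt 0 t).hasDerivAt.hasDerivWithinAt).congr heq (heq t ht)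

end Solutions

/-! ### The perturbed solution -/

section Perturbed

variable {v : Fin 3 → Sm} (Φ : TransportMap v) {ι : Type} [Fintype ι] {f : ι → Fin 3 → ℤ}
  (P : PipeFamily f) (a : ι → Sm) (M : Fin 3 → Fin 3 → ℕ → Sm)

/-- The deviation of the stress of the perturbed solution, with trace depending on time only. -/
def stressDefect (i j : Fin 3) (n : ℕ) : Sm :=
  M i j n - if i = j then (3 : ℝ)⁻¹ • (∑ k, M k k n - proj 0 (energyDefect Φ P a n)) else 0

/-- The velocity of the perturbed solution. -/
def newVelocity (n : ℕ) (i : Fin 3) : Sm := v i + perturb Φ P a i n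

/-- The stress of the perturbed solution. -/
def newStress (R : Fin 3 → Fin 3 → Sm) (n : ℕ) (i j : Fin 3) : Sm :=
  R i j - meanStress Φ P a i j - stressDefect Φ P a M i j n

/-- The pressure of the perturbed solution. -/
def newPressure (p : Sm) (π : ℕ → Sm) (n : ℕ) : Sm := p + π n - (3 : ℝ)⁻¹ • ∑ k, M k k n

theorem trace_stressDefect (n : ℕ) :
    ∑ i, stressDefect Φ P a M i i n = proj 0 (energyDefect Φ P a n) := by
  simp only [stressDefect, if_true, Fin.sum_univ_three]
  module

/-- The mean is constant in space, so the trace correction changes the divergence by a gradient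
only, which `newPressure` compensates. -/
theorem div_stressDefect (i : Fin 3) (n : ℕ) :
    ∑ j, Sm.dx j (stressDefect Φ P a M i j n)
      = ∑ j, Sm.dx j (M i j n) - Sm.dx i ((3 : ℝ)⁻¹ • ∑ k, M k k n) := by
  simp only [stressDefect, map_sub, Finset.sum_sub_distrib, apply_ite (Sm.dx _), map_zero,
    Finset.sum_ite_eq, Finset.mem_univ, if_true, Derivation.map_smul, dx_proj_zero, sub_zero]

theorem stressDefect_symm (hM : ∀ i j n, M i j n = M j i n) (i j : Fin 3) (n : ℕ) :
    stressDefect Φ P a M i j n = stressDefect Φ P a M j i n := by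
  rw [stressDefect, stressDefect, hM]
  simp only [eq_comm (a := i)]

theorem order_stressDefect {T θ : ℝ} (h0 : 0 < θ) (hM : ∀ i j, Order T (2 * θ - 1) (M i j))
    (i j : Fin 3) : Order T (2 * θ - 1) (stressDefect Φ P a M i j) := by
  have hμ : Order T (2 * θ - 1) fun n => proj 0 (energyDefect Φ P a n) :=
    (supBound_energyDefect Φ P a).order_proj_zero.mono (by linarith)
  unfold stressDefect
  by_cases hij : i = j
  · simp only [if_pos hij]
    exact (hM i j).sub (((Order.sum _ fun k _ => hM k k).sub hμ).smul _)
  · simpa only [if_neg hij, sub_zero] using hM i j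

/-- The two defects agree as functions for all times; the equation itself holds only on `[0,T]`,
where it is carried over from the given solution. -/
theorem momentumDefect_new {θ : ℝ} (h0 : 0 ≤ θ) (h1 : θ ≤ 1) (p : Sm) (R : Fin 3 → Fin 3 → Sm)
    (π : ℕ → Sm) (n : ℕ) (i : Fin 3)
    (h : Sm.dt (perturb Φ P a i n)
        + ∑ j, Sm.dx j (v i * perturb Φ P a j n + perturb Φ P a i n * v j
          + perturb Φ P a i n * perturb Φ P a j n)
        + mult (fracSymb θ h0 h1) (perturb Φ P a i n)
        = ∑ j, Sm.dx j (meanStress Φ P a i j + M i j n) - Sm.dx i (π n)) :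
    momentumDefect h0 h1 (newVelocity Φ P a n) (newPressure M p π n) (newStress Φ P a M R n) i
      = momentumDefect h0 h1 v p R i := by
  have hd := div_stressDefect Φ P a M i n
  have e : ∀ j, newVelocity Φ P a n i * newVelocity Φ P a n j = v i * v j
      + (v i * perturb Φ P a j n + perturb Φ P a i n * v j
          + perturb Φ P a i n * perturb Φ P a j n) := fun j => by
    rw [newVelocity, newVelocity]; ring
  simp only [momentumDefect, e, newPressure, newStress]
  simp only [newVelocity, map_add, map_sub, Finset.sum_add_distrib, Finset.sum_sub_distrib] at h hd ⊢
  linear_combination h - hd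

theorem div_newVelocity (n : ℕ) (hn : 1 ≤ n) :
    ∑ i, Sm.dx i (newVelocity Φ P a n i) = ∑ i, Sm.dx i (v i) := by
  simp only [newVelocity, map_add, Finset.sum_add_distrib, div_perturb Φ P a n hn, add_zero]

theorem order_newVelocity {T : ℝ} (i : Fin 3) : Order T 0 fun n => newVelocity Φ P a n i :=
  (Order.const (v i)).add (order_perturb Φ P a i)

/-- The trace of the stress defect is the mean of the energy defect, which is exactly the amount by
which the kinetic energy overshoots the trace of the mean stress. -/
theorem proj_zero_energy_new (R : Fin 3 → Fin 3 → Sm) (n : ℕ) :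
    proj 0 (∑ i, (newVelocity Φ P a n i ^ 2 + newStress Φ P a M R n i i))
      = proj 0 (∑ i, (v i ^ 2 + R i i)) := by
  have h : ∑ i, (newVelocity Φ P a n i ^ 2 + newStress Φ P a M R n i i)
      = ∑ i, (v i ^ 2 + R i i) + (energyDefect Φ P a n - proj 0 (energyDefect Φ P a n)) := by
    rw [← trace_stressDefect Φ P a M n, energyDefect, ← Finset.sum_sub_distrib,
      ← Finset.sum_add_distrib]
    refine Finset.sum_congr rfl fun i _ => ?_
    rw [newVelocity, newStress]
    ring
  have hsub : ∀ f g : Sm, proj 0 (f - g) = proj 0 f - proj 0 g := map_sub (projL 0)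
  rw [h, proj_add, hsub, proj_zero_proj_zero, sub_self, add_zero]

/-- Each factor `(-Δ)^{θ/2} v'` costs `n^θ`, and the density is quadratic. -/
theorem order_dissipationDefect {T θ : ℝ} (h0 : 0 < θ / 2) (h1 : θ / 2 < 1) :
    Order T (2 * θ) fun n => dissipationDefect h0.le h1.le (newVelocity Φ P a n) v := by
  refine (Order.sum _ fun i _ => ?_).sub ((Order.const _).mono (by linarith))
  have h := (order_newVelocity Φ P a i (T := T)).fracMult h0 h1
  simp only [pow_two]
  exact (h.mul h).mono (by linarith)

theorem exists_hNegOneNorm_perturb_le (T : ℝ) : ∃ C, 0 ≤ C ∧ ∀ l : ℝ, 1 < l → ∀ t ∈ Icc 0 T,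
    hNegOneNorm (fun x => WithLp.toLp 2 fun i => perturb Φ P a i ⌈l⌉₊ t x)
      ≤ ENNReal.ofReal (C / l) := by
  choose C hC0 hC using fun i => (order_potential Φ P a i (T := T)).supBound.exists_ceil_le
  have hB : ∀ i, C i ≤ ∑ i, C i := fun i =>
    Finset.single_le_sum (fun i _ => hC0 i) (Finset.mem_univ i)
  have hB0 : 0 ≤ ∑ i, C i := Finset.sum_nonneg fun i _ => hC0 i
  refine ⟨3 * ∑ i, C i, by positivity, fun l hl t ht => ?_⟩
  refine (hNegOneNorm_curl_le (fun i => potential Φ P a i ⌈l⌉₊) t (∑ i, C i) ((⌈l⌉₊ : ℝ)⁻¹)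
    (by positivity) hB0 (fun i x => ?_) (fun i => perturb_eq_curl Φ P a i _ (one_le_ceil hl))).trans
    (ENNReal.ofReal_le_ofReal ?_)
  · have := hC i l hl t ht x
    rw [Real.rpow_zero, mul_one] at this
    exact this.trans (hB i)
  · rw [div_eq_mul_inv]
    exact mul_le_mul_of_nonneg_left (inv_anti₀ (by linarith) (Nat.le_ceil l)) (by positivity)

end Perturbed

end HypoNS

end

/-! ### Assembly of the perturbed solution. -/

theorem mainTheorem7
    (θ : ℝ) (hθ₀ : 0 < θ) (hθ₁ : θ < 1 / 3) (T : ℝ) (hT : 0 < T)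
    (v : ℝ → E3 → E3) (p : ℝ → E3 → ℝ) (R : ℝ → E3 → Matrix (Fin 3) (Fin 3) ℝ)
    (hsol : IsSmoothSolution θ T v p R)
    (S : ℝ → E3 → Matrix (Fin 3) (Fin 3) ℝ)
    (hS : ∀ i j, SmoothField T (fun t x => S t x i j))
    (hSpos : ∀ t ∈ Set.Icc 0 T, ∀ x, (S t x).PosDef)
    (a : ℝ) (ha₀ : 0 < a) (ha₁ : a < 1) :
    ∃ (C : ℝ) (K : ℕ → ℝ), 1 ≤ C ∧ (∀ N, 1 ≤ K N) ∧
      ∀ ε : ℝ, 0 < ε → ∀ l : ℝ, 1 < l →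
        ∃ (v' : ℝ → E3 → E3) (p' : ℝ → E3 → ℝ) (R' : ℝ → E3 → Matrix (Fin 3) (Fin 3) ℝ),
          IsSmoothSolution θ T v' p' R' ∧
          (∀ t ∈ Set.Icc 0 T, t ∉ timeSuppTrace T S →
            v' t = v t ∧ p' t = p t ∧ R' t = R t) ∧
          (∀ t ∈ Set.Icc 0 T,
            ∫ x in cube, (‖v' t x‖ ^ 2 + (R' t x).trace)
              = ∫ x in cube, (‖v t x‖ ^ 2 + (R t x).trace)) ∧
          (∀ t ∈ Set.Icc 0 T,
            hNegOneNorm (fun x => v' t x - v t x) ≤ ENNReal.ofReal (C / l)) ∧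
          (∀ k : ℕ, k = 1 ∨ k = 2 → ∀ t ∈ Set.Icc 0 T,
            cNorm k (v' t) ≤ ENNReal.ofReal (C * l ^ k)) ∧
          (∀ N : ℕ, ∀ t ∈ Set.Icc 0 T,
            cNorm N (fun x => matVec (R t x - R' t x - S t x))
              ≤ ENNReal.ofReal (K N / l ^ (1 - 2 * θ - a - (N : ℝ)))) ∧
          (∃ μ : ℝ → ℝ,
            (∀ t ∈ Set.Icc 0 T, ∀ x, (R t x - R' t x - S t x).trace = μ t) ∧
            DifferentiableOn ℝ μ (Set.Icc 0 T) ∧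
            ∀ t ∈ Set.Icc 0 T, |derivWithin μ (Set.Icc 0 T) t| ≤ C * l ^ a) ∧
          DifferentiableOn ℝ (dissipationGap θ v' v) (Set.Icc 0 T) ∧
          ∀ t ∈ Set.Icc 0 T,
            |derivWithin (dissipationGap θ v' v) (Set.Icc 0 T) t| ≤ C * l ^ (2 * (θ + ε)) := by
  have hθ1 : θ < 1 := by linarith
  have hh0 : 0 < θ / 2 := by linarith
  have hh1 : θ / 2 < 1 := by linarith
  choose V hV hV0 using fun i => (hsol.smooth_v.coord i).exists_sm_compact hT
  obtain ⟨p₀, hp₀, -⟩ := hsol.smooth_p.exists_sm_compact hT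
  choose Q hQ _ using fun i j => (hsol.smooth_R i j).exists_sm_compact hT
  choose Z hZ _ using fun i j => (hS i j).exists_sm_compact hT
  -- The extensions vanish for `|t| > T + 1`, which makes the space-time field globally bounded and
  -- Lipschitz.
  obtain ⟨Φ⟩ := exists_transportMap V (T + 1) fun i t x => hV0 i t x
  have hZpos : ∀ t ∈ Icc 0 T, ∀ x, (Matrix.of fun i j => Z i j t x).PosDef := fun t ht x => by
    have : (Matrix.of fun i j => Z i j t x) = S t x := by
      ext i j
      exact hZ i j t ht x
    rw [this]
    exact hSpos t ht x
  obtain ⟨ι, _, f, P, b, hmean⟩ := exists_amplitude Φ hZpos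
  have hmeanS : ∀ t ∈ Icc 0 T, ∀ x i j, meanStress Φ P b i j t x = S t x i j :=
    fun t ht x i j => (hmean t ht x i j).trans (hZ i j t ht x)
  obtain ⟨M, π, hMsymm, hMord, hMeq⟩ := exists_small_stress Φ P b (T := T) hθ₀ hθ1
  obtain ⟨C₁, hC₁, hneg⟩ := exists_hNegOneNorm_perturb_le Φ P b T
  choose C₂ hC₂ hvel using fun k => exists_cNorm_le (fun i => order_newVelocity Φ P b i (T := T)) k
  choose C₃ hC₃ hstress using fun N => exists_cNorm_le (κ := Fin 3 × Fin 3)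
    (fun c => order_stressDefect Φ P b M hθ₀ hMord c.1 c.2) N
  obtain ⟨C₄, hC₄, hdμ⟩ := (supBound_dt_energyDefect Φ P b (T := T)).exists_ceil_le
  obtain ⟨C₅, hC₅, hdis⟩ :=
    (order_dissipationDefect Φ P b (T := T) hh0 hh1).supBound.proj_zero.exists_ceil_le
  have hC₅' : 0 ≤ (2 * Real.pi) ^ 3 * C₅ := by positivity
  set C := 1 + C₁ + C₂ 1 + C₂ 2 + C₄ + (2 * Real.pi) ^ 3 * C₅ with hC
  have hCk := hC₂ 1
  have hCk' := hC₂ 2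
  refine ⟨C, fun N => 1 + C₃ N, by linarith, fun N => by linarith [hC₃ N], fun ε hε l hl => ?_⟩
  have hl0 : 0 < l := by linarith
  have hn := one_le_ceil hl
  -- The frequency must be an integer for `q(t, nΦ)` to be periodic in space.
  set n := ⌈l⌉₊ with hnl
  have hdiff : ∀ t ∈ Icc 0 T, ∀ x i j, (R t x - (Matrix.of fun i j => newStress Φ P b M Q n i j t x)
      - S t x) i j = stressDefect Φ P b M i j n t x := by
    intro t ht x i j
    simp only [Matrix.sub_apply, Matrix.of_apply, newStress, Sm.sub_apply, hQ i j t ht x,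
      hmeanS t ht x i j]
    ring
  refine ⟨vecField (newVelocity Φ P b n), fun t x => newPressure M p₀ π n t x,
    fun t x => Matrix.of fun i j => newStress Φ P b M Q n i j t x, ?_, ?_, ?_, ?_, ?_, ?_, ?_, ?_, ?_⟩
  · refine isSmoothSolution_of_momentumDefect hT hθ₀.le hθ1.le (fun t ht x i => ?_)
      (fun t ht x i j => ?_) (fun t ht x => ?_)
    · rw [momentumDefect_new Φ P b M hθ₀.le hθ1.le p₀ Q π n i (hMeq i n hn),
        momentumDefect_apply hT hθ₀.le hθ1.le hV hp₀ hQ ht x i, hsol.momentum t ht x i]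
      ring
    · have hR := (hsol.symm_R t ht x).apply i j
      have hSs := (hZpos t ht x).isHermitian.apply i j
      simp only [Matrix.of_apply, star_trivial] at hSs
      simp only [newStress, Sm.sub_apply, stressDefect_symm Φ P b M hMsymm i j, hQ i j t ht x,
        hQ j i t ht x, hmean t ht x, hR, hSs]
    · have h := congrArg (fun g : Sm => g t x) (div_newVelocity Φ P b n hn)
      simp only [Sm.sum_apply] at h
      rw [h]
      simp only [Sm.dx_apply]
      have e : ∀ i, V i t = fun y => v t y i := fun i => funext fun y => hV i t ht y
      simp only [e]
      exact hsol.div_free t ht x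
  · intro t ht hts
    -- A positive definite matrix has positive trace, so the time support is all of `[0,T]` and
    -- there is no time left to check.
    have hmem : t ∈ {t | t ∈ Set.Icc 0 T ∧ ∃ x, (S t x).trace ≠ 0} :=
      ⟨ht, 0, (hSpos t ht 0).trace_pos.ne'⟩
    exact absurd (subset_closure hmem) hts
  · intro t ht
    have e1 : (fun x => ‖vecField (newVelocity Φ P b n) t x‖ ^ 2
        + (Matrix.of fun i j => newStress Φ P b M Q n i j t x).trace)
        = (∑ i, (newVelocity Φ P b n i ^ 2 + newStress Φ P b M Q n i i) : Sm) t := by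
      funext x
      simp [EuclideanSpace.real_norm_sq_eq, vecField, Matrix.trace, Finset.sum_add_distrib]
    have e2 : (fun x => ‖v t x‖ ^ 2 + (R t x).trace) = (∑ i, (V i ^ 2 + Q i i) : Sm) t := by
      funext x
      simp [EuclideanSpace.real_norm_sq_eq, Matrix.trace, Finset.sum_add_distrib, hV _ t ht x,
        hQ _ _ t ht x]
    rw [e1, e2, integral_cube_eq_proj_zero _ t 0, integral_cube_eq_proj_zero _ t 0,
      proj_zero_energy_new]
  · intro t ht
    have e : (fun x => vecField (newVelocity Φ P b n) t x - v t x)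
        = fun x => WithLp.toLp 2 fun i => perturb Φ P b i n t x := by
      funext x
      ext i
      simp [vecField, newVelocity, hV i t ht x]
    rw [e]
    exact (hneg l hl t ht).trans (ENNReal.ofReal_le_ofReal
      (div_le_div_of_nonneg_right (by linarith) hl0.le))
  · intro k hk t ht
    refine (hvel k l hl t ht).trans (ENNReal.ofReal_le_ofReal ?_)
    rw [zero_add, Real.rpow_natCast]
    refine mul_le_mul_of_nonneg_right ?_ (by positivity)
    rcases hk with rfl | rfl <;> linarith
  · intro N t ht
    have e : (fun x => matVec (R t x - (Matrix.of fun i j => newStress Φ P b M Q n i j t x) - S t x))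
        = fun x => WithLp.toLp 2 fun c : Fin 3 × Fin 3 => stressDefect Φ P b M c.1 c.2 n t x := by
      funext x
      ext c
      exact hdiff t ht x c.1 c.2
    rw [e]
    refine (hstress N l hl t ht).trans (ENNReal.ofReal_le_ofReal ?_)
    -- The construction gives the exponent `2θ - 1 + N`; the extra `a` in the claim is absorbed by
    -- monotonicity of powers, since `l > 1`.
    rw [div_eq_mul_inv, ← Real.rpow_neg hl0.le]
    exact mul_le_mul (by linarith) (Real.rpow_le_rpow_of_exponent_le hl.le (by linarith))
      (by positivity) (by linarith [hC₃ N])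
  · refine ⟨fun t => proj 0 (energyDefect Φ P b n) t 0, fun t ht x => ?_, fun t ht => ?_,
      fun t ht => ?_⟩
    · have h := congrArg (fun g : Sm => g t x) (trace_stressDefect Φ P b M n)
      simp only [Sm.sum_apply] at h
      simp only [Matrix.trace, Matrix.diag_apply, hdiff t ht x]
      rw [h, proj_zero_apply, proj_zero_apply]
    · exact ((proj 0 (energyDefect Φ P b n)).hasDerivAt_time t 0).differentiableAt.differentiableWithinAt
    · rw [((proj 0 (energyDefect Φ P b n)).hasDerivAt_time t 0).hasDerivWithinAt.derivWithin
        (uniqueDiffOn_Icc hT t ht)]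
      refine (hdμ l hl t ht 0).trans ?_
      exact mul_le_mul (by linarith) (Real.rpow_le_rpow_of_exponent_le hl.le ha₀.le)
        (by positivity) (by linarith)
  · exact fun t ht => (hasDerivWithinAt_dissipationGap hh0.le hh1.le hV ht).differentiableWithinAt
  · intro t ht
    rw [(hasDerivWithinAt_dissipationGap hh0.le hh1.le hV ht).derivWithin (uniqueDiffOn_Icc hT t ht),
      abs_mul, abs_of_nonneg (by positivity)]
    refine (mul_le_mul_of_nonneg_left (hdis l hl t ht 0) (by positivity)).trans ?_
    rw [← mul_assoc]
    exact mul_le_mul (by linarith) (Real.rpow_le_rpow_of_exponent_le hl.le (by linarith))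
      (by positivity) (by linarith)
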